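/- **Setting.** Let $n\ge 2$, $r\in\{n+4,n+5,\dots\}\cup\{\infty\}$, and $\mathbb T=\mathbb R/\mathbb Z$. Let $\mathcal D\subset\mathbb R^n$ be open with compact closure, $D\subset\mathbb R^2$ open with $0\in D$, and let $H_0(y,v,u)=F(y,f(v,u))$ on $\overline{\mathcal D}\times D$, with $F$ and $f$ of class $C^{r+1}$, be a Hamiltonian such that: $(0,0)$ is a nondegenerate saddle of $f$ and the unique critical point of $f$ on the connected component of $\{f=f(0,0)\}$ containing it, this component being compact; $\partial F/\partial f\,(y,f(0,0))\neq 0$ for all $y\in\overline{\mathcal D}$ (so that $(0,0)$ is a hyperbolic equilibrium of $H_0(y,\cdot)$); and $E(y)=H_0(y,0,0)$ has a nondegenerate Hessian at every $y\in\overline{\mathcal D}$. Put $\hat\nu=\partial E/\partial y$, and let $\lambda(y)>0$ be the positive eigenvalue of the linearization at $(0,0)$ of the Hamiltonian system with Hamiltonian $H_0(y,\cdot)$, i.e. $\lambda(y)=|\partial F/\partial f\,(y,f(0,0))|\,(-\det f''(0,0))^{1/2}$. For $0<\varepsilon<1$ put $\overline K=\frac1{10}|\log\varepsilon|$. A point $\eta\in\overline{\mathcal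 D}$ is resonant for $k=(\hat k,k_0)\in\mathbb Z^{n}\times\mathbb Z$ if $\langle\hat\nu(\eta),\hat k\rangle=k_0$. Let $k\neq0$ and let $\eta_*\in\mathcal D$ be resonant for $k$ and not a multiple resonance: every $l\in\mathbb Z^{n+1}$ for which $\eta_*$ is resonant is collinear with $k$. **Potential and good set.** For $\Theta=\Theta(\eta,\xi,\tau)\in C^r(\overline{\mathcal D}\times\mathbb T^{n+1})$ let $\partial=-\langle\hat\nu(\eta),\partial/\partial\xi\rangle+\partial/\partial\tau$, $\hat\Theta(\eta,\zeta,\tau)=\Theta(\eta,\zeta-\hat\nu(\eta)\tau,\tau)$, and $J_0=\{\partial\Theta=0,\ \partial^2\Theta\ne0\}\subset\overline{\mathcal D}\times\mathbb T^{n+1}$. Let $\pi(\rho,\zeta,\tau)=(\varepsilon\rho,\zeta-\hat\nu(\varepsilon\rho)\tau,\tau)$ and $\mathcal J_0=\pi^{-1}(J_0)\cap\{-1<\tau<1\}$. For $(\rho_0,\zeta_0,\tau_0)\in\mathcal J_0$ let $\tau=\Psi(\varepsilon\rho,\zeta,z)$ be the solution of $\hat\Theta_\tau(\varepsilon\rho,\zeta,\tau)=z$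 with $\Psi(\varepsilon\rho_0,\zeta_0,0)=\tau_0$. The set $\mathcal J_{c',c''}$ consists of those $(\rho_0,\zeta_0,\tau_0)\in\mathcal J_0$ for which $\Psi$ is defined and smooth (of class $C^{r-1}$) for all $\varepsilon\rho\in\overline{\mathcal D}$ with $\varepsilon^{3/4}|\rho-\rho_0|<c'$, $|\zeta-\zeta_0|<c'$, $|z|<c'$, and satisfies there $|\Psi|<2$, $|\Psi_\rho|<\varepsilon^{3/4}/c''$, $|\Psi_\zeta|<1/c''$, $|\Psi_z|<1/c''$. Finally $J_{c',c''}$ is the set of points of $J_0$ whose $\pi$-preimage meets $\mathcal J_{c',c''}$. **Typical sets.** A set $X\subset C^r(\overline{\mathcal D}\times\mathbb T^{n+1})$ is typical if it is open and dense in the $C^r$ topology and if, for every $l\ge1$, there is an open dense set of $C^r$ families $(\Theta_c)_{c\in B^l}$ ($B^l\subset\mathbb R^l$ the closed unit ball, $C^r$ jointly in all variables) for each of which $\Theta_c\in X$ for almost every $c\in B^l$. **Statement.** There is a typical set $X\subset C^r(\overline{\mathcal D}\times\mathbb T^{n+1})$ such that for every $\Theta\in X$ there is a number $\lambda_\Theta>0$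 with the following property. For every $\epsilon>0$ and every $C>0$ there is $\kappa>0$ such that for all $\varepsilon,c',c''\in(0,\kappa)$, all $p$ with $|p-\eta_*|\le C/|\log\varepsilon|$ and all unit vectors $\beta\in\mathbb R^n$ there exists a function $s=s_{\beta,p}:\mathbb T^n\to\big[0,(\overline K/\lambda(p))^{1/2}\big]$ such that 1. $\big(p,\ \zeta-\hat\nu(p)s(\zeta),\ \{s(\zeta)\}\big)\in J_{2c',2c''}$ for every $\zeta\in\mathbb T^n$, where $\{x\}$ is the fractional part of $x$; 2. the set of break points of $s$ (points near which $s$ is not of class $C^{r-1}$) lies in a finite union of smooth compact submanifolds of codimension $1$ in $\mathbb T^n$; 3. $\zeta\mapsto\hat\Theta_\zeta(p,\zeta,s(\zeta))$ is integrable on $\mathbb T^n$ and $\displaystyle\Big|\int_{\mathbb T^n}\hat\Theta_\zeta\big(p,\zeta,s(\zeta)\big)\,d\zeta-\lambda_\Theta\beta\Big|<\epsilon$. In particular $\lambda_\Theta$ does not depend on $\epsilon,C,\varepsilon,c',c'',p,\beta$. -/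

import Mathlib

open Set MeasureTheory Topology
open scoped ContDiff UniformConvergence

noncomputable section

namespace SeparatrixMap

/-- `ℝⁿ` with its Euclidean norm. -/
abbrev V (n : ℕ) : Type := EuclideanSpace ℝ (Fin n)

/-- The integer vector `m ∈ ℤⁿ`, as an element of `ℝⁿ`. -/
def intVec {n : ℕ} (m : Fin n → ℤ) : V n := WithLp.toLp 2 (fun i => (m i : ℝ))

/-! ### The unperturbed system -/

/-- Determinant of the Hessian matrix of a function of the two variables `(v, u)`. -/
def hessDet (f : ℝ × ℝ → ℝ) (z : ℝ × ℝ) : ℝ :=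
  iteratedFDeriv ℝ 2 f z ![(1, 0), (1, 0)] * iteratedFDeriv ℝ 2 f z ![(0, 1), (0, 1)]
    - iteratedFDeriv ℝ 2 f z ![(1, 0), (0, 1)] ^ 2

/-- The a priori unstable unperturbed Hamiltonian `H₀(y, v, u) = F(y, f(v, u))`, for `y` in the
closure of the bounded open set `dom ⊆ ℝⁿ` and `(v, u)` in the open set `D ⊆ ℝ²`. -/
structure UnperturbedSystem (n : ℕ) (r : ℕ∞) where
  dom : Set (V n)
  isOpen_dom : IsOpen dom
  isCompact_closure : IsCompact (closure dom)
  D : Set (ℝ × ℝ)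
  isOpen_D : IsOpen D
  zero_mem_D : (0 : ℝ × ℝ) ∈ D
  F : V n × ℝ → ℝ
  f : ℝ × ℝ → ℝ
  contDiffOn_f : ContDiffOn ℝ ((r : WithTop ℕ∞) + 1) f D
  contDiffAt_F : ∀ y ∈ closure dom, ∀ z ∈ D, ContDiffAt ℝ ((r : WithTop ℕ∞) + 1) F (y, f z)
  /-- `(0, 0)` is a nondegenerate saddle of `f` ... -/
  critical : fderiv ℝ f 0 = 0
  saddle : hessDet f 0 < 0
  /-- ... and the unique critical point of `f` on a compact connected component of
  `{(v, u) ∈ D : f(v, u) = f(0, 0)}`. -/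
  compact_component : IsCompact (connectedComponentIn {z ∈ D | f z = f 0} 0)
  unique_critical : ∀ z ∈ connectedComponentIn {z ∈ D | f z = f 0} 0, fderiv ℝ f z = 0 → z = 0
  /-- For every `y` the equilibrium `(0, 0)` of the Hamiltonian `H₀(y, ·)` is hyperbolic. -/
  hyperbolic : ∀ y ∈ closure dom, deriv (fun h => F (y, h)) (f 0) ≠ 0
  /-- The Hessian of `E(y) = H₀(y, 0, 0)` is nondegenerate. -/
  nondegenerate : ∀ y ∈ closure dom,
    Function.Bijective (fderiv ℝ (fun y' => gradient (fun x => F (x, f 0)) y') y)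

namespace UnperturbedSystem

variable {n : ℕ} {r : ℕ∞} (S : UnperturbedSystem n r)

/-- `H₀(y, v, u) = F(y, f(v, u))`. -/
def H₀ (y : V n) (z : ℝ × ℝ) : ℝ := S.F (y, S.f z)

/-- `E(y) = H₀(y, 0, 0)`. -/
def E (y : V n) : ℝ := S.H₀ y 0

/-- The frequency map `ν̂ = ∂E/∂y`. -/
def freq (y : V n) : V n := gradient S.E y

/-- `λ(y)`: the positive eigenvalue of the linearization at the equilibrium `(0, 0)` of the
Hamiltonian system with one degree of freedom and Hamiltonian `H₀(y, ·)`, i.e.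
`(- det Hess H₀(y, ·)(0, 0))^{1/2} = |∂F/∂f| (- det Hess f(0, 0))^{1/2}`. -/
def lam (y : V n) : ℝ := |deriv (fun h => S.F (y, h)) (S.f 0)| * Real.sqrt (-hessDet S.f 0)

/-- `y` lies on the resonance hypersurface of `k = (k̂, k₀)`: `⟨ν̂(y), k̂⟩ = k₀`, that is
`⟨ν(y), k⟩ = 0` for the frequency vector `ν = (-ν̂, 1)`. -/
def Resonant (y : V n) (k : (Fin n → ℤ) × ℤ) : Prop :=
  -(inner ℝ (S.freq y) (intVec k.1)) + (k.2 : ℝ) = 0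

end UnperturbedSystem

/-! ### The space `C^r(K × 𝕋ⁿ⁺¹)` and typical sets -/

/-- `C^r(K × 𝕋ⁿ⁺¹)`, for a closed set `K` of parameters: functions `Θ(η, ξ, τ)` of class `C^r` on
`K × ℝⁿ × ℝ` which have period one in each `ξᵢ` and in `τ`. Values at `η ∉ K` carry no
information and the topology below does not see them. -/
def CrSpace {P : Type} [NormedAddCommGroup P] [NormedSpace ℝ P] (n : ℕ) (r : ℕ∞) (K : Set P) :
    Type :=
  {Θ : P × V n × ℝ → ℝ //
    ContDiffOn ℝ (r : WithTop ℕ∞) Θ (K ×ˢ univ) ∧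
    ∀ η ∈ K, ∀ (ξ : V n) (τ : ℝ) (m : Fin n → ℤ) (j : ℤ),
      Θ (η, ξ + intVec m, τ + (j : ℝ)) = Θ (η, ξ, τ)}

/-- The `C^r` topology: uniform convergence of all derivatives of finite order at most `r`. All
sets `K` used below are closures of their interiors, so that uniform convergence over the interior
is uniform convergence over `K`. -/
instance {P : Type} [NormedAddCommGroup P] [NormedSpace ℝ P] (n : ℕ) (r : ℕ∞) (K : Set P) :
    TopologicalSpace (CrSpace n r K) :=
  ⨅ (j : ℕ) (_ : (j : ℕ∞) ≤ r), TopologicalSpace.induced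
    (fun Θ : CrSpace n r K => UniformFun.ofFun
      (fun x : {x : P × V n × ℝ // x.1 ∈ interior K} => iteratedFDeriv ℝ j Θ.1 x.1))
    inferInstance

/-- `C^r` families of elements of `C^r(K × 𝕋ⁿ⁺¹)` with parameter `c` in the closed unit ball
of `ℝˡ`: functions of class `C^r` of all the variables `(c, η, ξ, τ)`. -/
abbrev Family (l n : ℕ) (r : ℕ∞) (K : Set (V n)) : Type :=
  CrSpace (P := V l × V n) n r (Metric.closedBall (0 : V l) 1 ×ˢ K)

/-- The member of a family at the parameter value `c`. -/
def Family.slice {l n : ℕ} {r : ℕ∞} {K : Set (V n)} (𝓕 : Family l n r K) (c : V l)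
    (hc : c ∈ Metric.closedBall (0 : V l) 1) : CrSpace n r K :=
  ⟨fun q => 𝓕.1 ((c, q.1), q.2),
    𝓕.2.1.comp (t := (Metric.closedBall (0 : V l) 1 ×ˢ K) ×ˢ univ)
      (f := fun q : V n × V n × ℝ => (((c, q.1), q.2) : (V l × V n) × V n × ℝ))
      (ContDiff.contDiffOn (by fun_prop))
      (fun _ hq => ⟨⟨hc, hq.1⟩, mem_univ _⟩),
    fun η hη ξ τ m j => 𝓕.2.2 (c, η) ⟨hc, hη⟩ ξ τ m j⟩

/-- Typical sets: open and dense, and of full measure in every family of an open dense set of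
families depending on finitely many (at least one) parameters. -/
def IsTypical {n : ℕ} {r : ℕ∞} {K : Set (V n)} (X : Set (CrSpace n r K)) : Prop :=
  IsOpen X ∧ Dense X ∧
  ∀ l : ℕ, 1 ≤ l → ∃ 𝓤 : Set (Family l n r K), IsOpen 𝓤 ∧ Dense 𝓤 ∧
    ∀ 𝓕 ∈ 𝓤, ∀ᵐ c ∂(volume : Measure (V l)),
      ∀ hc : c ∈ Metric.closedBall (0 : V l) 1, 𝓕.slice c hc ∈ X

/-! ### The Poincaré–Melnikov potential and the good set

A subset of `𝕋ⁿ` or of `𝕋ⁿ⁺¹` is described by coordinates in `ℝⁿ` or `ℝⁿ × ℝ` modulo integers. -/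

section Good

variable {n : ℕ} {r : ℕ∞} (S : UnperturbedSystem n r) (Θ : V n × V n × ℝ → ℝ)

/-- The operator `∂ = -⟨ν̂(η), ∂/∂ξ⟩ + ∂/∂τ`. -/
def dNu (Θ : V n × V n × ℝ → ℝ) : V n × V n × ℝ → ℝ := fun q =>
  lineDeriv ℝ (fun x : V n × ℝ => Θ (q.1, x)) q.2 (-S.freq q.1, (1 : ℝ))

/-- `Θ̂(η, ζ, τ) = Θ(η, ζ - ν̂(η) τ, τ)`. -/
def hat (η ζ : V n) (τ : ℝ) : ℝ := Θ (η, ζ - τ • S.freq η, τ)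

/-- The partial derivative `Θ̂_τ`. -/
def hatTau (η ζ : V n) (τ : ℝ) : ℝ := deriv (fun t => hat S Θ η ζ t) τ

/-- The partial derivative `Θ̂_ζ` (a vector in `ℝⁿ`). -/
def hatZeta (η ζ : V n) (τ : ℝ) : V n := gradient (fun z => hat S Θ η z τ) ζ

/-- `J₀`: points `(η, ξ, τ)` where `∂Θ = 0` and `∂²Θ ≠ 0`. -/
def J₀ : Set (V n × V n × ℝ) :=
  {q | q.1 ∈ closure S.dom ∧ dNu S Θ q = 0 ∧ dNu S (dNu S Θ) q ≠ 0}

/-- `π(ρ, ζ, τ) = (ερ, ζ - ν̂(ερ) τ, τ)`. -/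
def proj (eps : ℝ) (w : V n × V n × ℝ) : V n × V n × ℝ :=
  (eps • w.1, w.2.1 - w.2.2 • S.freq (eps • w.1), w.2.2)

/-- `𝒥₀ = π⁻¹(J₀) ∩ {-1 < τ < 1}`. -/
def calJ₀ (eps : ℝ) : Set (V n × V n × ℝ) :=
  {w | proj S eps w ∈ J₀ S Θ ∧ -1 < w.2.2 ∧ w.2.2 < 1}

/-- The points `(ρ, ζ, z)` with `ερ` in the closed domain, `ε^{3/4} |ρ - ρ₀| < c'`,
`|ζ - ζ₀| < c'` and `|z| < c'`. -/
def nbhd (eps c' : ℝ) (ρ₀ ζ₀ : V n) : Set (V n × V n × ℝ) :=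
  {w | eps • w.1 ∈ closure S.dom ∧ eps ^ (3 / 4 : ℝ) * ‖w.1 - ρ₀‖ < c' ∧
    ‖w.2.1 - ζ₀‖ < c' ∧ |w.2.2| < c'}

/-- `𝒥_{c',c''}`: points `(ρ₀, ζ₀, τ₀) ∈ 𝒥₀` such that the solution `τ = Ψ(ερ, ζ, z)` of
`Θ̂_τ(ερ, ζ, τ) = z` with `Ψ(ερ₀, ζ₀, 0) = τ₀` is defined and smooth on the whole set `nbhd` and
satisfies there `|Ψ| < 2`, `|Ψ_ρ| < ε^{3/4}/c''`, `|Ψ_ζ| < 1/c''`, `|Ψ_z| < 1/c''`.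
Below, `ψ(ρ, ζ, z) = Ψ(ερ, ζ, z)`; since `Θ` is of class `C^r`, smooth means `C^{r-1}`. -/
def calJ (eps c' c'' : ℝ) : Set (V n × V n × ℝ) :=
  {w₀ | w₀ ∈ calJ₀ S Θ eps ∧ ∃ ψ : V n × V n × ℝ → ℝ,
    ContDiffOn ℝ ((r - 1 : ℕ∞) : WithTop ℕ∞) ψ (nbhd S eps c' w₀.1 w₀.2.1) ∧
    ψ (w₀.1, w₀.2.1, 0) = w₀.2.2 ∧
    ∀ w ∈ nbhd S eps c' w₀.1 w₀.2.1,
      hatTau S Θ (eps • w.1) w.2.1 (ψ w) = w.2.2 ∧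
      |ψ w| < 2 ∧
      ‖fderivWithin ℝ (fun ρ => ψ (ρ, w.2.1, w.2.2)) {ρ | eps • ρ ∈ closure S.dom} w.1‖
        < eps ^ (3 / 4 : ℝ) / c'' ∧
      ‖fderiv ℝ (fun ζ => ψ (w.1, ζ, w.2.2)) w.2.1‖ < 1 / c'' ∧
      |deriv (fun z => ψ (w.1, w.2.1, z)) w.2.2| < 1 / c''}

/-- `J_{c',c''}`: points `(η, ξ, τ) ∈ J₀` (with `ξ`, `τ` modulo integers) such that
`π⁻¹(η, ξ, τ)` meets `𝒥_{c',c''}`. -/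
def J (eps c' c'' : ℝ) : Set (V n × V n × ℝ) :=
  {q | q ∈ J₀ S Θ ∧ ∃ w ∈ calJ S Θ eps c' c'', ∃ (m : Fin n → ℤ) (j : ℤ),
    proj S eps w = (q.1, q.2.1 + intVec m, q.2.2 + (j : ℝ))}

end Good

/-! ### Functions and hypersurfaces on the torus -/

/-- A smooth compact submanifold of codimension one (without boundary, possibly empty) of
`𝕋ⁿ = ℝⁿ/ℤⁿ`, given by its preimage in `ℝⁿ`: a closed `ℤⁿ`-invariant set which is locally the
zero set of a smooth function with nonvanishing differential. -/
def IsTorusHypersurface {n : ℕ} (N : Set (V n)) : Prop :=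
  IsClosed N ∧ (∀ ζ ∈ N, ∀ m : Fin n → ℤ, ζ + intVec m ∈ N) ∧
  ∀ ζ ∈ N, ∃ U : Set (V n), IsOpen U ∧ ζ ∈ U ∧ ∃ g : V n → ℝ,
    ContDiffOn ℝ ∞ g U ∧ (∀ x ∈ U, fderiv ℝ g x ≠ 0) ∧ N ∩ U = {x ∈ U | g x = 0}

/-- Break points: points near which `s` is not smooth (of class `C^{r-1}`). -/
def breakPoints {n : ℕ} (r : ℕ∞) (s : V n → ℝ) : Set (V n) :=
  {ζ | ¬ ContDiffAt ℝ ((r - 1 : ℕ∞) : WithTop ℕ∞) s ζ}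

/-- The fundamental domain `[0, 1)ⁿ` of the torus. -/
def unitCube (n : ℕ) : Set (V n) := {ζ | ∀ i, ζ i ∈ Ico (0 : ℝ) 1}

end SeparatrixMap

end

open Set MeasureTheory Topology
open scoped ContDiff UniformConvergence

noncomputable section

namespace SeparatrixMap

variable {n : ℕ}

/-! Write ν for the frequency at η_* and g(ζ, τ) = Θ(η_*, ζ - τν, τ). Points of J₀ over η_* are
nondegenerate zeros of g_τ, so what is wanted is a choice s(ζ) of such zeros along which g_ζ has
average close to λβ. A choice is encoded by a finite-valued function of ζ, locally constant off a
periodic grid of hyperplanes, whose value is an interval in (0, ∞) isolating one zero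
(`IsSelection`). The conditions on the interval are open, so a choice made at η_* persists over all
nearby p with uniform neighbourhoods; its values stay bounded, whereas the allowed range of s grows
with |log ε|.

Averages. Alternating two choices on a fine checkerboard gives nearly the midpoint of their averages
(`exists_midpoint`), so the closure of the set of averages is convex. If every unit vector b has a
choice whose average has positive component along b (`IsGood`), then compactness of the sphere and
separation of convex sets put all λβ into this closure for some λ > 0 (`exists_average`).

Positivity. M(ζ) = sup_τ g(ζ, τ) is Lipschitz and periodic, so ∂_b M has mean zero, and for almost
every ζ the zeros of g_τ with value close to M(ζ) have ⟨g_ζ, b⟩ at least ∂_b M up to a small error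
(`touching`). Only a strict gain is missing. Let S be the maximum over a compact window of τ which
at some ζ₀ contains a point of global maximum. Where S is reached inside the window, ∂_b S is
available too. If no choice along b has positive average, then ∂_b S ≤ ∂_b M there; as S ≤ M with
equality at ζ₀, equality holds on a whole segment from ζ₀ in the direction -b. Now M is invariant
under translation by ν. A simple resonance with n ≥ 2 excludes integer multiples of ν, so M is
invariant along a line ℝw (`exists_invariant_direction`), and wherever M is attained both g_τ = 0
and ⟨g_ζ, w⟩ = 0. At m equally spaced points of the segment these are 2m equations in 2n + m
unknowns (the first point, the step, the times), impossible for generic Θ when m > 2n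
(`IsQuasiPeriodic.isGood`).

Genericity. Trigonometric polynomials interpolate the required derivatives at m distinct points of
the torus (`exists_interpolating`), so almost every perturbation in a finite-dimensional space
avoids every overdetermined system of this kind (`ae_forall_ne_of_finrank_lt`, `ae_isGeneric`); l
extra parameters only require l more points. Goodness at η_* is open in Θ, and the good potentials
are the typical set (`isTypical_goodAt`). -/

@[simp] lemma intVec_apply (m : Fin n → ℤ) (i : Fin n) : intVec m i = (m i : ℝ) := rfl

lemma intVec_neg (m : Fin n → ℤ) : intVec (-m) = -intVec m := by
  ext i; simp

lemma intVec_zero : intVec (0 : Fin n → ℤ) = 0 := by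
  ext i; simp

/-! ### Periodic functions and the unit cube. -/

/-- Functions with period one in every coordinate. -/
def IsPeriodic {X : Type*} (f : V n → X) : Prop := ∀ ζ (m : Fin n → ℤ), f (ζ + intVec m) = f ζ

/-- The integer part of a vector. -/
def floorVec (ζ : V n) : Fin n → ℤ := fun i => ⌊ζ i⌋

/-- The representative in the unit cube. -/
def fractVec (ζ : V n) : V n := ζ - intVec (floorVec ζ)

lemma fractVec_apply (ζ : V n) (i : Fin n) : fractVec ζ i = Int.fract (ζ i) := by
  simp [fractVec, floorVec]

lemma fractVec_mem (ζ : V n) : fractVec ζ ∈ unitCube n := fun i => by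
  rw [fractVec_apply]; exact ⟨Int.fract_nonneg _, Int.fract_lt_one _⟩

lemma fractVec_eq (ζ : V n) : fractVec ζ = ζ + intVec (-floorVec ζ) := by
  rw [intVec_neg]; rfl

lemma IsPeriodic.fractVec {X : Type*} {f : V n → X} (hf : IsPeriodic f) (ζ : V n) :
    f (fractVec ζ) = f ζ := by
  rw [fractVec_eq, hf]

/-- The closed unit cube. -/
def closedCube (n : ℕ) : Set (V n) := {ζ | ∀ i, ζ i ∈ Icc (0 : ℝ) 1}

lemma unitCube_subset : unitCube n ⊆ closedCube n := fun _ h i => ⟨(h i).1, (h i).2.le⟩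

lemma isCompact_closedCube : IsCompact (closedCube n) := by
  have h : IsCompact (univ.pi fun _ : Fin n => Icc (0 : ℝ) 1) :=
    isCompact_univ_pi fun _ => isCompact_Icc
  convert (EuclideanSpace.equiv (Fin n) ℝ).toHomeomorph.isClosedEmbedding.isCompact_preimage h
  ext ζ; simp [closedCube, Pi.le_def, forall_and]

lemma measurableSet_unitCube : MeasurableSet (unitCube n) := by
  have : unitCube n = ⋂ i, {ζ : V n | ζ i ∈ Ico (0 : ℝ) 1} := by
    ext; simp [unitCube]
  rw [this]
  refine MeasurableSet.iInter fun i => ?_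
  exact measurableSet_Ico.preimage (by fun_prop : Continuous fun ζ : V n => ζ i).measurable

lemma volume_unitCube_lt_top : volume (unitCube n) < ⊤ :=
  (measure_mono unitCube_subset).trans_lt isCompact_closedCube.measure_lt_top

instance : IsFiniteMeasure (volume.restrict (unitCube n)) :=
  ⟨by simpa using volume_unitCube_lt_top⟩

/-- The standard basis, whose integer span is the lattice `ℤⁿ`. -/
def stdBasis (n : ℕ) : Module.Basis (Fin n) ℝ (V n) := (EuclideanSpace.basisFun (Fin n) ℝ).toBasis

lemma unitCube_eq : unitCube n = ZSpan.fundamentalDomain (stdBasis n) := by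
  ext ζ; simp [unitCube, ZSpan.mem_fundamentalDomain, stdBasis]

lemma exists_intVec_of_mem_span {x : V n} (hx : x ∈ Submodule.span ℤ (range (stdBasis n))) :
    ∃ m : Fin n → ℤ, x = intVec m := by
  rw [Module.Basis.mem_span_iff_repr_mem (R := ℤ)] at hx
  choose m hm using hx
  refine ⟨m, ?_⟩
  ext i
  simpa [stdBasis] using (hm i).symm

instance : Countable (Submodule.span ℤ (range (stdBasis n))).toAddSubgroup :=
  inferInstanceAs (Countable (Submodule.span ℤ (range (stdBasis n))))

lemma isAddFundamentalDomain_unitCube :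
    IsAddFundamentalDomain (Submodule.span ℤ (range (stdBasis n))).toAddSubgroup (unitCube n)
      volume := by
  rw [unitCube_eq]; exact ZSpan.isAddFundamentalDomain' _ _

lemma IsPeriodic.vadd {X : Type*} {f : V n → X} (hf : IsPeriodic f)
    (g : (Submodule.span ℤ (range (stdBasis n))).toAddSubgroup) (x : V n) : f (g +ᵥ x) = f x := by
  obtain ⟨m, hm⟩ := exists_intVec_of_mem_span g.2
  have : g +ᵥ x = x + intVec m := by rw [← hm, add_comm]; rfl
  rw [this, hf]

/-- A translate of the cube is again a fundamental domain of ℤⁿ, and a periodic function has the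
same integral over any two of them. -/
lemma IsPeriodic.setIntegral_add {E : Type*} [NormedAddCommGroup E] [NormedSpace ℝ E]
    {f : V n → E} (hf : IsPeriodic f) (h : V n) :
    ∫ ζ in unitCube n, f (ζ + h) = ∫ ζ in unitCube n, f ζ := by
  have hmp : MeasurePreserving (fun ζ : V n => ζ + h) volume volume :=
    measurePreserving_add_right volume h
  have hemb : MeasurableEmbedding (fun ζ : V n => ζ + h) := measurableEmbedding_addRight h
  have e1 : ∫ ζ in unitCube n, f (ζ + h)
      = ∫ ζ in (fun ζ : V n => ζ + (-h)) ⁻¹' unitCube n, f ζ := by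
    rw [← hmp.setIntegral_preimage_emb hemb (fun ζ => f ζ)
      ((fun ζ : V n => ζ + (-h)) ⁻¹' unitCube n)]
    congr 2
    ext; simp
  rw [e1]
  refine IsAddFundamentalDomain.setIntegral_eq
    (G := (Submodule.span ℤ (range (stdBasis n))).toAddSubgroup) ?_ isAddFundamentalDomain_unitCube
    (fun g x => hf.vadd g x)
  have := (isAddFundamentalDomain_unitCube (n := n)).vadd_of_comm h
  convert this using 1
  ext x
  rw [mem_vadd_set_iff_neg_vadd_mem, vadd_eq_add, add_comm]
  rfl

lemma ae_of_ae_unitCube {P : V n → Prop} (hP : IsPeriodic P)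
    (h : ∀ᵐ ζ ∂volume.restrict (unitCube n), P ζ) : ∀ᵐ ζ : V n, P ζ := by
  have h0 : volume ({ζ | ¬ P ζ} ∩ unitCube n) = 0 := by
    have := (ae_restrict_iff' measurableSet_unitCube).1 h
    rw [ae_iff] at this
    refine measure_mono_null ?_ this
    rintro ζ ⟨h1, h2⟩; simpa using ⟨h2, h1⟩
  rw [ae_iff]
  refine measure_mono_null (t := ⋃ m : Fin n → ℤ,
    (fun ζ : V n => ζ + intVec m) ⁻¹' ({ζ | ¬ P ζ} ∩ unitCube n)) ?_ ?_
  · intro ζ hζ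
    refine mem_iUnion.2 ⟨-floorVec ζ, ?_, ?_⟩
    · simpa [hP ζ] using hζ
    · show ζ + intVec (-floorVec ζ) ∈ unitCube n
      rw [← fractVec_eq]; exact fractVec_mem ζ
  · refine measure_iUnion_null fun m => ?_
    rw [measure_preimage_add_right]; exact h0

/-! ### Grids of hyperplanes and functions constant on their cells. -/

/-- The hyperplanes of the grid of mesh `1 / N`. -/
def gridPlanes (n N : ℕ) : Set (V n) := {ζ | ∃ i, ∃ j : ℤ, (N : ℝ) * ζ i = j}

lemma gridPlane_isTorusHypersurface {N : ℕ} (hN : 0 < N) (i : Fin n) :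
    IsTorusHypersurface {ζ : V n | ∃ j : ℤ, (N : ℝ) * ζ i = j} := by
  have hc : Continuous fun ζ : V n => (N : ℝ) * ζ i := by fun_prop
  refine ⟨?_, ?_, ?_⟩
  · have : IsClosed (range ((↑) : ℤ → ℝ)) := Int.isClosedEmbedding_coe_real.isClosed_range
    convert this.preimage hc using 1
    ext ζ; simp [eq_comm]
  · rintro ζ ⟨j, hj⟩ m
    refine ⟨j + N * m i, ?_⟩
    simp [mul_add, hj]
  · rintro ζ ⟨j, hj⟩
    refine ⟨{x | |(N : ℝ) * x i - j| < 1}, ?_, by simp [hj], fun x => (N : ℝ) * x i - j, ?_, ?_, ?_⟩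
    · exact isOpen_lt (by fun_prop) continuous_const
    · exact ContDiff.contDiffOn (by fun_prop)
    · intro x _ h0
      have hd : HasFDerivAt (fun x : V n => (N : ℝ) * x i - j)
          ((N : ℝ) • (EuclideanSpace.proj i : V n →L[ℝ] ℝ)) x :=
        ((EuclideanSpace.proj i : V n →L[ℝ] ℝ).hasFDerivAt.const_mul (N : ℝ)).sub_const _
      rw [hd.fderiv] at h0
      have := congrArg (fun L : V n →L[ℝ] ℝ => L (EuclideanSpace.single i 1)) h0
      simp at this
      omega
    · ext x
      simp only [mem_inter_iff, mem_ofPred_eq]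
      constructor
      · rintro ⟨⟨j', hj'⟩, h⟩
        refine ⟨h, ?_⟩
        rw [hj'] at h ⊢
        have h2 : |j' - j| < 1 := by exact_mod_cast h
        rw [Int.abs_lt_one_iff, sub_eq_zero] at h2
        simp [h2]
      · rintro ⟨h, h2⟩
        exact ⟨⟨j, by linarith⟩, h⟩

lemma gridPlanes_eq (n N : ℕ) :
    gridPlanes n N = ⋃ i : Fin n, {ζ : V n | ∃ j : ℤ, (N : ℝ) * ζ i = j} := by
  ext; simp [gridPlanes]

lemma isOpen_compl_gridPlanes {N : ℕ} (hN : 0 < N) : IsOpen (gridPlanes n N)ᶜ := by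
  rw [isOpen_compl_iff, gridPlanes_eq]
  exact isClosed_iUnion_of_finite fun i => (gridPlane_isTorusHypersurface hN i).1

lemma volume_gridPlanes {N : ℕ} (hN : 0 < N) : volume (gridPlanes n N) = 0 := by
  have : gridPlanes n N = ⋃ (i : Fin n) (j : ℤ), {ζ : V n | (N : ℝ) * ζ i = j} := by
    ext; simp [gridPlanes]
  rw [this]
  refine measure_iUnion_null fun i => measure_iUnion_null fun j => ?_
  have hN' : (N : ℝ) ≠ 0 := by exact_mod_cast hN.ne'
  have e : {ζ : V n | (N : ℝ) * ζ i = j} = (AffineSubspace.mk' (EuclideanSpace.single i ((j : ℝ) / N))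
      (LinearMap.ker (EuclideanSpace.proj i : V n →L[ℝ] ℝ).toLinearMap) : Set (V n)) := by
    ext ζ
    simp only [mem_ofPred_eq, SetLike.mem_coe, AffineSubspace.mem_mk', vsub_eq_sub,
      LinearMap.mem_ker, ContinuousLinearMap.coe_coe, map_sub]
    rw [sub_eq_zero]
    simp only [PiLp.proj_apply, PiLp.single_apply, ite_true]
    rw [eq_div_iff hN', mul_comm]
  rw [e]
  refine Measure.addHaar_affineSubspace _ _ fun htop => ?_
  have h1 := (AffineSubspace.mem_top ℝ (V n) (EuclideanSpace.single i ((j : ℝ) / N + 1)))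
  rw [← htop] at h1
  simp [AffineSubspace.mem_mk'] at h1

/-- Multiplying N refines the grid, so finitely many grid functions are locally constant off one
common grid. -/
lemma gridPlanes_mul_left {N M : ℕ} : gridPlanes n N ⊆ gridPlanes n (M * N) := by
  rintro ζ ⟨i, j, h⟩
  exact ⟨i, M * j, by push_cast; rw [mul_assoc, h]⟩

/-- Periodic functions with finitely many values which are locally constant off the hyperplanes
of some grid. -/
structure IsGrid {X : Type*} (A : V n → X) : Prop where
  periodic : IsPeriodic A
  finite : (range A).Finite
  locConst : ∃ N : ℕ, 0 < N ∧ ∀ ζ ∉ gridPlanes n N, ∀ᶠ ζ' in 𝓝 ζ, A ζ' = A ζ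

lemma IsGrid.comp {X Y : Type*} {A : V n → X} (hA : IsGrid A) (φ : X → Y) :
    IsGrid fun ζ => φ (A ζ) where
  periodic ζ m := congrArg φ (hA.periodic ζ m)
  finite := by
    have := hA.finite.image φ
    rwa [← range_comp] at this
  locConst := by
    obtain ⟨N, hN, h⟩ := hA.locConst
    exact ⟨N, hN, fun ζ hζ => (h ζ hζ).mono fun ζ' e => congrArg φ e⟩

lemma IsGrid.ite {X : Type*} {A B : V n → X} (hA : IsGrid A) (hB : IsGrid B) {c : V n → Prop}
    [DecidablePred c] (hc : IsGrid c) : IsGrid fun ζ => if c ζ then A ζ else B ζ where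
  periodic ζ m := by
    have := hc.periodic ζ m
    simp only [hA.periodic ζ m, hB.periodic ζ m]
    by_cases h : c ζ
    · rw [if_pos h, if_pos (this.mpr h)]
    · rw [if_neg h, if_neg fun h' => h (this.mp h')]
  finite := by
    refine (hA.finite.union hB.finite).subset ?_
    rintro _ ⟨ζ, rfl⟩
    by_cases h : c ζ <;> simp [h]
  locConst := by
    obtain ⟨N, hN, h⟩ := hA.locConst
    obtain ⟨N', hN', h'⟩ := hB.locConst
    obtain ⟨M, hM, hm⟩ := hc.locConst
    refine ⟨N * N' * M, by positivity, fun ζ hζ => ?_⟩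
    have z1 : ζ ∉ gridPlanes n N := fun hh => hζ (by
      have := gridPlanes_mul_left (M := N' * M) hh; convert this using 2; ring)
    have z2 : ζ ∉ gridPlanes n N' := fun hh => hζ (by
      have := gridPlanes_mul_left (M := N * M) hh; convert this using 2; ring)
    have z3 : ζ ∉ gridPlanes n M := fun hh => hζ (gridPlanes_mul_left hh)
    filter_upwards [h ζ z1, h' ζ z2, hm ζ z3] with ζ' e1 e2 e3
    simp only [e1, e2]
    by_cases hh : c ζ
    · rw [if_pos hh, if_pos (e3.mpr hh)]
    · rw [if_neg hh, if_neg fun h' => hh (e3.mp h')]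

lemma aestronglyMeasurable_of_continuousAt {E : Type*} [NormedAddCommGroup E] {f : V n → E} {N : ℕ}
    (hN : 0 < N) (hf : ∀ ζ ∉ gridPlanes n N, ContinuousAt f ζ) : AEStronglyMeasurable f volume := by
  have h1 : AEStronglyMeasurable f (volume.restrict (gridPlanes n N)ᶜ) := by
    exact ContinuousOn.aestronglyMeasurable (fun ζ hζ => (hf ζ hζ).continuousWithinAt)
      (isOpen_compl_gridPlanes hN).measurableSet
  rwa [Measure.restrict_eq_self_of_ae_mem] at h1
  rw [ae_iff]
  simpa using volume_gridPlanes hN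

/-! ### Brackets of nondegenerate zeros, and openness of goodness. -/

/-- On the interval `[a.1, a.2]` of length less than one in `(0, ∞)` the function `g₁(ζ, ·)`
changes sign and the function `g₂(ζ, ·)` (its derivative) does not vanish. -/
def IsBracket (g₁ g₂ : V n → ℝ → ℝ) (a : ℝ × ℝ) (ζ : V n) : Prop :=
  0 < a.1 ∧ a.1 < a.2 ∧ a.2 < a.1 + 1 ∧ g₁ ζ a.1 * g₁ ζ a.2 < 0 ∧ ∀ τ ∈ Icc a.1 a.2, g₂ ζ τ ≠ 0

/-- A bracket on which the component of `gz` along `b` is larger than the weight `a.2`. -/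
def IsWeightedBracket (g₁ g₂ : V n → ℝ → ℝ) (gz : V n → ℝ → V n) (b : V n) (a : (ℝ × ℝ) × ℝ)
    (ζ : V n) : Prop :=
  IsBracket g₁ g₂ a.1 ζ ∧ ∀ τ ∈ Icc a.1.1 a.1.2, a.2 < inner ℝ (gz ζ τ) b

/-- A choice of brackets which depends on `ζ` through a grid. -/
def IsSelection (g₁ g₂ : V n → ℝ → ℝ) (A : V n → ℝ × ℝ) : Prop :=
  IsGrid A ∧ ∀ ζ, ∀ᶠ ζ' in 𝓝 ζ, IsBracket g₁ g₂ (A ζ') ζ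

/-- In every direction there is a choice of brackets with positive average of the weights. -/
def IsGood (g₁ g₂ : V n → ℝ → ℝ) (gz : V n → ℝ → V n) : Prop :=
  ∀ b : V n, ‖b‖ = 1 → ∃ A : V n → (ℝ × ℝ) × ℝ, IsGrid A ∧ 0 < ∫ ζ in unitCube n, (A ζ).2 ∧
    ∀ ζ, ∀ᶠ ζ' in 𝓝 ζ, IsWeightedBracket g₁ g₂ gz b (A ζ') ζ

lemma isOpen_forall_mem_Icc {T : Type*} [TopologicalSpace T] {P : T → ℝ → Prop} {a b : ℝ}
    (hP : IsOpen {z : T × ℝ | P z.1 z.2}) : IsOpen {t | ∀ τ ∈ Icc a b, P t τ} := by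
  rw [isOpen_iff_eventually]
  intro t ht
  exact isCompact_Icc.eventually_forall_of_forall_eventually
    fun τ hτ => isOpen_iff_eventually.1 hP (t, τ) (ht τ hτ)

lemma isOpen_isBracket {T : Type*} [TopologicalSpace T] {g₁ g₂ : T → V n → ℝ → ℝ}
    (h₁ : Continuous fun z : T × V n × ℝ => g₁ z.1 z.2.1 z.2.2)
    (h₂ : Continuous fun z : T × V n × ℝ => g₂ z.1 z.2.1 z.2.2) (a : ℝ × ℝ) :
    IsOpen {z : T × V n | IsBracket (g₁ z.1) (g₂ z.1) a z.2} := by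
  have e : ∀ τ : ℝ, Continuous fun z : T × V n => g₁ z.1 z.2 τ := fun τ =>
    h₁.comp (by fun_prop : Continuous fun z : T × V n => (z.1, z.2, τ))
  refine isOpen_const.inter (isOpen_const.inter (isOpen_const.inter (IsOpen.inter ?_ ?_)))
  · exact isOpen_lt ((e _).mul (e _)) continuous_const
  · refine isOpen_forall_mem_Icc (P := fun (z : T × V n) τ => g₂ z.1 z.2 τ ≠ 0)
      (isOpen_ne_fun ?_ continuous_const)
    exact h₂.comp (by fun_prop : Continuous fun z : (T × V n) × ℝ => (z.1.1, z.1.2, z.2))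

lemma isOpen_isWeightedBracket {T : Type*} [TopologicalSpace T] {g₁ g₂ : T → V n → ℝ → ℝ}
    {gz : T → V n → ℝ → V n}
    (h₁ : Continuous fun z : T × V n × ℝ => g₁ z.1 z.2.1 z.2.2)
    (h₂ : Continuous fun z : T × V n × ℝ => g₂ z.1 z.2.1 z.2.2)
    (hz : Continuous fun z : T × V n × ℝ => gz z.1 z.2.1 z.2.2) (a : (ℝ × ℝ) × ℝ) :
    IsOpen {z : (T × V n) × V n | IsWeightedBracket (g₁ z.1.1) (g₂ z.1.1) (gz z.1.1) z.1.2 a z.2} := by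
  refine IsOpen.inter ?_ ?_
  · exact isOpen_isBracket (T := T × V n) (g₁ := fun t => g₁ t.1) (g₂ := fun t => g₂ t.1)
      (h₁.comp (by fun_prop : Continuous fun z : (T × V n) × V n × ℝ => (z.1.1, z.2.1, z.2.2)))
      (h₂.comp (by fun_prop : Continuous fun z : (T × V n) × V n × ℝ => (z.1.1, z.2.1, z.2.2))) a.1
  · refine isOpen_forall_mem_Icc (P := fun (z : (T × V n) × V n) τ =>
      a.2 < inner ℝ (gz z.1.1 z.2 τ) z.1.2) (isOpen_lt continuous_const ?_)
    have h := hz.comp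
      (by fun_prop : Continuous fun z : ((T × V n) × V n) × ℝ => (z.1.1.1, z.1.2, z.2))
    exact h.inner (by fun_prop)

/-- Open periodic conditions satisfied by a grid function persist under small changes of the
parameter. -/
lemma IsGrid.eventually_robust {T X : Type*} [TopologicalSpace T] {Q : X → T → V n → Prop}
    (hQ : ∀ a, IsOpen {z : T × V n | Q a z.1 z.2}) (hper : ∀ a t, IsPeriodic (Q a t))
    {A : V n → X} (hA : IsGrid A) {t₀ : T} (h : ∀ ζ, ∀ᶠ ζ' in 𝓝 ζ, Q (A ζ') t₀ ζ) :
    ∀ᶠ t in 𝓝 t₀, ∀ ζ, ∀ᶠ ζ' in 𝓝 ζ, Q (A ζ') t ζ := by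
  have key : ∀ᶠ t in 𝓝 t₀, ∀ ζ ∈ closedCube n, ∀ᶠ ζ' in 𝓝 ζ, Q (A ζ') t ζ := by
    refine isCompact_closedCube.eventually_forall_of_forall_eventually
      (P := fun t ζ => ∀ᶠ ζ' in 𝓝 ζ, Q (A ζ') t ζ) fun ζ₀ _ => ?_
    -- Only finitely many values `a` occur, so one neighbourhood serves all those admissible at
    -- `ζ₀`. Every value of `A` near `ζ₀` is admissible at `ζ₀`; this form of the hypothesis is what
    -- makes the choice survive at points of the grid hyperplanes.
    have h1 : ∀ᶠ z : T × V n in 𝓝 (t₀, ζ₀), ∀ a ∈ range A, Q a t₀ ζ₀ → Q a z.1 z.2 := by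
      rw [Filter.eventually_all_finite hA.finite]
      intro a _
      by_cases hq : Q a t₀ ζ₀
      · filter_upwards [isOpen_iff_eventually.1 (hQ a) (t₀, ζ₀) hq] with z hz _ using hz
      · exact Filter.Eventually.of_forall fun z h' => absurd h' hq
    have h2 : ∀ᶠ z : T × V n in 𝓝 (t₀, ζ₀), ∀ᶠ ζ' in 𝓝 z.2, Q (A ζ') t₀ ζ₀ :=
      (continuous_snd.tendsto (t₀, ζ₀)).eventually (eventually_eventually_nhds.2 (h ζ₀))
    filter_upwards [h1, h2] with z hz1 hz2
    filter_upwards [hz2] with ζ' hζ'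
    exact hz1 _ ⟨ζ', rfl⟩ hζ'
  filter_upwards [key] with t ht ζ
  have h1 := ht (fractVec ζ) (unitCube_subset (fractVec_mem ζ))
  rw [fractVec_eq] at h1
  have h2 : Filter.Tendsto (fun ζ' : V n => ζ' + intVec (-floorVec ζ)) (𝓝 ζ)
      (𝓝 (ζ + intVec (-floorVec ζ))) := (continuous_add_const _).tendsto _
  filter_upwards [h2.eventually h1] with ζ' h3
  rw [hA.periodic] at h3
  rwa [hper] at h3

/-- The weights belong to the grid function and not to the parameter, so their integral stays
positive when the same `A` is reused for `(t, b)` near `(t₀, b₀)`. Compactness of the sphere of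
directions then yields a neighbourhood of `t₀`. -/
theorem isOpen_isGood {T : Type*} [TopologicalSpace T] {g₁ g₂ : T → V n → ℝ → ℝ}
    {gz : T → V n → ℝ → V n}
    (h₁ : Continuous fun z : T × V n × ℝ => g₁ z.1 z.2.1 z.2.2)
    (h₂ : Continuous fun z : T × V n × ℝ => g₂ z.1 z.2.1 z.2.2)
    (hz : Continuous fun z : T × V n × ℝ => gz z.1 z.2.1 z.2.2)
    (p₁ : ∀ t, IsPeriodic (g₁ t)) (p₂ : ∀ t, IsPeriodic (g₂ t)) (pz : ∀ t, IsPeriodic (gz t)) :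
    IsOpen {t | IsGood (g₁ t) (g₂ t) (gz t)} := by
  have hper : ∀ a (t : T × V n),
      IsPeriodic (IsWeightedBracket (g₁ t.1) (g₂ t.1) (gz t.1) t.2 a) := by
    intro a t ζ m
    simp only [IsWeightedBracket, IsBracket, p₁ t.1 ζ m, p₂ t.1 ζ m, pz t.1 ζ m]
  rw [isOpen_iff_eventually]
  intro t₀ ht₀
  have key : ∀ᶠ t in 𝓝 t₀, ∀ b ∈ Metric.sphere (0 : V n) 1, ∃ A : V n → (ℝ × ℝ) × ℝ, IsGrid A ∧
      0 < ∫ ζ in unitCube n, (A ζ).2 ∧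
      ∀ ζ, ∀ᶠ ζ' in 𝓝 ζ, IsWeightedBracket (g₁ t) (g₂ t) (gz t) b (A ζ') ζ := by
    refine (isCompact_sphere (0 : V n) 1).eventually_forall_of_forall_eventually fun b hb => ?_
    obtain ⟨A, hA, hpos, h⟩ := ht₀ b (by simpa using hb)
    have := hA.eventually_robust (Q := fun a (t : T × V n) =>
      IsWeightedBracket (g₁ t.1) (g₂ t.1) (gz t.1) t.2 a)
      (fun a => isOpen_isWeightedBracket h₁ h₂ hz a) hper (t₀ := (t₀, b)) h
    filter_upwards [this] with z hz
    exact ⟨A, hA, hpos, hz⟩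
  filter_upwards [key] with t ht b hb using ht b (by simpa using hb)

/-! ### The zero selected by a bracket. -/

/-- The zero of `g₁(ζ, ·)` in the interval `a`. -/
def bracketZero (g₁ : V n → ℝ → ℝ) (a : ℝ × ℝ) (ζ : V n) : ℝ :=
  Classical.epsilon fun τ => τ ∈ Ioo a.1 a.2 ∧ g₁ ζ τ = 0

/-- `Classical.epsilon` depends only on the function `g₁ ζ`, so the selected zero inherits the
periodicity of `g₁`, even where no zero exists. -/
lemma bracketZero_congr {g₁ g₁' : V n → ℝ → ℝ} {a : ℝ × ℝ} {ζ ζ' : V n} (h : g₁ ζ = g₁' ζ') :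
    bracketZero g₁ a ζ = bracketZero g₁' a ζ' := by
  unfold bracketZero; rw [h]

section Zero

variable {g₁ g₂ : V n → ℝ → ℝ} {a : ℝ × ℝ} {ζ : V n}

lemma IsBracket.exists_zero (h : IsBracket g₁ g₂ a ζ) (hc : Continuous (g₁ ζ)) :
    ∃ τ ∈ Ioo a.1 a.2, g₁ ζ τ = 0 := by
  obtain ⟨-, hlt, -, hmul, -⟩ := h
  rcases mul_neg_iff.1 hmul with ⟨h1, h2⟩ | ⟨h1, h2⟩
  · obtain ⟨τ, hτ, h0⟩ := intermediate_value_Ioo' hlt.le hc.continuousOn ⟨h2, h1⟩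
    exact ⟨τ, hτ, h0⟩
  · obtain ⟨τ, hτ, h0⟩ := intermediate_value_Ioo hlt.le hc.continuousOn ⟨h1, h2⟩
    exact ⟨τ, hτ, h0⟩

lemma IsBracket.bracketZero_mem (h : IsBracket g₁ g₂ a ζ) (hc : Continuous (g₁ ζ)) :
    bracketZero g₁ a ζ ∈ Ioo a.1 a.2 ∧ g₁ ζ (bracketZero g₁ a ζ) = 0 :=
  Classical.epsilon_spec (p := fun τ => τ ∈ Ioo a.1 a.2 ∧ g₁ ζ τ = 0)
    (by obtain ⟨τ, h1, h2⟩ := h.exists_zero hc; exact ⟨τ, h1, h2⟩)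

/-- Rolle's theorem: two points with equal values would enclose a zero of `g₂`. -/
lemma IsBracket.zero_unique (h : IsBracket g₁ g₂ a ζ) (hd : ∀ τ, HasDerivAt (g₁ ζ) (g₂ ζ τ) τ)
    {τ τ' : ℝ} (hτ : τ ∈ Ioo a.1 a.2) (hτ' : τ' ∈ Ioo a.1 a.2) (h0 : g₁ ζ τ = g₁ ζ τ') :
    τ = τ' := by
  by_contra hne
  wlog hlt : τ < τ' generalizing τ τ'
  · exact this hτ' hτ h0.symm (Ne.symm hne) (lt_of_le_of_ne (not_lt.1 hlt) (Ne.symm hne))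
  have hc : Continuous (g₁ ζ) := continuous_iff_continuousAt.2 fun τ => (hd τ).continuousAt
  obtain ⟨c, hc1, hc2⟩ := exists_hasDerivAt_eq_zero hlt hc.continuousOn h0 fun x _ => hd x
  exact h.2.2.2.2 c ⟨(hτ.1.trans hc1.1).le, (hc1.2.trans hτ'.2).le⟩ hc2

lemma IsBracket.eq_bracketZero (h : IsBracket g₁ g₂ a ζ)
    (hd : ∀ τ, HasDerivAt (g₁ ζ) (g₂ ζ τ) τ) {τ : ℝ} (hτ : τ ∈ Ioo a.1 a.2) (h0 : g₁ ζ τ = 0) :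
    τ = bracketZero g₁ a ζ := by
  have hc : Continuous (g₁ ζ) := continuous_iff_continuousAt.2 fun τ => (hd τ).continuousAt
  obtain ⟨h1, h2⟩ := h.bracketZero_mem hc
  exact h.zero_unique hd hτ h1 (h0.trans h2.symm)

end Zero

/-! ### Quasiperiodic functions and recurrence. -/

/-- A function `g(ζ, τ) = Φ(ζ - τ ν, τ)`, with `Φ` periodic of class `C²`, and its derivatives. -/
structure IsQuasiPeriodic (ν : V n) (g g₁ g₂ : V n → ℝ → ℝ) (gz : V n → ℝ → V n) : Prop where
  periodic : IsPeriodic g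
  shift : ∀ ζ τ (j : ℤ), g (ζ + (j : ℝ) • ν) (τ + j) = g ζ τ
  hasDerivAt : ∀ ζ τ, HasDerivAt (g ζ) (g₁ ζ τ) τ
  hasDerivAt' : ∀ ζ τ, HasDerivAt (g₁ ζ) (g₂ ζ τ) τ
  hasFDerivAt : ∀ ζ τ, HasFDerivAt (fun ζ => g ζ τ) (innerSL ℝ (gz ζ τ)) ζ
  cont : Continuous fun z : V n × ℝ => g z.1 z.2
  cont₁ : Continuous fun z : V n × ℝ => g₁ z.1 z.2
  cont₂ : Continuous fun z : V n × ℝ => g₂ z.1 z.2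
  contz : Continuous fun z : V n × ℝ => gz z.1 z.2

lemma innerSL_injective {u v : V n} (h : innerSL ℝ u = innerSL ℝ v) : u = v := by
  refine ext_inner_right ℝ fun w => ?_
  simpa using congrArg (fun L : V n →L[ℝ] ℝ => L w) h

lemma exists_recurrence (ν : V n) {δ : ℝ} (hδ : 0 < δ) (T : ℕ) :
    ∃ j : ℕ, T < j ∧ ∃ m : Fin n → ℤ, ‖(j : ℝ) • ν + intVec m‖ < δ := by
  obtain ⟨a, -, φ, hφ, ha⟩ := (isCompact_closedCube (n := n)).tendsto_subseq
    (x := fun j : ℕ => fractVec ((j : ℝ) • ν)) fun j => unitCube_subset (fractVec_mem _)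
  have hC := ha.cauchySeq
  rw [Metric.cauchySeq_iff] at hC
  obtain ⟨N, hN⟩ := hC δ hδ
  -- A strictly increasing φ satisfies φ(k) ≥ k, so this index makes the return time exceed `T`.
  have h1 : T < φ (N + φ N + T + 1) - φ N := by
    have := hφ.le_apply (x := N + φ N + T + 1)
    omega
  refine ⟨φ (N + φ N + T + 1) - φ N, h1,
    floorVec ((φ N : ℝ) • ν) - floorVec ((φ (N + φ N + T + 1) : ℝ) • ν), ?_⟩
  have h2 := hN (N + φ N + T + 1) (by omega) N le_rfl
  rw [dist_eq_norm] at h2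
  have h3 : φ N ≤ φ (N + φ N + T + 1) := by omega
  refine lt_of_eq_of_lt (congrArg norm ?_) h2
  rw [Nat.cast_sub h3]
  ext i
  simp [fractVec]
  ring

/-- If no multiple of `ν` is integer, the closure of `ℤ ν + ℤⁿ` contains a line. -/
lemma exists_invariant_direction {ν : V n} (hν : ∀ j : ℤ, j ≠ 0 → ∀ m, (j : ℝ) • ν ≠ intVec m) :
    ∃ w : V n, w ≠ 0 ∧ ∀ f : V n → ℝ, Continuous f → IsPeriodic f → (∀ ζ, f (ζ + ν) = f ζ) →
      ∀ (s : ℝ) ζ, f (ζ + s • w) = f ζ := by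
  -- These are arbitrarily short vectors of ℤν + ℤⁿ; they are nonzero because no nonzero multiple of
  -- ν is integer. The line is spanned by a limit of their directions.
  have h1 : ∀ k : ℕ, ∃ h : V n, h ≠ 0 ∧ ‖h‖ < 1 / ((k : ℝ) + 1) ∧
      ∃ (j : ℕ) (m : Fin n → ℤ), h = (j : ℝ) • ν + intVec m := by
    intro k
    obtain ⟨j, hj, m, hm⟩ := exists_recurrence ν (δ := 1 / ((k : ℝ) + 1)) (by positivity) 0
    refine ⟨_, fun h0 => ?_, hm, j, m, rfl⟩
    refine hν j (by exact_mod_cast hj.ne') (-m) ?_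
    rw [intVec_neg]
    simpa using eq_neg_of_add_eq_zero_left h0
  choose h h0 hlt j m hjm using h1
  obtain ⟨w, hw, φ, hφ, hlim⟩ := (isCompact_sphere (0 : V n) 1).tendsto_subseq
    (x := fun k => (‖h k‖)⁻¹ • h k) fun k => by
      simp [norm_smul, h0 k]
  refine ⟨w, fun hw0 => by simp [hw0] at hw, fun f hf hper hinv s ζ => ?_⟩
  have hinvj : ∀ (j : ℕ) ζ, f (ζ + (j : ℝ) • ν) = f ζ := by
    intro j
    induction j with
    | zero => simp
    | succ j ih =>
      intro ζ
      rw [Nat.cast_succ, add_smul, one_smul, ← add_assoc, hinv, ih]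
  have hinvh : ∀ k ζ, f (ζ + h k) = f ζ := by
    intro k ζ
    rw [hjm k, ← add_assoc, hper, hinvj]
  have hinvz : ∀ k (i : ℤ) ζ, f (ζ + (i : ℝ) • h k) = f ζ := by
    intro k i
    induction i with
    | zero => simp
    | succ i ih =>
      intro ζ
      push_cast at ih ⊢
      rw [add_smul, one_smul, ← add_assoc, hinvh, ih]
    | pred i ih =>
      intro ζ
      rw [← hinvh k]
      push_cast at ih ⊢
      rw [← ih ζ]
      congr 1
      rw [sub_smul, one_smul]
      abel
  have hnorm : Filter.Tendsto (fun k => ‖h (φ k)‖) Filter.atTop (𝓝 0) := by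
    have : Filter.Tendsto (fun k => ‖h k‖) Filter.atTop (𝓝 0) :=
      squeeze_zero (fun k => norm_nonneg _) (fun k => (hlt k).le)
        tendsto_one_div_add_atTop_nhds_zero_nat
    exact this.comp hφ.tendsto_atTop
  -- The multiple ⌊s / ‖h‖⌋ of a short `h` has length close to `s`, so invariance under ℤh becomes
  -- invariance under ℝw in the limit.
  have hcoef : Filter.Tendsto (fun k => (⌊s / ‖h (φ k)‖⌋ : ℝ) * ‖h (φ k)‖) Filter.atTop (𝓝 s) := by
    refine tendsto_of_tendsto_of_tendsto_of_le_of_le (g := fun k => s - ‖h (φ k)‖) (h := fun _ => s)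
      (by simpa using tendsto_const_nhds.sub hnorm) tendsto_const_nhds (fun k => ?_) (fun k => ?_)
    · have hp : 0 < ‖h (φ k)‖ := norm_pos_iff.2 (h0 _)
      have := Int.lt_floor_add_one (s / ‖h (φ k)‖)
      rw [div_lt_iff₀ hp] at this
      show s - ‖h (φ k)‖ ≤ _
      linarith
    · have hp : 0 < ‖h (φ k)‖ := norm_pos_iff.2 (h0 _)
      have := Int.floor_le (s / ‖h (φ k)‖)
      rw [le_div_iff₀ hp] at this
      exact this
  have hT : Filter.Tendsto (fun k => ζ + ((⌊s / ‖h (φ k)‖⌋ : ℝ) * ‖h (φ k)‖) •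
      ((‖h (φ k)‖)⁻¹ • h (φ k))) Filter.atTop (𝓝 (ζ + s • w)) :=
    tendsto_const_nhds.add (hcoef.smul hlim)
  have hF := (hf.tendsto (ζ + s • w)).comp hT
  refine tendsto_nhds_unique hF ?_
  refine tendsto_const_nhds.congr fun k => ?_
  have hp : ‖h (φ k)‖ ≠ 0 := norm_ne_zero_iff.2 (h0 _)
  simp only [Function.comp]
  rw [smul_smul, mul_assoc, mul_inv_cancel₀ hp, mul_one, hinvz]

namespace IsQuasiPeriodic

variable {ν : V n} {g g₁ g₂ : V n → ℝ → ℝ} {gz : V n → ℝ → V n}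

lemma periodic₁ (h : IsQuasiPeriodic ν g g₁ g₂ gz) : IsPeriodic g₁ := fun ζ m => by
  ext τ
  have := h.hasDerivAt (ζ + intVec m) τ
  rw [h.periodic] at this
  exact this.unique (h.hasDerivAt ζ τ)

lemma periodic₂ (h : IsQuasiPeriodic ν g g₁ g₂ gz) : IsPeriodic g₂ := fun ζ m => by
  ext1 τ
  have := h.hasDerivAt' (ζ + intVec m) τ
  rw [h.periodic₁] at this
  exact this.unique (h.hasDerivAt' ζ τ)

lemma periodicz (h : IsQuasiPeriodic ν g g₁ g₂ gz) : IsPeriodic gz := fun ζ m => by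
  ext1 τ
  have h1 := (hasFDerivAt_comp_add_right (intVec m)).2 (h.hasFDerivAt (ζ + intVec m) τ)
  simp only [fun ζ' => h.periodic ζ' m] at h1
  exact innerSL_injective (h1.unique (h.hasFDerivAt ζ τ))

lemma shiftz (h : IsQuasiPeriodic ν g g₁ g₂ gz) (ζ : V n) (τ : ℝ) (j : ℤ) :
    gz (ζ + (j : ℝ) • ν) (τ + j) = gz ζ τ := by
  have h1 := (hasFDerivAt_comp_add_right ((j : ℝ) • ν)).2
    (h.hasFDerivAt (ζ + (j : ℝ) • ν) (τ + j))
  simp only [fun ζ' => h.shift ζ' τ j] at h1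
  exact innerSL_injective (h1.unique (h.hasFDerivAt ζ τ))

/-- Moving back along the orbit by ⌊τ⌋ periods and then reducing ζ modulo ℤⁿ reaches a compact
cylinder, so bounds over the cylinder are global. -/
lemma eq_fract {X : Type*} {f : V n → ℝ → X} (hf : IsPeriodic f)
    (hs : ∀ ζ τ (j : ℤ), f (ζ + (j : ℝ) • ν) (τ + j) = f ζ τ) (ζ : V n) (τ : ℝ) :
    ∃ ζ' ∈ closedCube n, ∃ τ' ∈ Icc (0 : ℝ) 1, f ζ' τ' = f ζ τ := by
  refine ⟨fractVec (ζ + ((-⌊τ⌋ : ℤ) : ℝ) • ν), unitCube_subset (fractVec_mem _), Int.fract τ,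
    ⟨Int.fract_nonneg _, (Int.fract_lt_one _).le⟩, ?_⟩
  rw [hf.fractVec, ← hs ζ τ (-⌊τ⌋)]
  congr 1
  push_cast
  rw [← Int.self_sub_floor]; ring

lemma exists_bound {E : Type*} [NormedAddCommGroup E] {f : V n → ℝ → E} (hf : IsPeriodic f)
    (hs : ∀ ζ τ (j : ℤ), f (ζ + (j : ℝ) • ν) (τ + j) = f ζ τ)
    (hc : Continuous fun z : V n × ℝ => f z.1 z.2) : ∃ C, 0 ≤ C ∧ ∀ ζ τ, ‖f ζ τ‖ ≤ C := by
  obtain ⟨C, hC⟩ := (isCompact_closedCube.prod isCompact_Icc).exists_bound_of_continuousOn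
    (s := closedCube n ×ˢ Icc (0 : ℝ) 1) hc.continuousOn
  refine ⟨max C 0, le_max_right _ _, fun ζ τ => ?_⟩
  obtain ⟨ζ', h1, τ', h2, e⟩ := eq_fract hf hs ζ τ
  rw [← e]
  exact (hC (ζ', τ') ⟨h1, h2⟩).trans (le_max_left _ _)

lemma exists_lipschitz (h : IsQuasiPeriodic ν g g₁ g₂ gz) :
    ∃ L : ℝ, 0 ≤ L ∧ (∀ ζ τ, ‖gz ζ τ‖ ≤ L) ∧ ∀ ζ ζ' τ, |g ζ τ - g ζ' τ| ≤ L * ‖ζ - ζ'‖ := by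
  obtain ⟨L, hL0, hL⟩ := exists_bound h.periodicz h.shiftz h.contz
  refine ⟨L, hL0, hL, fun ζ ζ' τ => ?_⟩
  have := Convex.norm_image_sub_le_of_norm_hasFDerivWithin_le (s := univ) (C := L)
    (f := fun ζ => g ζ τ) (fun x _ => (h.hasFDerivAt x τ).hasFDerivWithinAt)
    (fun x _ => by rw [innerSL_apply_norm]; exact hL x τ) convex_univ (mem_univ ζ') (mem_univ ζ)
  simpa using this

/-- By `shift`, advancing τ by j amounts to translating ζ by -jν; if jν is close to ℤⁿ, the
Lipschitz bound makes j an almost period, uniformly in ζ and τ. -/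
lemma almost_period (h : IsQuasiPeriodic ν g g₁ g₂ gz) {ε : ℝ} (hε : 0 < ε) (T : ℕ) :
    ∃ j : ℕ, T < j ∧ ∀ ζ τ, |g ζ (τ + j) - g ζ τ| ≤ ε := by
  obtain ⟨L, hL0, -, hL⟩ := h.exists_lipschitz
  obtain ⟨j, hj, m, hm⟩ := exists_recurrence ν (δ := ε / (L + 1)) (by positivity) T
  refine ⟨j, hj, fun ζ τ => ?_⟩
  have e : g ζ (τ + j) = g (ζ + (-((j : ℝ) • ν + intVec m))) τ := by
    have := h.shift (ζ + (-((j : ℝ) • ν + intVec m))) τ j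
    rw [← this, neg_add, ← intVec_neg]
    have e2 : ζ + (-((j : ℝ) • ν) + intVec (-m)) + ((j : ℤ) : ℝ) • ν = ζ + intVec (-m) := by
      push_cast; abel
    rw [e2, h.periodic]; simp
  rw [e]
  refine (hL _ _ τ).trans ?_
  have e3 : ζ + (-((j : ℝ) • ν + intVec m)) - ζ = -((j : ℝ) • ν + intVec m) := by abel
  rw [e3, norm_neg]
  have h4 : L * ‖(j : ℝ) • ν + intVec m‖ ≤ L * (ε / (L + 1)) :=
    mul_le_mul_of_nonneg_left hm.le hL0
  refine h4.trans ?_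
  rw [mul_div_assoc', div_le_iff₀ (by positivity)]
  nlinarith

end IsQuasiPeriodic

/-! ### The supremum over an orbit. -/

/-- The supremum over an orbit. -/
def orbitSup (g : V n → ℝ → ℝ) (ζ : V n) : ℝ := ⨆ τ, g ζ τ

namespace IsQuasiPeriodic

variable {ν : V n} {g g₁ g₂ : V n → ℝ → ℝ} {gz : V n → ℝ → V n}

lemma le_orbitSup (h : IsQuasiPeriodic ν g g₁ g₂ gz) (ζ : V n) (τ : ℝ) : g ζ τ ≤ orbitSup g ζ := by
  obtain ⟨C, -, hC⟩ := exists_bound h.periodic h.shift h.cont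
  exact le_ciSup (f := fun τ => g ζ τ)
    ⟨C, by rintro _ ⟨τ, rfl⟩; exact (le_abs_self _).trans (hC ζ τ)⟩ τ

lemma lipschitz_orbitSup (h : IsQuasiPeriodic ν g g₁ g₂ gz) {L : ℝ}
    (hL : ∀ ζ ζ' τ, |g ζ τ - g ζ' τ| ≤ L * ‖ζ - ζ'‖) (ζ ζ' : V n) :
    |orbitSup g ζ - orbitSup g ζ'| ≤ L * ‖ζ - ζ'‖ := by
  have key : ∀ ζ ζ' : V n, orbitSup g ζ ≤ orbitSup g ζ' + L * ‖ζ - ζ'‖ := fun ζ ζ' =>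
    ciSup_le fun τ => by
      have h1 := (abs_le.1 (hL ζ ζ' τ)).2
      have h2 := h.le_orbitSup ζ' τ
      linarith
  rw [abs_le]
  have h1 := key ζ ζ'
  have h2 := key ζ' ζ
  rw [norm_sub_rev] at h2
  constructor <;> linarith

lemma continuous_orbitSup (h : IsQuasiPeriodic ν g g₁ g₂ gz) : Continuous (orbitSup g) := by
  obtain ⟨L, hL0, -, hL⟩ := h.exists_lipschitz
  refine (LipschitzWith.of_dist_le_mul (K := ⟨L, hL0⟩) fun ζ ζ' => ?_).continuous
  rw [Real.dist_eq, dist_eq_norm]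
  exact h.lipschitz_orbitSup hL ζ ζ'

lemma periodic_orbitSup (h : IsQuasiPeriodic ν g g₁ g₂ gz) : IsPeriodic (orbitSup g) := fun ζ m => by
  simp only [orbitSup, h.periodic ζ m]

/-- The orbits of ζ and ζ + ν coincide on the torus up to a unit shift of time. This is the
invariance to which `exists_invariant_direction` is applied. -/
lemma orbitSup_shift (h : IsQuasiPeriodic ν g g₁ g₂ gz) (ζ : V n) :
    orbitSup g (ζ + ν) = orbitSup g ζ := by
  unfold orbitSup
  rw [← (Equiv.addRight (1 : ℝ)).iSup_comp (g := fun τ => g (ζ + ν) τ)]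
  congr 1
  ext τ
  simpa using h.shift ζ τ 1

/-- Critical points with large `τ` and value close to the supremum over the orbit. -/
lemma exists_critical (h : IsQuasiPeriodic ν g g₁ g₂ gz) {ζ : V n} {t : ℝ}
    (ht : g ζ t < orbitSup g ζ) {ε : ℝ} (hε : 0 < ε) (T : ℝ) :
    ∃ τ > T, g₁ ζ τ = 0 ∧ orbitSup g ζ - ε < g ζ τ := by
  set M := orbitSup g ζ with hM
  obtain ⟨e, he0, he1, he2⟩ : ∃ e > 0, g ζ t + e < M - e ∧ 2 * e ≤ ε :=
    ⟨min ((M - g ζ t) / 4) (ε / 2), by have : 0 < M - g ζ t := by linarith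
                                       positivity,
      by have := min_le_left ((M - g ζ t) / 4) (ε / 2); linarith,
      by have := min_le_right ((M - g ζ t) / 4) (ε / 2); linarith⟩
  obtain ⟨t', ht'⟩ : ∃ t', M - e / 2 < g ζ t' := exists_lt_of_lt_ciSup (by
    show M - e / 2 < M; linarith)
  -- Almost periods place a copy t' + j₂ of a nearly maximal point between two copies t + j₁ and t +
  -- j₃ of a low point, all beyond `T`. The maximum over the interval between the low copies is
  -- therefore interior, hence critical, and close to the supremum.
  obtain ⟨j₁, hj₁, H₁⟩ := h.almost_period he0 ⌈|T| + |t|⌉₊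
  obtain ⟨j₂, hj₂, H₂⟩ := h.almost_period (half_pos he0) (j₁ + ⌈|t| + |t'|⌉₊)
  obtain ⟨j₃, hj₃, H₃⟩ := h.almost_period he0 (j₂ + ⌈|t| + |t'|⌉₊)
  have a1 : T < t + j₁ := by
    have h1 : |T| + |t| ≤ ⌈|T| + |t|⌉₊ := Nat.le_ceil _
    have h2 : ((⌈|T| + |t|⌉₊ : ℕ) : ℝ) < j₁ := by exact_mod_cast hj₁
    have := neg_abs_le t; have := le_abs_self T; linarith
  have a2 : t + j₁ < t' + j₂ := by
    have h1 : |t| + |t'| ≤ ⌈|t| + |t'|⌉₊ := Nat.le_ceil _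
    have h2 : ((j₁ : ℝ) + (⌈|t| + |t'|⌉₊ : ℕ) : ℝ) < j₂ := by exact_mod_cast hj₂
    have := neg_abs_le t'; have := le_abs_self t; linarith
  have a3 : t' + j₂ < t + j₃ := by
    have h1 : |t| + |t'| ≤ ⌈|t| + |t'|⌉₊ := Nat.le_ceil _
    have h2 : ((j₂ : ℝ) + (⌈|t| + |t'|⌉₊ : ℕ) : ℝ) < j₃ := by exact_mod_cast hj₃
    have := neg_abs_le t; have := le_abs_self t'; linarith
  have b1 := (abs_le.1 (H₁ ζ t)).2
  have b2 := (abs_le.1 (H₂ ζ t')).1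
  have b3 := (abs_le.1 (H₃ ζ t)).2
  have hc : Continuous (g ζ) := continuous_iff_continuousAt.2 fun τ => (h.hasDerivAt ζ τ).continuousAt
  obtain ⟨τ, hτ, hmax⟩ := isCompact_Icc.exists_isMaxOn (nonempty_Icc.2 (a2.trans a3).le)
    hc.continuousOn
  have c1 := hmax (⟨a2.le, a3.le⟩ : t' + (j₂ : ℝ) ∈ Icc (t + (j₁ : ℝ)) (t + (j₃ : ℝ)))
  simp only [mem_ofPred_eq] at c1
  have c2 : τ ≠ t + j₁ := fun e => by rw [e] at c1; linarith
  have c3 : τ ≠ t + j₃ := fun e => by rw [e] at c1; linarith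
  have c4 : τ ∈ Ioo (t + (j₁ : ℝ)) (t + j₃) :=
    ⟨lt_of_le_of_ne hτ.1 (Ne.symm c2), lt_of_le_of_ne hτ.2 c3⟩
  refine ⟨τ, a1.trans c4.1, ?_, by linarith⟩
  exact (hmax.isLocalMax (Icc_mem_nhds c4.1 c4.2)).hasDerivAt_eq_zero (h.hasDerivAt ζ τ)

end IsQuasiPeriodic

/-! ### Cells of a grid and approximation by grid functions. -/

lemma norm_le_of_coord_le {x : V n} {c : ℝ} (h : ∀ i, |x i| ≤ c) : ‖x‖ ≤ n * c := by
  have e := (EuclideanSpace.basisFun (Fin n) ℝ).sum_repr x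
  rw [← e]
  refine (norm_sum_le _ _).trans ?_
  have : ∀ i ∈ (Finset.univ : Finset (Fin n)),
      ‖(EuclideanSpace.basisFun (Fin n) ℝ).repr x i • (EuclideanSpace.basisFun (Fin n) ℝ) i‖ ≤ c := by
    intro i _
    rw [norm_smul]
    simpa using h i
  simpa using Finset.sum_le_sum this

/-- The index of the cell of the grid of mesh `1 / N` in the unit cube. -/
def gridCorner (N : ℕ) (ζ : V n) : Fin n → ℤ := fun i => ⌊(N : ℝ) * Int.fract (ζ i)⌋

/-- A closed cell of the grid of mesh `1 / N`. -/
def gridCell (N : ℕ) (J : Fin n → ℤ) : Set (V n) :=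
  {ζ | ∀ i, (J i : ℝ) ≤ N * ζ i ∧ N * ζ i ≤ J i + 1}

lemma fractVec_mem_gridCell (N : ℕ) (ζ : V n) : fractVec ζ ∈ gridCell N (gridCorner N ζ) := fun i => by
  rw [fractVec_apply]
  exact ⟨Int.floor_le _, (Int.lt_floor_add_one _).le⟩

lemma gridCell_subset_ball {N : ℕ} (hN : 0 < N) {J : Fin n → ℤ} {x : V n} (hx : x ∈ gridCell N J)
    {δ : ℝ} (hδ : (n : ℝ) < δ * N) : gridCell N J ⊆ Metric.ball x δ := by
  intro y hy
  have hN' : (0 : ℝ) < N := by exact_mod_cast hN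
  rw [Metric.mem_ball, dist_eq_norm]
  refine (norm_le_of_coord_le (c := 1 / N) fun i => ?_).trans_lt ?_
  · have h1 := hx i
    have h2 := hy i
    have e : |(y - x) i| * N = |N * y i - N * x i| := by
      rw [PiLp.sub_apply, ← mul_sub, abs_mul, abs_of_pos hN', mul_comm]
    rw [le_div_iff₀ hN', e, abs_le]
    constructor <;> linarith
  · rw [mul_one_div, div_lt_iff₀ hN']; exact hδ

lemma gridCorner_eq (N : ℕ) (ζ : V n) (i : Fin n) :
    gridCorner N ζ i = ⌊(N : ℝ) * ζ i⌋ - N * ⌊ζ i⌋ := by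
  unfold gridCorner
  rw [← Int.self_sub_floor, mul_sub, ← Int.floor_sub_intCast]
  push_cast; rfl

lemma eventually_floor_eq {x : ℝ} (hx : ∀ j : ℤ, x ≠ j) : ∀ᶠ y in 𝓝 x, ⌊y⌋ = ⌊x⌋ := by
  have h1 : x ∈ Ioo (⌊x⌋ : ℝ) (⌊x⌋ + 1) :=
    ⟨lt_of_le_of_ne (Int.floor_le x) (hx _).symm, Int.lt_floor_add_one x⟩
  filter_upwards [Ioo_mem_nhds h1.1 h1.2] with y hy
  exact Int.floor_eq_iff.2 ⟨hy.1.le, hy.2⟩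

lemma eventually_floor_near (x : ℝ) : ∀ᶠ y in 𝓝 x, (⌊y⌋ : ℝ) ≤ x ∧ x ≤ ⌊y⌋ + 1 := by
  have h1 : (⌈x⌉ : ℝ) - 1 < x := by linarith [Int.ceil_lt_add_one x]
  filter_upwards [Ioo_mem_nhds h1 (Int.lt_floor_add_one x)] with y hy
  constructor
  · have : ⌊y⌋ ≤ ⌊x⌋ := by
      have : ⌊y⌋ < ⌊x⌋ + 1 := Int.floor_lt.2 (by exact_mod_cast hy.2)
      omega
    exact le_trans (by exact_mod_cast this) (Int.floor_le x)
  · have : ⌈x⌉ - 1 ≤ ⌊y⌋ := Int.le_floor.2 (by push_cast; exact hy.1.le)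
    have h2 : (⌈x⌉ : ℝ) ≤ ⌊y⌋ + 1 := by exact_mod_cast (by omega : ⌈x⌉ ≤ ⌊y⌋ + 1)
    exact (Int.le_ceil x).trans h2

lemma isGrid_gridCorner {N : ℕ} (hN : 0 < N) : IsGrid (gridCorner N : V n → Fin n → ℤ) where
  periodic ζ m := by
    ext i; simp [gridCorner]
  finite := by
    refine (Set.Finite.pi fun _ : Fin n => finite_Icc (0 : ℤ) N).subset ?_
    rintro _ ⟨ζ, rfl⟩ i _
    have h0 : (0 : ℝ) ≤ N * Int.fract (ζ i) := mul_nonneg (by positivity) (Int.fract_nonneg _)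
    have h1 : (N : ℝ) * Int.fract (ζ i) ≤ N :=
      mul_le_of_le_one_right (by positivity) (Int.fract_lt_one _).le
    refine ⟨Int.floor_nonneg.2 h0, ?_⟩
    have := (Int.floor_le _).trans h1
    exact_mod_cast this
  locConst := by
    refine ⟨N, hN, fun ζ hζ => ?_⟩
    have h : ∀ i, ∀ᶠ ζ' : V n in 𝓝 ζ, gridCorner N ζ' i = gridCorner N ζ i := by
      intro i
      have hc1 : Continuous fun ζ : V n => (N : ℝ) * ζ i := by fun_prop
      have hc2 : Continuous fun ζ : V n => ζ i := by fun_prop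
      have n1 : ∀ j : ℤ, (N : ℝ) * ζ i ≠ j := fun j hj => hζ ⟨i, j, hj⟩
      have n2 : ∀ j : ℤ, ζ i ≠ j := fun j hj => hζ ⟨i, N * j, by rw [hj]; push_cast; rfl⟩
      filter_upwards [(hc1.tendsto ζ).eventually (eventually_floor_eq n1),
        (hc2.tendsto ζ).eventually (eventually_floor_eq n2)] with ζ' e1 e2
      rw [gridCorner_eq, gridCorner_eq, e1, e2]
    filter_upwards [Filter.eventually_all.2 h] with ζ' h'
    exact funext h'

/-- Near a grid hyperplane several cells occur, but each of the closed cells contains ζ modulo ℤⁿ. A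
property that holds on closed cells is thus valid at ζ for every value taken nearby. -/
lemma eventually_mem_gridCell (N : ℕ) (ζ : V n) :
    ∀ᶠ ζ' in 𝓝 ζ, ∃ m : Fin n → ℤ, ζ + intVec m ∈ gridCell N (gridCorner N ζ') := by
  have h : ∀ i, ∀ᶠ ζ' : V n in 𝓝 ζ, (⌊(N : ℝ) * ζ' i⌋ : ℝ) ≤ N * ζ i ∧
      (N : ℝ) * ζ i ≤ ⌊(N : ℝ) * ζ' i⌋ + 1 := by
    intro i
    have hc1 : Continuous fun ζ : V n => (N : ℝ) * ζ i := by fun_prop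
    exact (hc1.tendsto ζ).eventually (eventually_floor_near _)
  filter_upwards [Filter.eventually_all.2 h] with ζ' h'
  refine ⟨-floorVec ζ', fun i => ?_⟩
  rw [gridCorner_eq]
  have := h' i
  simp only [floorVec, PiLp.add_apply, intVec_apply, Pi.neg_apply]
  push_cast
  constructor <;> linarith

lemma IsGrid.integrable {A : V n → ℝ} (hA : IsGrid A) : IntegrableOn A (unitCube n) := by
  obtain ⟨N, hN, h⟩ := hA.locConst
  have hm : AEStronglyMeasurable A volume := aestronglyMeasurable_of_continuousAt hN
    fun ζ hζ => (continuousAt_const (y := A ζ)).congr ((h ζ hζ).mono fun _ e => e.symm)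
  obtain ⟨C, hC⟩ := (hA.finite.image norm).bddAbove
  exact Integrable.of_bound hm.restrict C
    (Filter.Eventually.of_forall fun ζ => hC ⟨_, ⟨ζ, rfl⟩, rfl⟩)

/-- Countably many open periodic sets with weights; a function which is almost everywhere bounded by
the weights of the sets containing the point is approximated from below by grid functions. -/
lemma exists_grid_of_cover {O : ℕ → Set (V n)} {wt : ℕ → ℝ} {B : ℝ} (hB : ∀ k, |wt k| ≤ B)
    (hO : ∀ k, IsOpen (O k)) (hper : ∀ k, IsPeriodic (· ∈ O k)) (hcov : ∀ ζ, ∃ k, ζ ∈ O k)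
    {f : V n → ℝ} (hf : IntegrableOn f (unitCube n)) (hfb : ∀ ζ, |f ζ| ≤ B)
    (hae : ∀ᵐ ζ : V n, ∀ ε > 0, ∃ k, ζ ∈ O k ∧ f ζ - ε < wt k)
    (hpos : 0 < ∫ ζ in unitCube n, f ζ) :
    ∃ κ : V n → ℕ, IsGrid κ ∧ 0 < ∫ ζ in unitCube n, wt (κ ζ) ∧
      ∀ ζ, ∀ᶠ ζ' in 𝓝 ζ, ζ ∈ O (κ ζ') := by
  classical
  obtain ⟨t, ht⟩ := isCompact_closedCube.elim_finite_subcover O hO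
    (s := closedCube n) fun ζ _ => mem_iUnion.2 (hcov ζ)
  -- A cell smaller than the Lebesgue number lies in one set of the finite subcover, and the indices
  -- of that subcover are below `N₀`; so each cell of a grid with N ≥ `N₀` has an admissible index.
  obtain ⟨δ, hδ, hleb⟩ := lebesgue_number_lemma_of_metric (c := fun k : t => O k)
    isCompact_closedCube (fun k => hO k) (fun ζ hζ => by
      have := ht hζ
      simp only [mem_iUnion] at this ⊢
      obtain ⟨k, hk, h⟩ := this
      exact ⟨⟨k, hk⟩, h⟩)
  obtain ⟨N₁, hN₁⟩ := exists_nat_gt ((n : ℝ) / δ)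
  set N₀ : ℕ := N₁ + t.sup id + 1 with hN₀
  -- Among the first N sets containing the whole closed cell, one of largest weight is chosen. The
  -- bound on the index makes the maximum exist.
  set P : ℕ → (Fin n → ℤ) → ℕ → Prop := fun N J k => k < N ∧ gridCell N J ⊆ O k ∧
    ∀ k' < N, gridCell N J ⊆ O k' → wt k' ≤ wt k with hP
  have hex : ∀ N ≥ N₀, ∀ ζ : V n, ∃ k, P N (gridCorner N ζ) k := by
    intro N hN ζ
    obtain ⟨⟨k, hk⟩, hball⟩ := hleb (fractVec ζ) (unitCube_subset (fractVec_mem ζ))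
    have hkN : k < N := by
      have : k ≤ t.sup id := Finset.le_sup (f := id) hk
      omega
    have hcell : gridCell N (gridCorner N ζ) ⊆ O k := by
      refine (gridCell_subset_ball (by omega) (fractVec_mem_gridCell N ζ) ?_).trans hball
      have h1 : (N₁ : ℝ) ≤ N := by exact_mod_cast (by omega : N₁ ≤ N)
      rw [div_lt_iff₀ hδ] at hN₁
      nlinarith
    obtain ⟨k₀, hk₀, hmax⟩ := Finset.exists_max_image
      ((Finset.range N).filter fun k => gridCell N (gridCorner N ζ) ⊆ O k) wt
      ⟨k, by simp [hkN, hcell]⟩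
    simp only [Finset.mem_filter, Finset.mem_range] at hk₀ hmax
    exact ⟨k₀, hk₀.1, hk₀.2, fun k' h1 h2 => hmax k' ⟨h1, h2⟩⟩
  set κ : ℕ → V n → ℕ := fun N ζ => Classical.epsilon (P N (gridCorner N ζ)) with hκ
  have hspec : ∀ N ≥ N₀, ∀ ζ : V n, P N (gridCorner N ζ) (κ N ζ) := fun N hN ζ =>
    Classical.epsilon_spec (hex N hN ζ)
  have hgrid : ∀ N ≥ N₀, IsGrid (κ N) := fun N hN =>
    (isGrid_gridCorner (by omega)).comp fun J => Classical.epsilon (P N J)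
  have hint : ∀ N ≥ N₀, IntegrableOn (fun ζ => wt (κ N ζ)) (unitCube n) := fun N hN =>
    ((hgrid N hN).comp wt).integrable
  -- As the mesh shrinks, each open set containing ζ eventually contains its cell modulo ℤⁿ, so the
  -- chosen weight eventually exceeds f(ζ) - ε. Taking the minimum with f turns this lower bound
  -- into convergence.
  have hlim : Filter.Tendsto (fun N => ∫ ζ in unitCube n, min (wt (κ (N + N₀) ζ)) (f ζ))
      Filter.atTop (𝓝 (∫ ζ in unitCube n, f ζ)) := by
    refine tendsto_integral_of_dominated_convergence (fun _ => B) (fun N => ?_)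
      (integrable_const _) (fun N => ?_) ?_
    · exact ((hint (N + N₀) (by omega)).inf hf).aestronglyMeasurable
    · refine Filter.Eventually.of_forall fun ζ => ?_
      rw [Real.norm_eq_abs]
      exact abs_min_le_max_abs_abs.trans (max_le (hB _) (hfb _))
    · refine ae_restrict_of_ae (hae.mono fun ζ h => ?_)
      rw [Metric.tendsto_atTop]
      intro ε hε
      obtain ⟨k, hk, hkε⟩ := h ε hε
      have hk' : fractVec ζ ∈ O k := by
        rw [fractVec_eq]
        exact (hper k ζ _).mpr hk
      obtain ⟨r, hr, hball⟩ := Metric.isOpen_iff.1 (hO k) _ hk'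
      obtain ⟨N₂, hN₂⟩ := exists_nat_gt ((n : ℝ) / r)
      refine ⟨N₂ + k, fun N hN => ?_⟩
      have hle : wt k ≤ wt (κ (N + N₀) ζ) := by
        refine (hspec (N + N₀) (by omega) ζ).2.2 k (by omega) ?_
        refine (gridCell_subset_ball (by omega) (fractVec_mem_gridCell _ ζ) ?_).trans hball
        have h1 : (N₂ : ℝ) ≤ (N + N₀ : ℕ) := by exact_mod_cast (by omega : N₂ ≤ N + N₀)
        rw [div_lt_iff₀ hr] at hN₂
        nlinarith
      rw [Real.dist_eq, abs_lt]
      rcases min_cases (wt (κ (N + N₀) ζ)) (f ζ) with ⟨e, h'⟩ | ⟨e, h'⟩ <;> rw [e] <;>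
        constructor <;> linarith
  obtain ⟨N, hN⟩ := ((hlim.eventually (lt_mem_nhds hpos))).exists
  refine ⟨κ (N + N₀), hgrid _ (by omega), hN.trans_le ?_, fun ζ => ?_⟩
  · exact integral_mono ((hint (N + N₀) (by omega)).inf hf) (hint (N + N₀) (by omega))
      fun ζ => min_le_left _ _
  · filter_upwards [eventually_mem_gridCell (N + N₀) ζ] with ζ' ⟨m, hm⟩
    exact (hper _ ζ m).mp ((hspec (N + N₀) (by omega) ζ').2.1 hm)

/-- A nondegenerate zero of `g₁(ζ, ·)` lies in arbitrarily short rational brackets. -/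
lemma exists_rat_bracket {g₁ g₂ : V n → ℝ → ℝ} {gz : V n → ℝ → V n}
    (hd : ∀ ζ τ, HasDerivAt (g₁ ζ) (g₂ ζ τ) τ)
    (h₂ : Continuous fun z : V n × ℝ => g₂ z.1 z.2) (hz : Continuous fun z : V n × ℝ => gz z.1 z.2)
    {b ζ : V n} {τ : ℝ} (hτ : 0 < τ) (h0 : g₁ ζ τ = 0) (hne : g₂ ζ τ ≠ 0) {w : ℝ}
    (hw : w < inner ℝ (gz ζ τ) b) :
    ∃ a : ℚ × ℚ, IsWeightedBracket g₁ g₂ gz b (((a.1 : ℝ), (a.2 : ℝ)), w) ζ := by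
  have c2 : Continuous (g₂ ζ) := h₂.comp (by fun_prop : Continuous fun τ : ℝ => (ζ, τ))
  have cz : Continuous fun τ => (inner ℝ (gz ζ τ) b : ℝ) :=
    (hz.comp (by fun_prop : Continuous fun τ : ℝ => (ζ, τ))).inner continuous_const
  have hev : ∀ᶠ τ' in 𝓝 τ, 0 < g₂ ζ τ * g₂ ζ τ' ∧ w < inner ℝ (gz ζ τ') b ∧ 0 < τ' := by
    refine Filter.Eventually.and ?_ (Filter.Eventually.and ?_ ?_)
    · exact (isOpen_lt continuous_const (continuous_const.mul c2)).mem_nhds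
        (mul_self_pos.2 hne)
    · exact (isOpen_lt continuous_const cz).mem_nhds hw
    · exact lt_mem_nhds hτ
  obtain ⟨e, he, hball⟩ := Metric.eventually_nhds_iff.1 hev
  set e' := min e (1 / 2) with he'
  have he'0 : 0 < e' := by positivity
  obtain ⟨α, hα1, hα2⟩ := exists_rat_btwn (by linarith : τ - e' < τ)
  obtain ⟨β, hβ1, hβ2⟩ := exists_rat_btwn (by linarith : τ < τ + e')
  have hin : ∀ τ' ∈ Icc (α : ℝ) β, 0 < g₂ ζ τ * g₂ ζ τ' ∧ w < inner ℝ (gz ζ τ') b ∧ 0 < τ' := by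
    intro τ' hτ'
    refine hball ?_
    rw [Real.dist_eq, abs_lt]
    have := min_le_left e (1 / 2)
    constructor <;> linarith [hτ'.1, hτ'.2]
  refine ⟨(α, β), ⟨(hin α ⟨le_rfl, (hα2.trans hβ1).le⟩).2.2, hα2.trans hβ1, ?_, ?_, ?_⟩, ?_⟩
  · have := min_le_right e (1 / 2)
    show (β : ℝ) < α + 1
    linarith
  -- The factor `g₂ ζ τ` makes the function increasing whatever the sign of the derivative.
  · have hmono : StrictMonoOn (fun t => g₂ ζ τ * g₁ ζ t) (Icc (α : ℝ) β) := by
      refine strictMonoOn_of_hasDerivWithinAt_pos (convex_Icc _ _) ?_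
        (f' := fun t => g₂ ζ τ * g₂ ζ t) ?_ ?_
      · exact fun t _ => ((hd ζ t).const_mul _).continuousAt.continuousWithinAt
      · exact fun t _ => ((hd ζ t).const_mul _).hasDerivWithinAt
      · exact fun t ht => (hin t (interior_subset ht)).1
    have m1 := hmono ⟨le_rfl, (hα2.trans hβ1).le⟩ ⟨hα2.le, hβ1.le⟩ hα2
    have m2 := hmono ⟨hα2.le, hβ1.le⟩ ⟨(hα2.trans hβ1).le, le_rfl⟩ hβ1
    simp only [h0, mul_zero] at m1 m2
    show g₁ ζ α * g₁ ζ β < 0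
    have m3 := mul_neg_of_neg_of_pos m1 m2
    have h4 : 0 < g₂ ζ τ ^ 2 := by positivity
    by_contra hcon
    nlinarith [mul_nonneg h4.le (not_lt.1 hcon)]
  · intro t ht h
    have := (hin t ht).1
    simp [h] at this
  · exact fun t ht => (hin t ht).2.1

/-- Brackets with rational ends and rational weights form a countable family of open periodic
conditions on ζ, to which `exists_grid_of_cover` applies. The function f records the component along
b that zeros at ζ can reach almost everywhere, while `hcov` supplies a bracket at the remaining ζ.
-/
theorem IsQuasiPeriodic.exists_grid {ν : V n} {g g₁ g₂ : V n → ℝ → ℝ} {gz : V n → ℝ → V n}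
    (h : IsQuasiPeriodic ν g g₁ g₂ gz) {b : V n} {L : ℝ} (hL : ∀ ζ τ, |inner ℝ (gz ζ τ) b| ≤ L)
    (hcov : ∀ ζ, ∃ τ > 0, g₁ ζ τ = 0 ∧ g₂ ζ τ ≠ 0)
    {f : V n → ℝ} (hf : IntegrableOn f (unitCube n)) (hfb : ∀ ζ, |f ζ| ≤ L)
    (hae : ∀ᵐ ζ : V n, ∀ ε > 0, ∃ τ > 0, g₁ ζ τ = 0 ∧ g₂ ζ τ ≠ 0 ∧ f ζ - ε < inner ℝ (gz ζ τ) b)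
    (hpos : 0 < ∫ ζ in unitCube n, f ζ) :
    ∃ A : V n → (ℝ × ℝ) × ℝ, IsGrid A ∧ 0 < ∫ ζ in unitCube n, (A ζ).2 ∧
      ∀ ζ, ∀ᶠ ζ' in 𝓝 ζ, IsWeightedBracket g₁ g₂ gz b (A ζ') ζ := by
  obtain ⟨q, hq⟩ := exists_surjective_nat ((ℚ × ℚ) × ℚ)
  -- Weights are clamped to a bounded interval as dominated convergence requires; the rational
  -- weights produced in `hfind` lie inside it and are not changed.
  set a : ℕ → (ℝ × ℝ) × ℝ := fun k => ((((q k).1.1 : ℝ), ((q k).1.2 : ℝ)),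
    max (-(L + 1)) (min (L + 1) ((q k).2 : ℝ))) with ha
  have hL0 : 0 ≤ L := (abs_nonneg _).trans (hL 0 0)
  have hk : ∀ k, |(a k).2| ≤ L + 1 := fun k => by
    rw [abs_le]
    exact ⟨le_max_left _ _, max_le (by linarith) (min_le_left _ _)⟩
  have hfind : ∀ (ζ : V n) (τ : ℝ), 0 < τ → g₁ ζ τ = 0 → g₂ ζ τ ≠ 0 → ∀ y : ℝ,
      y < inner ℝ (gz ζ τ) b → ∃ k, IsWeightedBracket g₁ g₂ gz b (a k) ζ ∧ y < (a k).2 := by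
    intro ζ τ hτ h0 hne y hy
    obtain ⟨w, hw1, hw2⟩ := exists_rat_btwn (max_lt hy
      (by linarith [(abs_le.1 (hL ζ τ)).1] : -(L + 1) < (inner ℝ (gz ζ τ) b : ℝ)))
    obtain ⟨c, hc⟩ := exists_rat_bracket h.hasDerivAt' h.cont₂ h.contz hτ h0 hne hw2
    obtain ⟨k, hk⟩ := hq (c, w)
    have e : max (-(L + 1)) (min (L + 1) (w : ℝ)) = w := by
      rw [min_eq_right (by linarith [(abs_le.1 (hL ζ τ)).2]), max_eq_right]
      exact (le_max_right _ _).trans hw1.le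
    refine ⟨k, ?_, ?_⟩
    · simp only [ha, hk, e]; exact hc
    · simp only [ha, hk, e]; exact (le_max_left _ _).trans_lt hw1
  have hopen : ∀ k, IsOpen {ζ | IsWeightedBracket g₁ g₂ gz b (a k) ζ} := fun k => by
    have := isOpen_isWeightedBracket (T := Unit) (g₁ := fun _ => g₁) (g₂ := fun _ => g₂)
      (gz := fun _ => gz) (h.cont₁.comp continuous_snd) (h.cont₂.comp continuous_snd)
      (h.contz.comp continuous_snd) (a k)
    exact this.preimage (by fun_prop : Continuous fun ζ : V n => (((), b), ζ))
  have hper : ∀ k, IsPeriodic (· ∈ {ζ | IsWeightedBracket g₁ g₂ gz b (a k) ζ}) := fun k ζ m => by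
    simp only [mem_ofPred_eq, IsWeightedBracket, IsBracket, h.periodic₁ ζ m, h.periodic₂ ζ m,
      h.periodicz ζ m]
  obtain ⟨κ, hκ, hint, hκr⟩ := exists_grid_of_cover hk hopen hper
    (fun ζ => by
      obtain ⟨τ, hτ, h0, hne⟩ := hcov ζ
      obtain ⟨k, hk, -⟩ := hfind ζ τ hτ h0 hne (inner ℝ (gz ζ τ) b - 1) (by linarith)
      exact ⟨k, hk⟩) hf (fun ζ => (hfb ζ).trans (by linarith))
    (by
      filter_upwards [hae] with ζ hζ ε hε
      obtain ⟨τ, hτ, h0, hne, hlt⟩ := hζ ε hε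
      exact hfind ζ τ hτ h0 hne _ hlt) hpos
  exact ⟨fun ζ => a (κ ζ), hκ.comp a, hint, hκr⟩

/-! ### Generic conditions, and Lipschitz functions differentiated along a direction. -/

/-- The point `(ζ - τ ν, τ)`. -/
def flowPt (ν ζ : V n) (τ : ℝ) : V n × ℝ := (ζ - τ • ν, τ)

/-- The points of a family are distinct modulo the integer lattice. -/
def DistinctMod {ι : Type*} (x : ι → V n × ℝ) : Prop :=
  ∀ i i', i ≠ i' → ∀ (m : Fin n → ℤ) (j : ℤ), x i ≠ x i' + (intVec m, (j : ℝ))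

/-- A set of conditions of infinite codimension. -/
structure IsGeneric (ν w : V n) (m : ℕ) (g₁ g₂ : V n → ℝ → ℝ) (gz : V n → ℝ → V n) : Prop where
  finite_degenerate : ∀ ζ, {τ | g₁ ζ τ = 0 ∧ g₂ ζ τ = 0}.Finite
  ae_nondegenerate : ∀ᵐ ζ : V n, ∀ τ, g₁ ζ τ = 0 → g₂ ζ τ ≠ 0
  no_chain : ∀ (ζ b : V n) (t : Fin m → ℝ),
    DistinctMod (fun i : Fin m => flowPt ν (ζ - (i : ℝ) • b) (t i)) →
    ¬ ∀ i : Fin m, g₁ (ζ - (i : ℝ) • b) (t i) = 0 ∧ inner ℝ (gz (ζ - (i : ℝ) • b) (t i)) w = 0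

section Lipschitz

variable {f : V n → ℝ} {K : NNReal}

lemma ae_hasDerivAt_line (hf : LipschitzWith K f) (b : V n) :
    ∀ᵐ ζ : V n, HasDerivAt (fun s : ℝ => f (ζ + s • b)) (lineDeriv ℝ f ζ b) 0 := by
  filter_upwards [hf.ae_lineDifferentiableAt (μ := volume) b] with ζ hζ
  exact hζ.hasLineDerivAt

/-- The Lipschitz bound dominates the difference quotients, so differentiation passes under the
integral although f has a derivative along b only almost everywhere. -/
lemma hasDerivAt_setIntegral_line (hf : LipschitzWith K f) (b : V n) {B : Set (V n)}
    (hB : volume B < ⊤) (hBb : Bornology.IsBounded B) (s : ℝ) :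
    HasDerivAt (fun s : ℝ => ∫ ζ in B, f (ζ + s • b)) (∫ ζ in B, lineDeriv ℝ f (ζ + s • b) b) s := by
  have : IsFiniteMeasure (volume.restrict B) := ⟨by simpa using hB⟩
  have hc : ∀ s : ℝ, Continuous fun ζ => f (ζ + s • b) := fun s =>
    hf.continuous.comp (by fun_prop)
  have hint : ∀ s : ℝ, Integrable (fun ζ => f (ζ + s • b)) (volume.restrict B) := fun s => by
    have hcomp : IsCompact (closure B) := hBb.isCompact_closure
    exact ((hc s).continuousOn.integrableOn_compact hcomp).mono_set subset_closure
  refine (hasDerivAt_integral_of_dominated_loc_of_lip (μ := volume.restrict B)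
    (F := fun (s : ℝ) ζ => f (ζ + s • b)) (s := univ) (x₀ := s)
    (bound := fun _ => K * ‖b‖) Filter.univ_mem ?_ (hint s) ?_ ?_ (integrable_const _) ?_).2
  · exact Filter.Eventually.of_forall fun s => (hc s).aestronglyMeasurable
  · have hm : Measurable fun ζ => lineDeriv ℝ f ζ b := measurable_lineDeriv hf.continuous
    exact (hm.comp (measurable_add_const (s • b))).aestronglyMeasurable
  · refine Filter.Eventually.of_forall fun ζ => LipschitzWith.lipschitzOnWith ?_
    refine LipschitzWith.of_dist_le_mul fun s s' => ?_
    refine (hf.dist_le_mul _ _).trans (le_of_eq ?_)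
    have e : ζ + s • b - (ζ + s' • b) = (s - s') • b := by module
    have e' : |(K : ℝ) * ‖b‖| = K * ‖b‖ := abs_of_nonneg (by positivity)
    rw [dist_eq_norm, e, norm_smul, Real.dist_eq, Real.norm_eq_abs, Real.coe_nnabs, e']
    ring
  · have h0 : ∀ᵐ ζ : V n, HasDerivAt (fun s' : ℝ => f (ζ + s • b + s' • b))
        (lineDeriv ℝ f (ζ + s • b) b) 0 :=
      (measurePreserving_add_right volume (s • b)).quasiMeasurePreserving.ae (ae_hasDerivAt_line hf b)
    refine ae_restrict_of_ae (h0.mono fun ζ h => ?_)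
    have h1 := HasDerivAt.comp_sub_const (f := fun s' : ℝ => f (ζ + s • b + s' • b)) (x := s) s
      (by simpa using h)
    refine h1.congr_of_eventuallyEq (Filter.Eventually.of_forall fun s' => ?_)
    have e : ζ + s • b + (s' - s) • b = ζ + s' • b := by module
    simp only [e]

lemma abs_lineDeriv_le (hf : LipschitzWith K f) {b : V n} (hb : ‖b‖ = 1) (ζ : V n) :
    |lineDeriv ℝ f ζ b| ≤ K := by
  simpa [hb] using norm_lineDeriv_le_of_lipschitz ℝ hf (x₀ := ζ) (v := b)

lemma integrableOn_lineDeriv (hf : LipschitzWith K f) {b : V n} (hb : ‖b‖ = 1) :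
    IntegrableOn (fun ζ => lineDeriv ℝ f ζ b) (unitCube n) :=
  Integrable.of_bound (measurable_lineDeriv hf.continuous).aestronglyMeasurable K
    (Filter.Eventually.of_forall fun ζ => abs_lineDeriv_le hf hb ζ)

lemma isBounded_unitCube : Bornology.IsBounded (unitCube n) :=
  isCompact_closedCube.isBounded.subset unitCube_subset

/-- The integral of f(ζ + sb) over a period does not depend on s. -/
lemma setIntegral_lineDeriv_eq_zero (hf : LipschitzWith K f) (hper : IsPeriodic f) (b : V n) :
    ∫ ζ in unitCube n, lineDeriv ℝ f ζ b = 0 := by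
  have h := hasDerivAt_setIntegral_line hf b volume_unitCube_lt_top isBounded_unitCube 0
  simp only [hper.setIntegral_add, zero_smul, add_zero] at h
  exact h.unique (hasDerivAt_const _ _)

/-- A Lipschitz function whose derivative along `b` is almost everywhere nonpositive in an open set
does not increase along `b`. -/
lemma le_of_lineDeriv_nonpos (hf : LipschitzWith K f) {b : V n} {W : Set (V n)}
    (h : ∀ᵐ ζ : V n, ζ ∈ W → lineDeriv ℝ f ζ b ≤ 0) {ζ₀ : V n} {s₀ r : ℝ} (hr : 0 < r)
    (hW : ∀ s ∈ Icc 0 s₀, Metric.ball (ζ₀ - s • b) r ⊆ W) {s : ℝ} (hs : s ∈ Icc 0 s₀) :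
    f ζ₀ ≤ f (ζ₀ - s • b) := by
  by_contra! hlt
  have hcont : Continuous fun ζ => f ζ - f (ζ - s • b) :=
    hf.continuous.sub (hf.continuous.comp (by fun_prop))
  obtain ⟨δ, hδ, hball⟩ := Metric.isOpen_iff.1 (isOpen_lt continuous_const hcont) ζ₀
    (by show (0 : ℝ) < f ζ₀ - f (ζ₀ - s • b); linarith)
  -- Averages over a small ball need the sign of the derivative only almost everywhere. They give
  -- F(0) ≤ F(-s), whereas the assumed strict inequality, which persists on the ball, gives the
  -- opposite.
  set B := Metric.ball ζ₀ (min δ r) with hB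
  have hBf : volume B < ⊤ := measure_ball_lt_top
  set F : ℝ → ℝ := fun s => ∫ ζ in B, f (ζ + s • b) with hF
  have hder := hasDerivAt_setIntegral_line hf b hBf Metric.isBounded_ball
  have hanti : AntitoneOn F (Icc (-s₀) 0) := by
    refine antitoneOn_of_deriv_nonpos (convex_Icc _ _)
      (fun x _ => (hder x).continuousAt.continuousWithinAt)
      (fun x _ => (hder x).differentiableAt.differentiableWithinAt) fun x hx => ?_
    rw [interior_Icc] at hx
    rw [(hder x).deriv]
    refine setIntegral_nonpos_ae measurableSet_ball ?_
    have h1 : ∀ᵐ ζ : V n, ζ + x • b ∈ W → lineDeriv ℝ f (ζ + x • b) b ≤ 0 :=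
      (measurePreserving_add_right volume (x • b)).quasiMeasurePreserving.ae h
    filter_upwards [h1] with ζ hζ hζB
    refine hζ (hW (-x) ⟨by linarith [hx.2], by linarith [hx.1]⟩ ?_)
    have : dist (ζ + x • b) (ζ₀ - (-x) • b) = dist ζ ζ₀ := by
      rw [neg_smul, sub_neg_eq_add, dist_add_right]
    rw [Metric.mem_ball, this]
    exact (Metric.mem_ball.1 hζB).trans_le (min_le_right _ _)
  have hle : F 0 ≤ F (-s) := hanti ⟨by linarith [hs.2], by linarith [hs.1]⟩
    ⟨by linarith [hs.1, hs.2], le_rfl⟩ (by linarith [hs.1])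
  have hint : ∀ s : ℝ, IntegrableOn (fun ζ => f (ζ + s • b)) B := fun s =>
    ((hf.continuous.comp (by fun_prop : Continuous fun ζ : V n => ζ + s • b)).continuousOn.integrableOn_compact
      (isCompact_closedBall ζ₀ (min δ r))).mono_set Metric.ball_subset_closedBall
  have hpos : 0 < ∫ ζ in B, (f (ζ + (0 : ℝ) • b) - f (ζ + (-s) • b)) := by
    rw [setIntegral_pos_iff_support_of_nonneg_ae]
    · refine lt_of_lt_of_le (Metric.measure_ball_pos volume ζ₀ (lt_min hδ hr)) (measure_mono ?_)
      intro ζ hζ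
      refine ⟨?_, hζ⟩
      have : (0 : ℝ) < f ζ - f (ζ - s • b) :=
        hball (Metric.ball_subset_ball (min_le_left _ _) hζ)
      simp only [Function.mem_support, zero_smul, add_zero, neg_smul, ← sub_eq_add_neg]
      exact this.ne'
    · refine (ae_restrict_iff' measurableSet_ball).2 (Filter.Eventually.of_forall fun ζ hζ => ?_)
      have : (0 : ℝ) < f ζ - f (ζ - s • b) :=
        hball (Metric.ball_subset_ball (min_le_left _ _) hζ)
      simp only [Pi.zero_apply, zero_smul, add_zero, neg_smul, ← sub_eq_add_neg]
      exact this.le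
    · exact (hint 0).sub (hint (-s))
  rw [integral_sub (hint 0) (hint (-s))] at hpos
  have : F 0 = ∫ ζ in B, f (ζ + (0 : ℝ) • b) := rfl
  have : F (-s) = ∫ ζ in B, f (ζ + (-s) • b) := rfl
  linarith

end Lipschitz

/-! ### Window maxima, and goodness of generic functions. -/

/-- The maximum over a window of an orbit. -/
def windowSup (g : V n → ℝ → ℝ) (t₁ t₂ : ℝ) (ζ : V n) : ℝ := sSup (g ζ '' Icc t₁ t₂)

lemma isClosed_range_intVec : IsClosed (range (intVec : (Fin n → ℤ) → V n)) := by
  have e : range (intVec : (Fin n → ℤ) → V n) =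
      ⋂ i, (fun ζ : V n => ζ i) ⁻¹' range ((↑) : ℤ → ℝ) := by
    ext ζ
    simp only [mem_range, mem_iInter, mem_preimage]
    constructor
    · rintro ⟨m, rfl⟩ i
      exact ⟨m i, rfl⟩
    · intro h
      choose m hm using h
      exact ⟨m, by ext i; simpa using hm i⟩
  rw [e]
  exact isClosed_iInter fun i => Int.isClosedEmbedding_coe_real.isClosed_range.preimage (by fun_prop)

lemma one_le_norm_intVec {m : Fin n → ℤ} (hm : intVec m ≠ (0 : V n)) : 1 ≤ ‖(intVec m : V n)‖ := by
  obtain ⟨i, hi⟩ : ∃ i, m i ≠ 0 := by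
    by_contra! h
    exact hm (by ext i; simp [h i])
  have h1 : ‖(intVec m : V n) i‖ ≤ ‖(intVec m : V n)‖ := PiLp.norm_apply_le _ i
  refine le_trans ?_ h1
  rw [intVec_apply, Real.norm_eq_abs]
  exact_mod_cast Int.one_le_abs hi

/-- Multiples of an irrational vector stay away from the lattice on bounded ranges. -/
lemma exists_lattice_gap {ν : V n} (hν : ∀ j : ℤ, j ≠ 0 → ∀ m, (j : ℝ) • ν ≠ intVec m) (T : ℤ) :
    ∃ d > 0, ∀ j : ℤ, |j| ≤ T → j ≠ 0 → ∀ m : Fin n → ℤ, d ≤ ‖(j : ℝ) • ν + intVec m‖ := by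
  have h : ∀ᶠ d : ℝ in 𝓝[>] 0, ∀ j ∈ Icc (-T) T, j ≠ 0 → ∀ m : Fin n → ℤ,
      d ≤ ‖(j : ℝ) • ν + intVec m‖ := by
    rw [Filter.eventually_all_finite (finite_Icc _ _)]
    intro j _
    by_cases hj : j = 0
    · exact Filter.Eventually.of_forall fun d h => absurd hj h
    have h1 : (j : ℝ) • ν ∉ range (intVec : (Fin n → ℤ) → V n) := fun ⟨m, hm⟩ => hν j hj m hm.symm
    obtain ⟨d, hd, hball⟩ := Metric.isOpen_iff.1 isClosed_range_intVec.isOpen_compl _ h1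
    filter_upwards [Ioo_mem_nhdsGT hd] with d' hd' _ m
    by_contra! hlt
    have hmem : (intVec (-m) : V n) ∈ Metric.ball ((j : ℝ) • ν) d := by
      rw [Metric.mem_ball, dist_eq_norm, norm_sub_rev, intVec_neg, sub_neg_eq_add]
      exact hlt.trans hd'.2
    exact hball hmem ⟨-m, rfl⟩
  obtain ⟨d, hd, hd0⟩ := (h.and self_mem_nhdsWithin).exists
  exact ⟨d, hd0, fun j hj => hd j (abs_le.1 hj)⟩

namespace IsQuasiPeriodic

variable {ν : V n} {g g₁ g₂ : V n → ℝ → ℝ} {gz : V n → ℝ → V n}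

/-- Uniform continuity on a compact cylinder, transported by periodicity and `shift`. The cube is
thickened because the point that accompanies the representative of ζ may lie outside it. -/
lemma uniform_gz (h : IsQuasiPeriodic ν g g₁ g₂ gz) {ε : ℝ} (hε : 0 < ε) :
    ∃ δ > 0, ∀ ζ ζ' τ, ‖ζ' - ζ‖ < δ → ‖gz ζ' τ - gz ζ τ‖ < ε := by
  have hK : IsCompact (Metric.cthickening 1 (closedCube n) ×ˢ Icc (0 : ℝ) 1) :=
    isCompact_closedCube.cthickening.prod isCompact_Icc
  have hu := Metric.uniformContinuousOn_iff.1
    (hK.uniformContinuousOn_of_continuous h.contz.continuousOn) ε hε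
  obtain ⟨δ, hδ, H⟩ := hu
  refine ⟨min δ 1, by positivity, fun ζ ζ' τ hlt => ?_⟩
  set v : V n := ((-⌊τ⌋ : ℤ) : ℝ) • ν with hv
  set m := -floorVec (ζ + v) with hm
  have e : ∀ ζ, gz ζ τ = gz (ζ + v + intVec m) (Int.fract τ) := by
    intro ζ
    rw [h.periodicz, ← h.shiftz ζ τ (-⌊τ⌋)]
    congr 1
    push_cast
    rw [← Int.self_sub_floor]; ring
  have hτ : Int.fract τ ∈ Icc (0 : ℝ) 1 := ⟨Int.fract_nonneg _, (Int.fract_lt_one _).le⟩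
  have h0 : ζ + v + intVec m ∈ closedCube n := by
    rw [hm, ← fractVec_eq]; exact unitCube_subset (fractVec_mem _)
  have hd : dist (ζ' + v + intVec m) (ζ + v + intVec m) = ‖ζ' - ζ‖ := by
    rw [dist_add_right, dist_add_right, dist_eq_norm]
  have h1 : ζ' + v + intVec m ∈ Metric.cthickening 1 (closedCube n) :=
    Metric.mem_cthickening_of_dist_le _ _ _ _ h0 (by rw [hd]; exact (hlt.trans_le (min_le_right _ _)).le)
  rw [e ζ, e ζ', ← dist_eq_norm]
  refine H (_, _) ⟨h1, hτ⟩ (_, _) ⟨Metric.self_subset_cthickening _ h0, hτ⟩ ?_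
  rw [Prod.dist_eq, dist_self, hd]
  exact max_lt (hlt.trans_le (min_le_left _ _)) hδ

/-- If `f` majorizes `g(·, τ)` and almost touches it at `ζ`, the derivatives almost agree. -/
lemma touching (h : IsQuasiPeriodic ν g g₁ g₂ gz) {b ζ : V n} (hb : ‖b‖ = 1) {f : V n → ℝ} {D : ℝ}
    (hD : HasDerivAt (fun s : ℝ => f (ζ + s • b)) D 0) {ε : ℝ} (hε : 0 < ε) :
    ∃ δ > 0, ∀ τ, (∀ ζ', g ζ' τ ≤ f ζ') → f ζ - δ < g ζ τ → D - ε < inner ℝ (gz ζ τ) b := by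
  obtain ⟨δ₁, hδ₁, hu⟩ := h.uniform_gz (show 0 < ε / 4 by positivity)
  have hs := hasDerivAt_iff_tendsto_slope_zero.1 hD
  obtain ⟨ρ, hρ, hρ'⟩ := Metric.mem_nhdsWithin_iff.1 (hs (Metric.ball_mem_nhds D (show 0 < ε / 4 by positivity)))
  set r := min ρ δ₁ / 2 with hr
  have hr0 : 0 < r := by positivity
  have hr1 : r < ρ := by have := min_le_left ρ δ₁; linarith
  have hr2 : r < δ₁ := by have := min_le_right ρ δ₁; linarith
  -- The mean value theorem compares ζ with ζ - rb. The total loss ε splits into ε/4 for the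
  -- difference quotient of f, ε/2 for δ/r, and ε/4 for the variation of `gz` over the step.
  refine ⟨ε * r / 2, by positivity, fun τ hle hlt => ?_⟩
  have h1 : -r ∈ Metric.ball (0 : ℝ) ρ ∩ {0}ᶜ := by
    refine ⟨by simpa [abs_of_pos hr0] using hr1, by simpa using hr0.ne'⟩
  have h2 := hρ' h1
  simp only [mem_preimage, Metric.mem_ball, zero_add, zero_smul, add_zero, smul_eq_mul] at h2
  rw [Real.dist_eq, abs_lt] at h2
  have h3 : f (ζ + (-r) • b) - f ζ ≤ -r * (D - ε / 4) := by
    have h4 := h2.1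
    have e : (-r)⁻¹ * (f (ζ + (-r) • b) - f ζ) * (-r) = f (ζ + (-r) • b) - f ζ := by
      field_simp
    rw [← e]
    nlinarith
  have hder : ∀ s : ℝ, HasDerivAt (fun s : ℝ => g (ζ + s • b) τ) (inner ℝ (gz (ζ + s • b) τ) b) s := by
    intro s
    have h5 : HasDerivAt (fun s : ℝ => ζ + s • b) b s := by
      simpa using ((hasDerivAt_id s).smul_const b).const_add ζ
    exact (h.hasFDerivAt (ζ + s • b) τ).comp_hasDerivAt s h5
  obtain ⟨c, hc, hc'⟩ := exists_hasDerivAt_eq_slope (fun s : ℝ => g (ζ + s • b) τ)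
    (fun s => inner ℝ (gz (ζ + s • b) τ) b) (neg_lt_zero.2 hr0)
    (fun s _ => (hder s).continuousAt.continuousWithinAt) fun s _ => hder s
  simp only [zero_smul, add_zero, sub_neg_eq_add, zero_add] at hc'
  rw [eq_div_iff hr0.ne'] at hc'
  have h6 : inner ℝ (gz (ζ + c • b) τ) b - inner ℝ (gz ζ τ) b < ε / 4 := by
    rw [← inner_sub_left]
    refine (real_inner_le_norm _ _).trans_lt ?_
    rw [hb, mul_one]
    refine hu _ _ _ ?_
    rw [add_sub_cancel_left, norm_smul, hb, mul_one, Real.norm_eq_abs, abs_lt]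
    constructor <;> linarith [hc.1, hc.2]
  have h7 := hle (ζ + (-r) • b)
  have h8 : r * (D - ε) < r * inner ℝ (gz ζ τ) b := by nlinarith
  exact lt_of_mul_lt_mul_left h8 hr0.le

lemma exists_windowSup (h : IsQuasiPeriodic ν g g₁ g₂ gz) {t₁ t₂ : ℝ} (ht : t₁ ≤ t₂) (ζ : V n) :
    ∃ τ ∈ Icc t₁ t₂, g ζ τ = windowSup g t₁ t₂ ζ ∧ ∀ τ' ∈ Icc t₁ t₂, g ζ τ' ≤ windowSup g t₁ t₂ ζ := by
  have hc : Continuous (g ζ) := h.cont.comp (by fun_prop : Continuous fun τ : ℝ => (ζ, τ))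
  obtain ⟨τ, hτ, h1, h2⟩ := isCompact_Icc.exists_sSup_image_eq_and_ge (nonempty_Icc.2 ht)
    hc.continuousOn
  exact ⟨τ, hτ, h1.symm, fun τ' hτ' => (h2 τ' hτ').trans h1.ge⟩

lemma lipschitz_windowSup (h : IsQuasiPeriodic ν g g₁ g₂ gz) {t₁ t₂ : ℝ} (ht : t₁ ≤ t₂) {L : ℝ}
    (hL : ∀ ζ ζ' τ, |g ζ τ - g ζ' τ| ≤ L * ‖ζ - ζ'‖) (ζ ζ' : V n) :
    |windowSup g t₁ t₂ ζ - windowSup g t₁ t₂ ζ'| ≤ L * ‖ζ - ζ'‖ := by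
  have key : ∀ ζ ζ' : V n, windowSup g t₁ t₂ ζ ≤ windowSup g t₁ t₂ ζ' + L * ‖ζ - ζ'‖ := by
    intro ζ ζ'
    obtain ⟨τ, hτ, h1, -⟩ := h.exists_windowSup ht ζ
    obtain ⟨-, -, -, h2⟩ := h.exists_windowSup ht ζ'
    have h3 := (abs_le.1 (hL ζ ζ' τ)).2
    have h4 := h2 τ hτ
    linarith
  rw [abs_le]
  have h1 := key ζ ζ'
  have h2 := key ζ' ζ
  rw [norm_sub_rev] at h2
  constructor <;> linarith

lemma windowSup_le (h : IsQuasiPeriodic ν g g₁ g₂ gz) {t₁ t₂ : ℝ} (ht : t₁ ≤ t₂) (ζ : V n) :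
    windowSup g t₁ t₂ ζ ≤ orbitSup g ζ := by
  obtain ⟨τ, -, h1, -⟩ := h.exists_windowSup ht ζ
  rw [← h1]; exact h.le_orbitSup ζ τ

lemma periodic_windowSup (h : IsQuasiPeriodic ν g g₁ g₂ gz) (t₁ t₂ : ℝ) :
    IsPeriodic (windowSup g t₁ t₂) := fun ζ m => by
  simp only [windowSup, h.periodic ζ m]

/-- A point where the global maximum is attained, inside a window in `(0, ∞)` at whose ends the
function is smaller. -/
lemma exists_maximum (h : IsQuasiPeriodic ν g g₁ g₂ gz) (hlt : ∀ ζ, ∃ t, g ζ t < orbitSup g ζ) :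
    ∃ ζ t₁ t₂, 0 < t₁ ∧ t₁ < t₂ ∧ ∃ t ∈ Icc t₁ t₂, g ζ t = orbitSup g ζ ∧
      g ζ t₁ < g ζ t ∧ g ζ t₂ < g ζ t := by
  obtain ⟨⟨ζ₀, t₀⟩, -, hmax⟩ := (isCompact_closedCube.prod isCompact_Icc).exists_isMaxOn
    (s := closedCube n ×ˢ Icc (0 : ℝ) 1)
    ⟨(0, 0), fun i => ⟨le_rfl, zero_le_one⟩, le_rfl, zero_le_one⟩ h.cont.continuousOn
  have hG : ∀ ζ τ, g ζ τ ≤ g ζ₀ t₀ := fun ζ τ => by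
    obtain ⟨ζ', h1, τ', h2, e⟩ := eq_fract h.periodic h.shift ζ τ
    rw [← e]; exact hmax (show (ζ', τ') ∈ closedCube n ×ˢ Icc (0 : ℝ) 1 from ⟨h1, h2⟩)
  obtain ⟨ts, hts⟩ := hlt ζ₀
  have hM : orbitSup g ζ₀ = g ζ₀ t₀ := le_antisymm (ciSup_le fun τ => hG _ _) (h.le_orbitSup _ _)
  rw [hM] at hts
  -- The point `ts` below the maximum has low copies ts - j and ts + j on either side of t₀.
  -- Translating ζ₀ by Jν and times by J preserves all values and makes the window positive.
  obtain ⟨j, hj, hap⟩ := h.almost_period (show 0 < (g ζ₀ t₀ - g ζ₀ ts) / 2 by linarith) ⌈|t₀| + |ts|⌉₊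
  have hj' : |t₀| + |ts| < j := (Nat.le_ceil _).trans_lt (by exact_mod_cast hj)
  have a1 := (abs_le.1 (hap ζ₀ (ts - j))).1
  have a2 := (abs_le.1 (hap ζ₀ ts)).2
  rw [sub_add_cancel] at a1
  obtain ⟨J, hJ⟩ := exists_nat_gt (j - ts : ℝ)
  have hs : ∀ τ, g (ζ₀ + (J : ℝ) • ν) (τ + J) = g ζ₀ τ := fun τ => by
    have := h.shift ζ₀ τ (J : ℤ)
    simpa using this
  have b1 := neg_abs_le t₀
  have b2 := le_abs_self t₀
  have b3 := neg_abs_le ts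
  have b4 := le_abs_self ts
  refine ⟨ζ₀ + (J : ℝ) • ν, ts - j + J, ts + j + J, by linarith, ?_, t₀ + J,
    ⟨by linarith, by linarith⟩, ?_, ?_, ?_⟩
  · have := abs_nonneg t₀; have := abs_nonneg ts; linarith
  · rw [hs]
    refine le_antisymm ?_ (ciSup_le fun τ => hG _ _)
    rw [← hs]; exact h.le_orbitSup _ _
  · rw [hs, hs]; linarith
  · rw [hs, hs]; linarith

/-- Otherwise g would be constant on the orbit and every τ a degenerate zero. -/
lemma exists_lt_orbitSup (h : IsQuasiPeriodic ν g g₁ g₂ gz)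
    (hfin : ∀ ζ, {τ | g₁ ζ τ = 0 ∧ g₂ ζ τ = 0}.Finite) (ζ : V n) : ∃ t, g ζ t < orbitSup g ζ := by
  by_contra! hle
  have hconst : g ζ = fun _ => orbitSup g ζ := funext fun t => le_antisymm (h.le_orbitSup ζ t) (hle t)
  have h1 : g₁ ζ = fun _ => 0 := funext fun t => by
    have := h.hasDerivAt ζ t
    rw [hconst] at this
    exact this.unique (hasDerivAt_const _ _)
  have h2 : g₂ ζ = fun _ => 0 := funext fun t => by
    have := h.hasDerivAt' ζ t
    rw [h1] at this
    exact this.unique (hasDerivAt_const _ _)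
  have := hfin ζ
  simp only [h1, h2, and_self] at this
  exact infinite_univ this

/-- Critical points occur at arbitrarily large τ, and only finitely many of them are degenerate. -/
lemma exists_nondegenerate (h : IsQuasiPeriodic ν g g₁ g₂ gz)
    (hfin : ∀ ζ, {τ | g₁ ζ τ = 0 ∧ g₂ ζ τ = 0}.Finite) (ζ : V n) :
    ∃ τ > 0, g₁ ζ τ = 0 ∧ g₂ ζ τ ≠ 0 := by
  obtain ⟨t, ht⟩ := h.exists_lt_orbitSup hfin ζ
  obtain ⟨T, hT⟩ := (hfin ζ).bddAbove
  obtain ⟨τ, hτ, h0, -⟩ := h.exists_critical ht one_pos (max T 0)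
  refine ⟨τ, (le_max_right _ _).trans_lt hτ, h0, fun h2 => ?_⟩
  have := hT ⟨h0, h2⟩
  exact absurd ((le_max_left _ _).trans_lt hτ) (not_lt.2 this)

/-- Inside a window, the derivative of the maximum does not exceed that of the orbit supremum, if
there is no direction-`b` choice of brackets with positive average. -/
lemma lineDeriv_windowSup_le (h : IsQuasiPeriodic ν g g₁ g₂ gz)
    (hfin : ∀ ζ, {τ | g₁ ζ τ = 0 ∧ g₂ ζ τ = 0}.Finite)
    (hae : ∀ᵐ ζ : V n, ∀ τ, g₁ ζ τ = 0 → g₂ ζ τ ≠ 0) {b : V n} (hb : ‖b‖ = 1)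
    (hbad : ¬ ∃ A : V n → (ℝ × ℝ) × ℝ, IsGrid A ∧ 0 < ∫ ζ in unitCube n, (A ζ).2 ∧
      ∀ ζ, ∀ᶠ ζ' in 𝓝 ζ, IsWeightedBracket g₁ g₂ gz b (A ζ') ζ)
    {t₁ t₂ : ℝ} (ht₁ : 0 < t₁) (ht : t₁ < t₂) :
    ∀ᵐ ζ : V n, g ζ t₁ < windowSup g t₁ t₂ ζ ∧ g ζ t₂ < windowSup g t₁ t₂ ζ →
      lineDeriv ℝ (windowSup g t₁ t₂) ζ b ≤ lineDeriv ℝ (orbitSup g) ζ b := by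
  classical
  obtain ⟨L, hL0, hgz, hL⟩ := h.exists_lipschitz
  set S := windowSup g t₁ t₂ with hS
  set M := orbitSup g with hM
  set K : NNReal := ⟨L, hL0⟩ with hK
  have lipM : LipschitzWith K M := LipschitzWith.of_dist_le_mul fun ζ ζ' => by
    rw [Real.dist_eq, dist_eq_norm]; exact h.lipschitz_orbitSup hL ζ ζ'
  have lipS : LipschitzWith K S := LipschitzWith.of_dist_le_mul fun ζ ζ' => by
    rw [Real.dist_eq, dist_eq_norm]; exact h.lipschitz_windowSup ht.le hL ζ ζ'
  set W : Set (V n) := {ζ | g ζ t₁ < S ζ ∧ g ζ t₂ < S ζ} with hW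
  have hWo : IsOpen W := by
    have hc : ∀ t, Continuous fun ζ => g ζ t := fun t =>
      h.cont.comp (by fun_prop : Continuous fun ζ : V n => (ζ, t))
    exact (isOpen_lt (hc _) lipS.continuous).inter (isOpen_lt (hc _) lipS.continuous)
  have perW : IsPeriodic (· ∈ W) := fun ζ m => by
    simp only [hW, mem_ofPred_eq, h.periodic ζ m, hS, h.periodic_windowSup t₁ t₂ ζ m]
  have perD : ∀ {f : V n → ℝ}, IsPeriodic f → IsPeriodic fun ζ => lineDeriv ℝ f ζ b := by
    intro f hf ζ m
    simp only [lineDeriv]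
    congr 1
    ext s
    rw [add_right_comm, hf]
  set DM := fun ζ => lineDeriv ℝ M ζ b with hDM
  set DS := fun ζ => lineDeriv ℝ S ζ b with hDS
  -- f is the best rate obtained from the two maxima: ∂_b M everywhere, and also ∂_b S where the
  -- window maximum is not reached at the ends.
  set f : V n → ℝ := fun ζ => if ζ ∈ W then max (DM ζ) (DS ζ) else DM ζ with hf
  have mM : Measurable DM := measurable_lineDeriv lipM.continuous
  have mS : Measurable DS := measurable_lineDeriv lipS.continuous
  have hfm : Measurable f := Measurable.ite hWo.measurableSet (mM.max mS) mM
  have hfb : ∀ ζ, |f ζ| ≤ L := fun ζ => by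
    simp only [hf]
    split_ifs
    · exact abs_max_le_max_abs_abs.trans
        (max_le (abs_lineDeriv_le lipM hb ζ) (abs_lineDeriv_le lipS hb ζ))
    · exact abs_lineDeriv_le lipM hb ζ
  have hfi : IntegrableOn f (unitCube n) :=
    Integrable.of_bound hfm.aestronglyMeasurable L (Filter.Eventually.of_forall hfb)
  have hgb : ∀ ζ τ, |inner ℝ (gz ζ τ) b| ≤ L := fun ζ τ => by
    refine (abs_real_inner_le_norm _ _).trans ?_
    rw [hb, mul_one]; exact hgz ζ τ
  have hapx : ∀ᵐ ζ : V n, ∀ ε > 0,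
      ∃ τ > 0, g₁ ζ τ = 0 ∧ g₂ ζ τ ≠ 0 ∧ f ζ - ε < inner ℝ (gz ζ τ) b := by
    filter_upwards [hae, ae_hasDerivAt_line lipM b, ae_hasDerivAt_line lipS b] with ζ hnd hdM hdS ε hε
    have hMcase : ∃ τ > 0, g₁ ζ τ = 0 ∧ g₂ ζ τ ≠ 0 ∧ DM ζ - ε < inner ℝ (gz ζ τ) b := by
      obtain ⟨δ, hδ, htouch⟩ := h.touching hb hdM hε
      obtain ⟨t, ht⟩ := h.exists_lt_orbitSup hfin ζ
      obtain ⟨τ, hτ, h0, hlt⟩ := h.exists_critical ht hδ 0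
      exact ⟨τ, hτ, h0, hnd τ h0, htouch τ (fun ζ' => h.le_orbitSup ζ' τ) hlt⟩
    by_cases hζ : ζ ∈ W
    · rcases le_total (DS ζ) (DM ζ) with hle | hle
      · simpa [hf, hζ, hle] using hMcase
      · obtain ⟨δ, hδ, htouch⟩ := h.touching hb hdS hε
        obtain ⟨τ, hτ, e, hmax⟩ := h.exists_windowSup ht.le ζ
        have n1 : τ ≠ t₁ := fun e' => by
          have := hζ.1; rw [e'] at e; exact absurd e this.ne
        have n2 : τ ≠ t₂ := fun e' => by
          have := hζ.2; rw [e'] at e; exact absurd e this.ne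
        have hin : τ ∈ Ioo t₁ t₂ := ⟨lt_of_le_of_ne hτ.1 n1.symm, lt_of_le_of_ne hτ.2 n2⟩
        have hloc : IsLocalMax (g ζ) τ := by
          filter_upwards [Icc_mem_nhds hin.1 hin.2] with τ' hτ'
          rw [e]; exact hmax τ' hτ'
        have h0 := hloc.hasDerivAt_eq_zero (h.hasDerivAt ζ τ)
        refine ⟨τ, ht₁.trans hin.1, h0, hnd τ h0, ?_⟩
        have := htouch τ (fun ζ' => by
          obtain ⟨-, -, -, hmax'⟩ := h.exists_windowSup ht.le ζ'
          exact hmax' τ hτ) (by rw [e]; show S ζ - δ < S ζ; linarith)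
        simpa [hf, hζ, hle] using this
    · simpa [hf, hζ] using hMcase
  -- A positive mean of f would contradict `hbad` through `exists_grid`. Since f ≥ ∂_b M and ∂_b M
  -- has mean zero, f = ∂_b M almost everywhere, which on `W` says ∂_b S ≤ ∂_b M.
  have hle0 : ∫ ζ in unitCube n, f ζ ≤ 0 := by
    by_contra! hpos
    exact hbad (h.exists_grid hgb (h.exists_nondegenerate hfin) hfi hfb hapx hpos)
  have hDM0 : ∫ ζ in unitCube n, DM ζ = 0 :=
    setIntegral_lineDeriv_eq_zero lipM h.periodic_orbitSup b
  have hDMi : IntegrableOn DM (unitCube n) := integrableOn_lineDeriv lipM hb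
  have hnn : ∀ ζ, 0 ≤ f ζ - DM ζ := fun ζ => by
    simp only [hf]
    split_ifs
    · exact sub_nonneg.2 (le_max_left _ _)
    · simp
  have hint0 : ∫ ζ in unitCube n, (f ζ - DM ζ) = 0 := by
    refine le_antisymm ?_ (integral_nonneg hnn)
    rw [integral_sub hfi hDMi, hDM0]; linarith
  have hz := (integral_eq_zero_iff_of_nonneg hnn (hfi.sub hDMi)).1 hint0
  refine ae_of_ae_unitCube (P := fun ζ => ζ ∈ W → DS ζ ≤ DM ζ) (fun ζ m => ?_) ?_
  · have e1 := perW ζ m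
    have e2 := perD h.periodic_orbitSup ζ m
    have e3 := perD (h.periodic_windowSup t₁ t₂) ζ m
    simp only at e1 e2 e3
    simp only [hDM, hDS, hM, hS, e1, e2, e3]
  · filter_upwards [hz] with ζ hζ hζW
    have : f ζ - DM ζ = 0 := hζ
    simp only [hf, if_pos hζW] at this
    have := le_max_right (DM ζ) (DS ζ)
    linarith

/-- Generic quasiperiodic functions are good. -/
theorem isGood (h : IsQuasiPeriodic ν g g₁ g₂ gz)
    (hν : ∀ j : ℤ, j ≠ 0 → ∀ m, (j : ℝ) • ν ≠ intVec m) {w : V n}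
    (hw : ∀ f : V n → ℝ, Continuous f → IsPeriodic f → (∀ ζ, f (ζ + ν) = f ζ) →
      ∀ (s : ℝ) ζ, f (ζ + s • w) = f ζ) {m : ℕ} (hgen : IsGeneric ν w m g₁ g₂ gz) :
    IsGood g₁ g₂ gz := by
  intro b hb
  by_contra hbad
  obtain ⟨hfin, hae, hchain⟩ := hgen
  obtain ⟨ζ₀, t₁, t₂, ht₁, ht, t₀, ht₀, hmax, hl1, hl2⟩ :=
    h.exists_maximum (h.exists_lt_orbitSup hfin)
  obtain ⟨L, hL0, hgz, hL⟩ := h.exists_lipschitz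
  set S := windowSup g t₁ t₂ with hS
  set M := orbitSup g with hM
  set K : NNReal := ⟨L, hL0⟩ with hK
  have lipM : LipschitzWith K M := LipschitzWith.of_dist_le_mul fun ζ ζ' => by
    rw [Real.dist_eq, dist_eq_norm]; exact h.lipschitz_orbitSup hL ζ ζ'
  have lipS : LipschitzWith K S := LipschitzWith.of_dist_le_mul fun ζ ζ' => by
    rw [Real.dist_eq, dist_eq_norm]; exact h.lipschitz_windowSup ht.le hL ζ ζ'
  set W : Set (V n) := {ζ | g ζ t₁ < S ζ ∧ g ζ t₂ < S ζ} with hW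
  have hWo : IsOpen W := by
    have hc : ∀ t, Continuous fun ζ => g ζ t := fun t =>
      h.cont.comp (by fun_prop : Continuous fun ζ : V n => (ζ, t))
    exact (isOpen_lt (hc _) lipS.continuous).inter (isOpen_lt (hc _) lipS.continuous)
  have hS0 : S ζ₀ = M ζ₀ := by
    refine le_antisymm (h.windowSup_le ht.le ζ₀) ?_
    rw [← hmax]
    obtain ⟨-, -, -, h1⟩ := h.exists_windowSup ht.le ζ₀
    exact h1 t₀ ht₀
  have hζ₀ : ζ₀ ∈ W := by
    show g ζ₀ t₁ < S ζ₀ ∧ g ζ₀ t₂ < S ζ₀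
    rw [hS0, ← hmax]; exact ⟨hl1, hl2⟩
  obtain ⟨r, hr, hball⟩ := Metric.isOpen_iff.1 hWo ζ₀ hζ₀
  have hder : ∀ᵐ ζ : V n, ζ ∈ W → lineDeriv ℝ (S - M) ζ b ≤ 0 := by
    filter_upwards [h.lineDeriv_windowSup_le hfin hae hb hbad ht₁ ht, ae_hasDerivAt_line lipM b,
      ae_hasDerivAt_line lipS b] with ζ h1 h2 h3 hζ
    have h4 : HasLineDerivAt ℝ (S - M) (lineDeriv ℝ S ζ b - lineDeriv ℝ M ζ b) ζ b := h3.sub h2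
    rw [h4.lineDeriv]
    exact sub_nonpos.2 (h1 hζ)
  -- S - M is never positive, vanishes at `ζ₀` and does not decrease in the direction -b while the
  -- path stays in `W`.
  have hSM : ∀ s ∈ Icc 0 (r / 2), S (ζ₀ - s • b) = M (ζ₀ - s • b) := by
    intro s hs
    refine le_antisymm (h.windowSup_le ht.le _) ?_
    have := le_of_lineDeriv_nonpos (lipS.sub lipM) hder (ζ₀ := ζ₀) (s₀ := r / 2) (half_pos hr)
      (fun s hs => (Metric.ball_subset_ball' ?_).trans hball) hs
    · have h1 : S ζ₀ - M ζ₀ ≤ S (ζ₀ - s • b) - M (ζ₀ - s • b) := this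
      linarith
    · rw [dist_eq_norm, sub_sub_cancel_left, norm_neg, norm_smul, hb, mul_one, Real.norm_eq_abs,
        abs_of_nonneg hs.1]
      linarith [hs.2]
  -- The chain must consist of distinct points of the torus. A coincidence with time difference j
  -- would make jν + M' as short as a part of the chain; the chain is kept shorter than d, which
  -- excludes j ≠ 0, and than 1, which excludes j = 0. The bound r/2 keeps it on the segment where S
  -- = M.
  obtain ⟨d, hd, hgap⟩ := exists_lattice_gap hν ⌈t₂ - t₁⌉
  set δ := min (min d 1) (r / 2) / (m + 1) with hδ
  have hδ0 : 0 < δ := by positivity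
  have hmδ : ∀ i : Fin m, (i : ℝ) * δ < min (min d 1) (r / 2) := by
    intro i
    have hi : (i : ℝ) < m + 1 := by
      have : (i : ℕ) < m + 1 := by omega
      exact_mod_cast this
    rw [hδ, mul_div_assoc', div_lt_iff₀ (by positivity)]
    have : 0 < min (min d 1) (r / 2) := by positivity
    nlinarith
  have hsi : ∀ i : Fin m, (i : ℝ) * δ ∈ Icc 0 (r / 2) := fun i =>
    ⟨by positivity, ((hmδ i).trans_le (min_le_right _ _)).le⟩
  have hex : ∀ i : Fin m, ∃ t ∈ Icc t₁ t₂, g (ζ₀ - (i : ℝ) • δ • b) t = M (ζ₀ - (i : ℝ) • δ • b) := by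
    intro i
    obtain ⟨t, ht', e, -⟩ := h.exists_windowSup ht.le (ζ₀ - (i : ℝ) • δ • b)
    refine ⟨t, ht', e.trans ?_⟩
    have := hSM _ (hsi i)
    rwa [mul_smul] at this
  choose t htI hte using hex
  refine hchain ζ₀ (δ • b) t ?_ fun i => ⟨?_, ?_⟩
  · intro i i' hne M' j heq
    simp only [flowPt, Prod.mk_add_mk, Prod.mk.injEq] at heq
    obtain ⟨e1, e2⟩ := heq
    have e3 : (((i' : ℝ) - i) * δ) • b = (j : ℝ) • ν + intVec M' := by
      rw [e2] at e1
      have : ζ₀ - (i : ℝ) • δ • b - (t i' + j) • ν + ((i : ℝ) • δ • b) + (t i' + j) • ν - ζ₀ +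
        (i' : ℝ) • δ • b - (i : ℝ) • δ • b = ζ₀ - (i' : ℝ) • δ • b - t i' • ν + intVec M' +
        ((i : ℝ) • δ • b) + (t i' + j) • ν - ζ₀ + (i' : ℝ) • δ • b - (i : ℝ) • δ • b := by rw [e1]
      calc (((i' : ℝ) - i) * δ) • b = ζ₀ - (i : ℝ) • δ • b - (t i' + j) • ν + ((i : ℝ) • δ • b) +
            (t i' + j) • ν - ζ₀ + (i' : ℝ) • δ • b - (i : ℝ) • δ • b := by module
        _ = _ := this
        _ = (j : ℝ) • ν + intVec M' := by module
    have hii : |(i' : ℝ) - i| * δ < min (min d 1) (r / 2) := by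
      have a1 := hmδ i
      have a2 := hmδ i'
      have a3 : 0 ≤ (i : ℝ) * δ := by positivity
      have a4 : 0 ≤ (i' : ℝ) * δ := by positivity
      have e : |(i' : ℝ) - i| * δ = |((i' : ℝ) - i) * δ| := by rw [abs_mul, abs_of_pos hδ0]
      rw [e, abs_lt]
      constructor <;> nlinarith
    have hn : ‖(j : ℝ) • ν + intVec M'‖ = |(i' : ℝ) - i| * δ := by
      rw [← e3, norm_smul, hb, mul_one, Real.norm_eq_abs, abs_mul, abs_of_pos hδ0]
    have hii0 : 0 < |(i' : ℝ) - i| * δ := by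
      refine mul_pos (abs_pos.2 (sub_ne_zero.2 ?_)) hδ0
      exact_mod_cast fun e => hne (Fin.ext e).symm
    by_cases hj : j = 0
    · subst hj
      rw [Int.cast_zero, zero_smul, zero_add] at hn
      have h1 : (intVec M' : V n) ≠ 0 := fun e => by rw [e, norm_zero] at hn; exact hii0.ne hn
      have h2 := one_le_norm_intVec h1
      have h3 := (min_le_left (min d 1) (r / 2)).trans (min_le_right _ _)
      linarith
    · have hjT : |j| ≤ ⌈t₂ - t₁⌉ := by
        have : |(j : ℝ)| ≤ t₂ - t₁ := by
          have h1 := htI i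
          have h2 := htI i'
          rw [abs_le]
          constructor <;> linarith [h1.1, h1.2, h2.1, h2.2]
        have h3 : |(j : ℝ)| ≤ ⌈t₂ - t₁⌉ := this.trans (Int.le_ceil _)
        exact_mod_cast h3
      have h2 := hgap j hjT hj M'
      have h3 := (min_le_left (min d 1) (r / 2)).trans (min_le_left _ _)
      linarith
  · have hloc : IsLocalMax (g (ζ₀ - (i : ℝ) • δ • b)) (t i) :=
      Filter.Eventually.of_forall fun τ => by rw [hte i]; exact h.le_orbitSup _ τ
    exact hloc.hasDerivAt_eq_zero (h.hasDerivAt _ _)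
  -- M is constant on the line x + ℝw, touches g(·, t i) at x and dominates it elsewhere, so g(·, t
  -- i) restricted to the line has a maximum at x.
  · set x := ζ₀ - (i : ℝ) • δ • b with hx
    have hinv := hw M h.continuous_orbitSup h.periodic_orbitSup h.orbitSup_shift
    have hloc : IsLocalMax (fun s : ℝ => g (x + s • w) (t i)) 0 := by
      refine Filter.Eventually.of_forall fun s => ?_
      simp only [zero_smul, add_zero]
      rw [hte i, ← hinv s x]; exact h.le_orbitSup _ _
    have h5 : HasDerivAt (fun s : ℝ => x + s • w) w 0 := by
      simpa using ((hasDerivAt_id (0 : ℝ)).smul_const w).const_add x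
    have h6 : HasFDerivAt (fun ζ => g ζ (t i)) (innerSL ℝ (gz x (t i))) (x + (0 : ℝ) • w) := by
      rw [zero_smul, add_zero]; exact h.hasFDerivAt x (t i)
    have h7 := h6.comp_hasDerivAt (0 : ℝ) h5
    simpa using hloc.hasDerivAt_eq_zero h7

end IsQuasiPeriodic

/-! ### Functions on the torus along a linear flow, and the jets controlled by the C^r topology. -/

section Flow

variable (ν : V n) (Φ : V n × ℝ → ℝ)

/-- The function `Φ(ζ - τ ν, τ)`. -/
def qp (ζ : V n) (τ : ℝ) : ℝ := Φ (flowPt ν ζ τ)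

/-- Its first derivative in `τ`. -/
def qpTau (ζ : V n) (τ : ℝ) : ℝ := fderiv ℝ Φ (flowPt ν ζ τ) (-ν, 1)

/-- Its second derivative in `τ`. -/
def qpTauTau (ζ : V n) (τ : ℝ) : ℝ :=
  fderiv ℝ (fun x => fderiv ℝ Φ x (-ν, 1)) (flowPt ν ζ τ) (-ν, 1)

/-- Its gradient in `ζ`. -/
def qpZeta (ζ : V n) (τ : ℝ) : V n :=
  WithLp.toLp 2 fun i => fderiv ℝ Φ (flowPt ν ζ τ) (EuclideanSpace.single i 1, 0)

/-- The function has period one in all variables. -/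
def IsPeriodicLift : Prop :=
  ∀ (ξ : V n) (τ : ℝ) (m : Fin n → ℤ) (j : ℤ), Φ (ξ + intVec m, τ + (j : ℝ)) = Φ (ξ, τ)

variable {ν Φ}

lemma hasDerivAt_flowPt (ζ : V n) (τ : ℝ) : HasDerivAt (flowPt ν ζ) (-ν, 1) τ := by
  refine HasDerivAt.prodMk ?_ (hasDerivAt_id τ)
  simpa using ((hasDerivAt_id τ).smul_const ν).const_sub ζ

lemma continuous_flowPt : Continuous fun z : V n × ℝ => flowPt ν z.1 z.2 := by
  unfold flowPt; fun_prop

lemma inner_qpZeta (ζ : V n) (τ : ℝ) (v : V n) :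
    inner ℝ (qpZeta ν Φ ζ τ) v = fderiv ℝ Φ (flowPt ν ζ τ) (v, 0) := by
  have e : ((v, 0) : V n × ℝ) = ∑ i, v i • ((EuclideanSpace.single i 1, 0) : V n × ℝ) := by
    refine Prod.ext ?_ (by simp [Prod.snd_sum])
    rw [Prod.fst_sum]
    ext j
    simp [EuclideanSpace.single, Pi.single_apply]
  rw [e, map_sum, PiLp.inner_apply]
  refine Finset.sum_congr rfl fun i _ => ?_
  rw [map_smul]
  simp [qpZeta]

lemma isQuasiPeriodic_qp (hΦ : ContDiff ℝ 2 Φ) (hper : IsPeriodicLift Φ) :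
    IsQuasiPeriodic ν (qp ν Φ) (qpTau ν Φ) (qpTauTau ν Φ) (qpZeta ν Φ) where
  periodic ζ m := by
    funext τ
    have := hper (ζ - τ • ν) τ m 0
    simp only [Int.cast_zero, add_zero] at this
    rw [qp, qp, flowPt, flowPt, ← this, sub_add_eq_add_sub]
  shift ζ τ j := by
    have := hper (ζ - τ • ν) τ 0 j
    rw [intVec_zero, add_zero] at this
    rw [qp, qp, flowPt, flowPt, ← this]
    congr 2
    module
  hasDerivAt ζ τ :=
    ((hΦ.differentiable (by norm_num)).differentiableAt.hasFDerivAt).comp_hasDerivAt τ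
      (hasDerivAt_flowPt ζ τ)
  hasDerivAt' ζ τ := by
    have h : ContDiff ℝ 1 fun x => fderiv ℝ Φ x (-ν, 1) :=
      (hΦ.fderiv_right (m := 1) (by norm_num)).clm_apply contDiff_const
    exact ((h.differentiable (by norm_num)).differentiableAt.hasFDerivAt).comp_hasDerivAt τ
      (hasDerivAt_flowPt ζ τ)
  hasFDerivAt ζ τ := by
    have h1 : HasFDerivAt (fun ζ : V n => flowPt ν ζ τ) (ContinuousLinearMap.inl ℝ (V n) ℝ) ζ :=
      ((hasFDerivAt_id ζ).sub_const _).prodMk (hasFDerivAt_const τ ζ)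
    have h2 := ((hΦ.differentiable (by norm_num)).differentiableAt (x := flowPt ν ζ τ)).hasFDerivAt.comp ζ h1
    have h3 : innerSL ℝ (qpZeta ν Φ ζ τ) =
        (fderiv ℝ Φ (flowPt ν ζ τ)).comp (ContinuousLinearMap.inl ℝ (V n) ℝ) := by
      ext1 v
      simp [inner_qpZeta]
    rw [h3]
    exact h2
  cont := hΦ.continuous.comp continuous_flowPt
  cont₁ := ((hΦ.continuous_fderiv (by norm_num)).comp continuous_flowPt).clm_apply continuous_const
  cont₂ := by
    have h : ContDiff ℝ 1 fun x => fderiv ℝ Φ x (-ν, 1) :=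
      (hΦ.fderiv_right (m := 1) (by norm_num)).clm_apply contDiff_const
    exact ((h.continuous_fderiv (by norm_num)).comp continuous_flowPt).clm_apply continuous_const
  contz := by
    refine (PiLp.continuous_toLp 2 _).comp (continuous_pi fun i => ?_)
    exact ((hΦ.continuous_fderiv (by norm_num)).comp continuous_flowPt).clm_apply continuous_const

end Flow

/-- A family of functions whose first and second derivatives depend continuously on the
parameter. -/
structure ContinuousJet {T : Type*} [TopologicalSpace T] (Φ : T → V n × ℝ → ℝ) : Prop where
  first : Continuous fun z : T × (V n × ℝ) × (V n × ℝ) => fderiv ℝ (Φ z.1) z.2.1 z.2.2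
  second : Continuous fun z : T × (V n × ℝ) × (V n × ℝ) × (V n × ℝ) =>
    fderiv ℝ (fun x => fderiv ℝ (Φ z.1) x z.2.2.1) z.2.1 z.2.2.2

namespace ContinuousJet

variable {T : Type*} [TopologicalSpace T] {Φ : T → V n × ℝ → ℝ} {ν : T → V n}

lemma qpTau (h : ContinuousJet Φ) (hν : Continuous ν) :
    Continuous fun z : T × V n × ℝ => qpTau (ν z.1) (Φ z.1) z.2.1 z.2.2 := by
  refine h.first.comp (?_ : Continuous fun z : T × V n × ℝ =>
    (z.1, flowPt (ν z.1) z.2.1 z.2.2, ((-ν z.1, 1) : V n × ℝ)))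
  unfold flowPt; fun_prop

lemma qpTauTau (h : ContinuousJet Φ) (hν : Continuous ν) :
    Continuous fun z : T × V n × ℝ => qpTauTau (ν z.1) (Φ z.1) z.2.1 z.2.2 := by
  refine h.second.comp (?_ : Continuous fun z : T × V n × ℝ =>
    (z.1, flowPt (ν z.1) z.2.1 z.2.2, ((-ν z.1, 1) : V n × ℝ), ((-ν z.1, 1) : V n × ℝ)))
  unfold flowPt; fun_prop

lemma qpZeta (h : ContinuousJet Φ) (hν : Continuous ν) :
    Continuous fun z : T × V n × ℝ => qpZeta (ν z.1) (Φ z.1) z.2.1 z.2.2 := by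
  refine (PiLp.continuous_toLp 2 _).comp (continuous_pi fun i => ?_)
  refine h.first.comp (?_ : Continuous fun z : T × V n × ℝ =>
    (z.1, flowPt (ν z.1) z.2.1 z.2.2, ((EuclideanSpace.single i 1, 0) : V n × ℝ)))
  unfold flowPt; fun_prop

end ContinuousJet

section Jet

variable {P : Type} [NormedAddCommGroup P] [NormedSpace ℝ P] {r : ℕ∞} {K U : Set P}

lemma CrSpace.contDiff_slice (Θ : CrSpace n r K) {κ : P} (hκ : κ ∈ K) :
    ContDiff ℝ r fun x => Θ.1 (κ, x) := by
  rw [← contDiffOn_univ]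
  exact Θ.2.1.comp (t := K ×ˢ univ) (f := fun x : V n × ℝ => (κ, x))
    (ContDiff.contDiffOn (by fun_prop)) fun x _ => ⟨hκ, mem_univ _⟩

lemma CrSpace.isPeriodicLift (Θ : CrSpace n r K) {κ : P} (hκ : κ ∈ K) :
    IsPeriodicLift fun x => Θ.1 (κ, x) := fun ξ τ m j => Θ.2.2 κ hκ ξ τ m j

lemma CrSpace.tendsto_iff {ι : Type*} {l : Filter ι} {f : ι → CrSpace n r K} {Θ : CrSpace n r K} :
    Filter.Tendsto f l (𝓝 Θ) ↔ ∀ j : ℕ, (j : ℕ∞) ≤ r → TendstoUniformly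
      (fun (i : ι) (x : {x : P × V n × ℝ // x.1 ∈ interior K}) => iteratedFDeriv ℝ j (f i).1 x.1)
      (fun x => iteratedFDeriv ℝ j Θ.1 x.1) l := by
  simp only [nhds_iInf, Filter.tendsto_iInf, nhds_induced, Filter.tendsto_comap_iff]
  refine forall_congr' fun j => forall_congr' fun _ => ?_
  exact UniformFun.tendsto_iff_tendstoUniformly

/-- The topology compares derivatives over the interior only; continuity of the derivatives within
`U` and density of its interior extend the uniform estimate to `U`. Unique differentiability is
asked of `U` and not of `K`, because the closure of an open set may lack it. -/
lemma CrSpace.continuous_iteratedFDerivWithin (hUK : U ⊆ K) (hU : UniqueDiffOn ℝ U)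
    (hcl : U ⊆ closure (interior U)) {j : ℕ} (hj : (j : ℕ∞) ≤ r) :
    Continuous fun z : CrSpace n r K × (U ×ˢ (univ : Set (V n × ℝ)) : Set _) =>
      iteratedFDerivWithin ℝ j z.1.1 (U ×ˢ univ) z.2.1 := by
  have hj' : (j : WithTop ℕ∞) ≤ r := by exact_mod_cast hj
  have hUD : UniqueDiffOn ℝ (U ×ˢ (univ : Set (V n × ℝ))) := hU.prod uniqueDiffOn_univ
  have hΘ : ∀ Θ : CrSpace n r K, ContinuousOn (iteratedFDerivWithin ℝ j Θ.1 (U ×ˢ univ))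
      (U ×ˢ (univ : Set (V n × ℝ))) := fun Θ =>
    ((Θ.2.1.mono (prod_mono_left hUK)).of_le hj').continuousOn_iteratedFDerivWithin le_rfl hUD
  rw [continuous_iff_continuousAt]
  rintro ⟨Θ, q⟩
  rw [ContinuousAt, Metric.tendsto_nhds]
  intro ε hε
  have h1 := (CrSpace.tendsto_iff (f := id) (l := 𝓝 Θ)).1 Filter.tendsto_id j hj
  rw [Metric.tendstoUniformly_iff] at h1
  have h2 : ∀ᶠ Θ' in 𝓝 Θ, ∀ q ∈ U ×ˢ (univ : Set (V n × ℝ)),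
      dist (iteratedFDerivWithin ℝ j Θ.1 (U ×ˢ univ) q)
        (iteratedFDerivWithin ℝ j Θ'.1 (U ×ˢ univ) q) ≤ ε / 2 := by
    filter_upwards [h1 (ε / 2) (half_pos hε)] with Θ' h' q hq
    have hmem : q ∈ closure (interior U ×ˢ (univ : Set (V n × ℝ))) := by
      rw [closure_prod_eq, closure_univ]; exact ⟨hcl hq.1, mem_univ _⟩
    have hsub : interior U ×ˢ (univ : Set (V n × ℝ)) ⊆ U ×ˢ univ := prod_mono_left interior_subset
    have hne := mem_closure_iff_nhdsWithin_neBot.1 hmem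
    refine le_of_tendsto (Filter.Tendsto.dist ((hΘ Θ q hq).mono hsub) ((hΘ Θ' q hq).mono hsub)) ?_
    filter_upwards [self_mem_nhdsWithin] with x hx
    have hxn : U ×ˢ (univ : Set (V n × ℝ)) ∈ 𝓝 x := by
      rw [← Prod.mk.eta (p := x)]
      exact prod_mem_nhds (mem_interior_iff_mem_nhds.1 hx.1) Filter.univ_mem
    have e : ∀ Θ : CrSpace n r K, iteratedFDerivWithin ℝ j Θ.1 (U ×ˢ univ) x =
        iteratedFDeriv ℝ j Θ.1 x := fun Θ => by
      refine iteratedFDerivWithin_eq_iteratedFDeriv hUD ?_ (hsub hx)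
      exact ((Θ.2.1.mono (prod_mono_left hUK)).contDiffAt hxn).of_le hj'
    rw [e, e]
    exact (h' ⟨x, interior_mono hUK hx.1⟩).le
  have h3 : ∀ᶠ q' : (U ×ˢ (univ : Set (V n × ℝ)) : Set _) in 𝓝 q,
      dist (iteratedFDerivWithin ℝ j Θ.1 (U ×ˢ univ) q'.1)
        (iteratedFDerivWithin ℝ j Θ.1 (U ×ˢ univ) q.1) < ε / 2 :=
    Metric.tendsto_nhds.1 ((continuousOn_iff_continuous_domRestrict.1 (hΘ Θ)).tendsto q) _ (half_pos hε)
  rw [nhds_prod_eq]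
  filter_upwards [h2.prod_mk h3] with z hz
  have h4 := hz.1 z.2.1 z.2.2
  rw [dist_comm] at h4
  linarith [dist_triangle (iteratedFDerivWithin ℝ j z.1.1 (U ×ˢ univ) z.2.1)
    (iteratedFDerivWithin ℝ j Θ.1 (U ×ˢ univ) z.2.1) (iteratedFDerivWithin ℝ j Θ.1 (U ×ˢ univ) q.1),
    hz.2]

lemma CrSpace.fderiv_slice (hUK : U ⊆ K) (hU : UniqueDiffOn ℝ U) (hr : 2 ≤ r) (Θ : CrSpace n r K) {κ : P} (hκ : κ ∈ U) (x v : V n × ℝ) :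
    fderiv ℝ (fun x => Θ.1 (κ, x)) x v =
      iteratedFDerivWithin ℝ 1 Θ.1 (U ×ˢ univ) (κ, x) (fun _ => (0, v)) := by
  have hq : (κ, x) ∈ U ×ˢ (univ : Set (V n × ℝ)) := ⟨hκ, mem_univ _⟩
  have hUD : UniqueDiffOn ℝ (U ×ˢ (univ : Set (V n × ℝ))) := hU.prod uniqueDiffOn_univ
  rw [iteratedFDerivWithin_one_apply (hUD _ hq)]
  have h1 : HasFDerivWithinAt Θ.1 (fderivWithin ℝ Θ.1 (U ×ˢ univ) (κ, x)) (U ×ˢ univ) (κ, x) :=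
    (((Θ.2.1.mono (prod_mono_left hUK)).differentiableOn (by
      have : (r : WithTop ℕ∞) ≠ 0 := by
        have : r ≠ 0 := by rintro rfl; simp at hr
        exact_mod_cast this
      exact this)) _ hq).hasFDerivWithinAt
  have h2 : HasFDerivWithinAt (fun x : V n × ℝ => (κ, x)) (ContinuousLinearMap.inr ℝ P (V n × ℝ))
      univ x := ((hasFDerivAt_const κ x).prodMk (hasFDerivAt_id x)).hasFDerivWithinAt
  have h3 := h1.comp (t := U ×ˢ univ) x h2 fun x _ => ⟨hκ, mem_univ _⟩
  rw [hasFDerivWithinAt_univ] at h3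
  rw [show (fun x => Θ.1 (κ, x)) = Θ.1 ∘ fun x => (κ, x) from rfl, h3.fderiv]
  rfl

lemma CrSpace.fderiv_fderiv_slice (hUK : U ⊆ K) (hU : UniqueDiffOn ℝ U) (hr : 2 ≤ r) (Θ : CrSpace n r K) {κ : P} (hκ : κ ∈ U)
    (x u v : V n × ℝ) :
    fderiv ℝ (fun x => fderiv ℝ (fun x => Θ.1 (κ, x)) x u) x v =
      iteratedFDerivWithin ℝ 2 Θ.1 (U ×ˢ univ) (κ, x) ![(0, v), (0, u)] := by
  have hq : ∀ x, (κ, x) ∈ U ×ˢ (univ : Set (V n × ℝ)) := fun x => ⟨hκ, mem_univ _⟩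
  have hUD : UniqueDiffOn ℝ (U ×ˢ (univ : Set (V n × ℝ))) := hU.prod uniqueDiffOn_univ
  rw [iteratedFDerivWithin_two_apply _ hUD (hq x)]
  have e : (fun x => fderiv ℝ (fun x => Θ.1 (κ, x)) x u) =
      fun x => fderivWithin ℝ Θ.1 (U ×ˢ univ) (κ, x) (0, u) := by
    funext x
    rw [CrSpace.fderiv_slice hUK hU hr Θ hκ, iteratedFDerivWithin_one_apply (hUD _ (hq x))]
  have hr' : (1 : WithTop ℕ∞) + 1 ≤ r := by
    rw [one_add_one_eq_two]; exact WithTop.coe_le_coe.2 hr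
  have h0 : DifferentiableOn ℝ (fderivWithin ℝ Θ.1 (U ×ˢ univ)) (U ×ˢ univ) :=
    ((Θ.2.1.mono (prod_mono_left hUK)).fderivWithin hUD hr').differentiableOn one_ne_zero
  have h1 := (h0 _ (hq x)).hasFDerivWithinAt
  have h2 : HasFDerivWithinAt (fun x : V n × ℝ => (κ, x)) (ContinuousLinearMap.inr ℝ P (V n × ℝ))
      univ x := ((hasFDerivAt_const κ x).prodMk (hasFDerivAt_id x)).hasFDerivWithinAt
  have h3 := h1.comp (t := U ×ˢ univ) x h2 fun x _ => hq x
  rw [hasFDerivWithinAt_univ] at h3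
  have h4 := h3.clm_apply (hasFDerivAt_const (((0 : P), u)) x)
  rw [e]
  erw [h4.fderiv]
  simp

lemma CrSpace.continuousJet (hUK : U ⊆ K) (hU : UniqueDiffOn ℝ U) (hcl : U ⊆ closure (interior U)) (hr : 2 ≤ r) :
    ContinuousJet fun (t : CrSpace n r K × U) (x : V n × ℝ) => t.1.1 (t.2.1, x) where
  first := by
    have h1 := CrSpace.continuous_iteratedFDerivWithin (n := n) (r := r) hUK hU hcl (j := 1)
      ((by norm_num : ((1 : ℕ) : ℕ∞) ≤ 2).trans hr)
    have h2 : Continuous fun z : (CrSpace n r K × U) × (V n × ℝ) × (V n × ℝ) =>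
      (z.1.1, (⟨(z.1.2.1, z.2.1), z.1.2.2, mem_univ _⟩ :
        (U ×ˢ (univ : Set (V n × ℝ)) : Set _))) := by fun_prop
    have h3 : Continuous fun z : (CrSpace n r K × U) × (V n × ℝ) × (V n × ℝ) =>
      (fun _ : Fin 1 => ((0 : P), z.2.2)) := by fun_prop
    have h4 := (h1.comp h2).eval h3
    refine h4.congr fun z => ?_
    exact (CrSpace.fderiv_slice hUK hU hr z.1.1 z.1.2.2 z.2.1 z.2.2).symm
  second := by
    have h1 := CrSpace.continuous_iteratedFDerivWithin (n := n) (r := r) hUK hU hcl (j := 2) hr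
    have h2 : Continuous fun z : (CrSpace n r K × U) × (V n × ℝ) × (V n × ℝ) × (V n × ℝ) =>
      (z.1.1, (⟨(z.1.2.1, z.2.1), z.1.2.2, mem_univ _⟩ :
        (U ×ˢ (univ : Set (V n × ℝ)) : Set _))) := by fun_prop
    have h3 : Continuous fun z : (CrSpace n r K × U) × (V n × ℝ) × (V n × ℝ) × (V n × ℝ) =>
      ![((0 : P), z.2.2.2), ((0 : P), z.2.2.1)] := by
      refine continuous_pi fun i => ?_
      fin_cases i <;> simp only [Fin.zero_eta, Fin.mk_one, Matrix.cons_val_zero, Matrix.cons_val_one] <;> fun_prop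
    have h4 := (h1.comp h2).eval h3
    refine h4.congr fun z => ?_
    exact (CrSpace.fderiv_fderiv_slice hUK hU hr z.1.1 z.1.2.2 z.2.1 z.2.2.1 z.2.2.2).symm

end Jet

/-! ### General position: overdetermined systems have no solution for almost every perturbation. -/

section GeneralPosition

variable {Y Z E F : Type*} [NormedAddCommGroup Y] [NormedSpace ℝ Y] [FiniteDimensional ℝ Y]
  [NormedAddCommGroup Z] [NormedSpace ℝ Z] [FiniteDimensional ℝ Z]
  [NormedAddCommGroup E] [NormedSpace ℝ E] [FiniteDimensional ℝ E]
  [NormedAddCommGroup F] [NormedSpace ℝ F] [FiniteDimensional ℝ F]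

open Module in
/-- If the number of linear equations on `a` exceeds the dimension of the parameter `y`, then for
almost every `a` no value of the parameter makes it a solution of a nondegenerate system. -/
theorem ae_forall_ne_of_finrank_lt [MeasurableSpace (E × Z)] [BorelSpace (E × Z)]
    (μ : Measure (E × Z)) [μ.IsAddHaarMeasure] {K : Set Y} (hK : Convex ℝ K)
    {L : Y × Z → E →L[ℝ] F} {G : Y × Z → F} (hL : ContDiffOn ℝ 1 L (K ×ˢ univ))
    (hG : ContDiffOn ℝ 1 G (K ×ˢ univ)) (hdim : finrank ℝ Y < finrank ℝ F) :
    ∀ᵐ p ∂μ, ∀ y ∈ K, Function.Surjective (L (y, p.2)) → L (y, p.2) p.1 ≠ G (y, p.2) := by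
  have : CompleteSpace F := FiniteDimensional.complete ℝ F
  set I : Set ((Y × Z) × E) := {x | x.1.1 ∈ K ∧ Function.Surjective (L x.1) ∧ L x.1 x.2 = G x.1}
    with hI
  have hloc : ∀ x ∈ I, ∃ N ∈ 𝓝[I] x, μ ((fun x : (Y × Z) × E => (x.2, x.1.2)) '' (N ∩ I)) = 0 := by
    rintro ⟨q₀, a₀⟩ ⟨hy₀, hsurj, -⟩
    simp only at hy₀ hsurj
    -- A right inverse of `L q₀` fixes a complement of its kernel. On this complement `L q` stays
    -- invertible for q near `q₀`, so the solutions of L(q)a = G(q) form a graph over the kernel,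
    -- parametrised by `h` below.
    obtain ⟨R, hR⟩ := LinearMap.exists_rightInverse_of_surjective (L q₀ : E →ₗ[ℝ] F)
      (LinearMap.range_eq_top.2 hsurj)
    set R' : F →L[ℝ] E := LinearMap.toContinuousLinearMap R with hR'
    have hRR : (L q₀).comp R' = ContinuousLinearMap.id ℝ F := by
      ext v
      exact LinearMap.congr_fun hR v
    set T : Y × Z → F →L[ℝ] F := fun q => (L q).comp R' with hT
    have hTc : ContDiffOn ℝ 1 T (K ×ˢ univ) := hL.clm_comp contDiffOn_const
    have hq₀ : q₀ ∈ K ×ˢ (univ : Set Z) := ⟨hy₀, mem_univ _⟩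
    have hunit : ∀ᶠ q in 𝓝[K ×ˢ univ] q₀, IsUnit (T q) := by
      have h1 : IsUnit (T q₀) := by
        rw [hT]; simp only; rw [hRR]; exact isUnit_one
      exact (hTc.continuousOn q₀ hq₀).eventually (Units.isOpen.mem_nhds h1)
    obtain ⟨ε, hε, hball⟩ := Metric.mem_nhdsWithin_iff.1 hunit
    set s : Set ((Y × Z) × LinearMap.ker (L q₀ : E →ₗ[ℝ] F)) :=
      (Metric.ball q₀ ε ∩ K ×ˢ univ) ×ˢ univ with hs
    have hconv : Convex ℝ s :=
      ((convex_ball _ _).inter (hK.prod convex_univ)).prod convex_univ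
    set h : (Y × Z) × LinearMap.ker (L q₀ : E →ₗ[ℝ] F) → E × Z := fun x =>
      ((x.2 : E) + R' (Ring.inverse (T x.1) (G x.1 - L x.1 x.2)), x.1.2) with hh
    have hfst : ContDiffOn ℝ 1 (Prod.fst : (Y × Z) × LinearMap.ker (L q₀ : E →ₗ[ℝ] F) → Y × Z) s :=
      contDiff_fst.contDiffOn
    have hmaps : MapsTo (Prod.fst : (Y × Z) × LinearMap.ker (L q₀ : E →ₗ[ℝ] F) → Y × Z) s
      (K ×ˢ univ) := fun x hx => hx.1.2
    have hval : ContDiff ℝ 1 fun x : (Y × Z) × LinearMap.ker (L q₀ : E →ₗ[ℝ] F) => (x.2 : E) :=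
      (LinearMap.ker (L q₀ : E →ₗ[ℝ] F)).subtypeL.contDiff.comp contDiff_snd
    have hhc : ContDiffOn ℝ 1 h s := by
      refine ContDiffOn.prodMk ?_ (contDiff_snd.comp contDiff_fst).contDiffOn
      refine hval.contDiffOn.add (R'.contDiff.comp_contDiffOn (ContDiffOn.clm_apply ?_ ?_))
      · intro x hx
        obtain ⟨u, hu⟩ := hball hx.1
        have h1 : ContDiffAt ℝ 1 Ring.inverse (T x.1) := by
          rw [← hu]; exact contDiffAt_ringInverse ℝ u
        exact h1.comp_contDiffWithinAt x ((hTc.comp hfst hmaps) x hx)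
      · exact (hG.comp hfst hmaps).sub ((hL.comp hfst hmaps).clm_apply hval.contDiffOn)
    -- The source of `h` has dimension dim Y + dim Z + dim E - dim F, less than dim(E × Z), so the
    -- Hausdorff dimension of the image is too small for positive measure. Convexity of `s` allows
    -- the dimension bound on a set that need not be open.
    have hnull : μ (h '' s) = 0 := by
      have hd := hhc.dimH_image_le hconv Subset.rfl
      have hlt : dimH (h '' s) < (finrank ℝ (E × Z) : NNReal) := by
        refine (hd.trans (dimH_mono (subset_univ _))).trans_lt ?_
        rw [Real.dimH_univ_eq_finrank]
        have h1 := LinearMap.finrank_range_add_finrank_ker (L q₀ : E →ₗ[ℝ] F)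
        rw [LinearMap.range_eq_top.2 hsurj, finrank_top] at h1
        rw [finrank_prod, finrank_prod, finrank_prod]
        have : finrank ℝ Y + finrank ℝ Z + finrank ℝ (LinearMap.ker (L q₀ : E →ₗ[ℝ] F)) <
          finrank ℝ E + finrank ℝ Z := by omega
        exact_mod_cast this
      have : (μH[(finrank ℝ (E × Z) : NNReal)] : Measure (E × Z)).IsAddHaarMeasure := by
        simpa using isAddHaarMeasure_hausdorffMeasure (E := E × Z)
      exact measure_zero_of_dimH_lt (Measure.absolutelyContinuous_isAddHaarMeasure μ _) hlt
    refine ⟨{x | x.1 ∈ Metric.ball q₀ ε}, mem_nhdsWithin_of_mem_nhds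
      (continuous_fst.continuousAt.preimage_mem_nhds (Metric.ball_mem_nhds q₀ hε)),
      measure_mono_null ?_ hnull⟩
    rintro _ ⟨⟨q, a⟩, ⟨hqb, hqK, -, heq⟩, rfl⟩
    simp only at hqK heq ⊢
    have hu : IsUnit (T q) := hball ⟨hqb, hqK, mem_univ _⟩
    have hker : a - R' (L q₀ a) ∈ LinearMap.ker (L q₀ : E →ₗ[ℝ] F) := by
      rw [LinearMap.mem_ker]
      have := congrArg (fun f : F →L[ℝ] F => f (L q₀ a)) hRR
      simp only [ContinuousLinearMap.comp_apply, ContinuousLinearMap.id_apply] at this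
      simp [this]
    refine ⟨(q, ⟨a - R' (L q₀ a), hker⟩), ⟨⟨hqb, hqK, mem_univ _⟩, mem_univ _⟩, ?_⟩
    simp only [hh, Prod.mk.injEq, and_true]
    have e : G q - L q (a - R' (L q₀ a)) = T q (L q₀ a) := by
      rw [map_sub, heq, sub_sub_cancel]; rfl
    have e2 : Ring.inverse (T q) (T q (L q₀ a)) = L q₀ a := by
      rw [← mul_apply_eq_comp, Ring.inverse_mul_cancel _ hu]; rfl
    rw [e, e2, sub_add_cancel]
  choose! N hN hN0 using hloc
  obtain ⟨t, htI, htc, hcov⟩ := TopologicalSpace.countable_cover_nhdsWithin hN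
  have h0 : μ (⋃ x ∈ t, (fun x : (Y × Z) × E => (x.2, x.1.2)) '' (N x ∩ I)) = 0 :=
    (measure_biUnion_null_iff htc).2 fun x hx => hN0 x (htI hx)
  refine measure_mono_null ?_ h0
  rintro ⟨a, z⟩ hbad
  simp only [mem_compl_iff, mem_ofPred_eq, not_forall, not_not] at hbad
  obtain ⟨y, hy, hs, he⟩ := hbad
  have hx : ((y, z), a) ∈ I := ⟨hy, hs, he⟩
  obtain ⟨x, hx1, hx2⟩ := mem_iUnion₂.1 (hcov hx)
  exact mem_iUnion₂.2 ⟨x, hx1, ((y, z), a), ⟨hx2, hx⟩, rfl⟩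

end GeneralPosition

/-! ### Interpolation of derivatives by trigonometric polynomials. -/

section DirDeriv

variable {X : Type*} [NormedAddCommGroup X] [NormedSpace ℝ X]

/-- The derivative in a constant direction. -/
def dirDeriv (v : X) (f : X → ℝ) : X → ℝ := fun x => fderiv ℝ f x v

lemma contDiff_dirDeriv (v : X) {f : X → ℝ} (hf : ContDiff ℝ ∞ f) : ContDiff ℝ ∞ (dirDeriv v f) :=
  (hf.fderiv_right (m := ∞) (by norm_num)).clm_apply contDiff_const

lemma dirDeriv_mul (v : X) {f g : X → ℝ} (hf : ContDiff ℝ ∞ f) (hg : ContDiff ℝ ∞ g) :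
    dirDeriv v (f * g) = dirDeriv v f * g + f * dirDeriv v g := by
  funext x
  have h1 := (hf.differentiable (by norm_num)).differentiableAt (x := x)
  have h2 := (hg.differentiable (by norm_num)).differentiableAt (x := x)
  simp only [dirDeriv, Pi.add_apply, Pi.mul_apply]
  rw [(h1.hasFDerivAt.mul h2.hasFDerivAt).fderiv]
  simp
  ring

lemma dirDeriv_add (v : X) {f g : X → ℝ} (hf : ContDiff ℝ ∞ f) (hg : ContDiff ℝ ∞ g) :
    dirDeriv v (f + g) = dirDeriv v f + dirDeriv v g := by
  funext x
  have h1 := (hf.differentiable (by norm_num)).differentiableAt (x := x)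
  have h2 := (hg.differentiable (by norm_num)).differentiableAt (x := x)
  simp only [dirDeriv, Pi.add_apply]
  rw [(h1.hasFDerivAt.add h2.hasFDerivAt).fderiv]
  simp

lemma dirDeriv_sum (v : X) {ι : Type*} (s : Finset ι) (a : ι → ℝ) {q : ι → X → ℝ}
    (hq : ∀ i, ContDiff ℝ ∞ (q i)) :
    dirDeriv v (fun x => ∑ i ∈ s, a i * q i x) = fun x => ∑ i ∈ s, a i * dirDeriv v (q i) x := by
  funext x
  have h1 : ∀ i ∈ s, HasFDerivAt (fun x => a i * q i x) (a i • fderiv ℝ (q i) x) x := fun i _ =>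
    (((hq i).differentiable (by norm_num)).differentiableAt (x := x)).hasFDerivAt.const_mul _
  simp only [dirDeriv]
  rw [(HasFDerivAt.fun_sum h1).fderiv]
  simp

lemma dirDeriv_dirDeriv_mul (v : X) {f g : X → ℝ} (hf : ContDiff ℝ ∞ f) (hg : ContDiff ℝ ∞ g) :
    dirDeriv v (dirDeriv v (f * g)) =
      dirDeriv v (dirDeriv v f) * g + 2 * dirDeriv v f * dirDeriv v g +
        f * dirDeriv v (dirDeriv v g) := by
  have hf' := contDiff_dirDeriv v hf
  have hg' := contDiff_dirDeriv v hg
  have h1 : dirDeriv v (dirDeriv v f * g + f * dirDeriv v g) =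
      dirDeriv v (dirDeriv v f * g) + dirDeriv v (f * dirDeriv v g) :=
    dirDeriv_add v (hf'.mul hg) (hf.mul hg')
  rw [dirDeriv_mul v hf hg, h1, dirDeriv_mul v hf' hg, dirDeriv_mul v hf hg']
  ring

/-- The function `P³ u` and its derivatives vanish where `P` does. -/
lemma cube_mul_vanish (v : X) {P u : X → ℝ} (hP : ContDiff ℝ ∞ P) (hu : ContDiff ℝ ∞ u) {x : X}
    (h0 : P x = 0) : dirDeriv v (P * (P * (P * u))) x = 0 ∧
      dirDeriv v (dirDeriv v (P * (P * (P * u)))) x = 0 := by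
  have h1 : ContDiff ℝ ∞ (P * u) := hP.mul hu
  have h2 : ContDiff ℝ ∞ (P * (P * u)) := hP.mul h1
  -- Three factors P are needed: with two, the second derivative would keep the term 2(∂P)²u where P
  -- vanishes.
  rw [dirDeriv_dirDeriv_mul v hP h2, dirDeriv_mul v hP h2, dirDeriv_mul v hP h1]
  simp [h0]

/-- Where `u` vanishes, the derivatives of `P³ u` depend on few derivatives of `u`. -/
lemma cube_mul_at_zero (v : X) {P u : X → ℝ} (hP : ContDiff ℝ ∞ P) (hu : ContDiff ℝ ∞ u) {x : X}
    (h0 : u x = 0) : dirDeriv v (P * (P * (P * u))) x = P x ^ 3 * dirDeriv v u x ∧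
      dirDeriv v (dirDeriv v (P * (P * (P * u)))) x =
        P x ^ 3 * dirDeriv v (dirDeriv v u) x + 6 * P x ^ 2 * dirDeriv v P x * dirDeriv v u x := by
  have h1 : ContDiff ℝ ∞ (P * u) := hP.mul hu
  have h2 : ContDiff ℝ ∞ (P * (P * u)) := hP.mul h1
  rw [dirDeriv_dirDeriv_mul v hP h2, dirDeriv_dirDeriv_mul v hP h1, dirDeriv_dirDeriv_mul v hP hu,
    dirDeriv_mul v hP h2, dirDeriv_mul v hP h1, dirDeriv_mul v hP hu]
  simp only [Pi.add_apply, Pi.mul_apply, h0]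
  simp
  constructor <;> ring

end DirDeriv

section Trig

/-- The coordinates of `ℝⁿ × ℝ`. -/
def crd : Option (Fin n) → V n × ℝ →L[ℝ] ℝ
  | none => ContinuousLinearMap.snd ℝ (V n) ℝ
  | some i => (EuclideanSpace.proj i).comp (ContinuousLinearMap.fst ℝ (V n) ℝ)

lemma contDiff_crd (k : Option (Fin n)) : ContDiff ℝ ∞ (crd k) := (crd k).contDiff

/-- `sin 2π(xₖ - c)`. -/
def sinWave (k : Option (Fin n)) (c : ℝ) : V n × ℝ → ℝ := fun x => Real.sin (2 * Real.pi * (crd k x - c))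

/-- `cos 2π(xₖ - c)`. -/
def cosWave (k : Option (Fin n)) (c : ℝ) : V n × ℝ → ℝ := fun x => Real.cos (2 * Real.pi * (crd k x - c))

lemma contDiff_sinWave (k : Option (Fin n)) (c : ℝ) : ContDiff ℝ ∞ (sinWave k c) :=
  Real.contDiff_sin.comp (contDiff_const.mul ((contDiff_crd k).sub contDiff_const))

lemma contDiff_cosWave (k : Option (Fin n)) (c : ℝ) : ContDiff ℝ ∞ (cosWave k c) :=
  Real.contDiff_cos.comp (contDiff_const.mul ((contDiff_crd k).sub contDiff_const))

lemma contDiff_one_sub_cosWave (k : Option (Fin n)) (c : ℝ) : ContDiff ℝ ∞ (1 - cosWave k c) :=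
  ContDiff.sub (f := fun _ => (1 : ℝ)) contDiff_const (contDiff_cosWave k c)

lemma hasFDerivAt_phase (k : Option (Fin n)) (c : ℝ) (x : V n × ℝ) :
    HasFDerivAt (fun x => 2 * Real.pi * (crd k x - c)) ((2 * Real.pi) • crd k) x :=
  ((crd k).hasFDerivAt.sub_const c).const_mul _

lemma dirDeriv_sinWave (v : V n × ℝ) (k : Option (Fin n)) (c : ℝ) :
    dirDeriv v (sinWave k c) = fun x => 2 * Real.pi * crd k v * cosWave k c x := by
  funext x
  have : fderiv ℝ (sinWave k c) x = _ := ((hasFDerivAt_phase k c x).sin).fderiv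
  simp only [dirDeriv, this, cosWave]
  simp
  ring

lemma dirDeriv_one_sub_cosWave (v : V n × ℝ) (k : Option (Fin n)) (c : ℝ) :
    dirDeriv v (1 - cosWave k c) = fun x => 2 * Real.pi * crd k v * sinWave k c x := by
  funext x
  have : fderiv ℝ (1 - cosWave k c) x = _ := (((hasFDerivAt_phase k c x).cos).const_sub 1).fderiv
  simp only [dirDeriv, this, sinWave]
  simp
  ring

/-- Trigonometric polynomials of degree one in each variable separately. -/
def waves (n : ℕ) : Submodule ℝ (V n × ℝ → ℝ) :=
  Submodule.span ℝ (insert 1 (range (fun k : Option (Fin n) => sinWave k 0) ∪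
    range fun k : Option (Fin n) => cosWave k 0))

lemma one_mem_waves : (1 : V n × ℝ → ℝ) ∈ waves n := Submodule.subset_span (mem_insert _ _)

lemma sinWave_mem (k : Option (Fin n)) (c : ℝ) : sinWave k c ∈ waves n := by
  have e : sinWave k c = Real.cos (2 * Real.pi * c) • sinWave k 0 -
      Real.sin (2 * Real.pi * c) • cosWave k 0 := by
    funext x
    simp only [sinWave, cosWave, Pi.sub_apply, Pi.smul_apply, smul_eq_mul, mul_sub, Real.sin_sub,
      sub_zero]
    ring
  rw [e]
  exact sub_mem (Submodule.smul_mem _ _ (Submodule.subset_span (Or.inr (Or.inl ⟨k, rfl⟩))))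
    (Submodule.smul_mem _ _ (Submodule.subset_span (Or.inr (Or.inr ⟨k, rfl⟩))))

lemma cosWave_mem (k : Option (Fin n)) (c : ℝ) : cosWave k c ∈ waves n := by
  have e : cosWave k c = Real.cos (2 * Real.pi * c) • cosWave k 0 +
      Real.sin (2 * Real.pi * c) • sinWave k 0 := by
    funext x
    simp only [sinWave, cosWave, Pi.add_apply, Pi.smul_apply, smul_eq_mul, mul_sub, Real.cos_sub,
      sub_zero]
    ring
  rw [e]
  exact add_mem (Submodule.smul_mem _ _ (Submodule.subset_span (Or.inr (Or.inr ⟨k, rfl⟩))))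
    (Submodule.smul_mem _ _ (Submodule.subset_span (Or.inr (Or.inl ⟨k, rfl⟩))))

/-- The algebra of smooth functions on the torus. -/
def smoothPeriodic (n : ℕ) : Subalgebra ℝ (V n × ℝ → ℝ) where
  carrier := {f | ContDiff ℝ ∞ f ∧ IsPeriodicLift f}
  mul_mem' hf hg := ⟨hf.1.mul hg.1, fun ξ τ m j => by
    simp only [Pi.mul_apply, hf.2 ξ τ m j, hg.2 ξ τ m j]⟩
  add_mem' hf hg := ⟨hf.1.add hg.1, fun ξ τ m j => by
    simp only [Pi.add_apply, hf.2 ξ τ m j, hg.2 ξ τ m j]⟩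
  algebraMap_mem' c := ⟨contDiff_const, fun _ _ _ _ => rfl⟩

lemma crd_add_int (k : Option (Fin n)) (ξ : V n) (τ : ℝ) (m : Fin n → ℤ) (j : ℤ) :
    ∃ i : ℤ, crd k (ξ + intVec m, τ + (j : ℝ)) = crd k (ξ, τ) + i := by
  cases k with
  | none => exact ⟨j, rfl⟩
  | some k => exact ⟨m k, rfl⟩

lemma waves_le : waves n ≤ Subalgebra.toSubmodule (smoothPeriodic n) := by
  refine Submodule.span_le.2 ?_
  rintro f (rfl | ⟨k, rfl⟩ | ⟨k, rfl⟩)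
  · exact one_mem (smoothPeriodic n)
  · refine ⟨contDiff_sinWave k 0, fun ξ τ m j => ?_⟩
    obtain ⟨i, hi⟩ := crd_add_int k ξ τ m j
    simp only [sinWave, hi]
    rw [← Real.sin_add_int_mul_two_pi (2 * Real.pi * (crd k (ξ, τ) - 0)) i]
    congr 1; ring
  · refine ⟨contDiff_cosWave k 0, fun ξ τ m j => ?_⟩
    obtain ⟨i, hi⟩ := crd_add_int k ξ τ m j
    simp only [cosWave, hi]
    rw [← Real.cos_add_int_mul_two_pi (2 * Real.pi * (crd k (ξ, τ) - 0)) i]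
    congr 1; ring

lemma fg_waves : (waves n).FG :=
  Submodule.fg_span (((finite_range _).union (finite_range _)).insert _)

/-- Trigonometric polynomials, enough for interpolation at `m` points. -/
def trigPoly (n m : ℕ) : Submodule ℝ (V n × ℝ → ℝ) :=
  waves n ^ m * (waves n ^ m * (waves n ^ m * waves n))

lemma pow_waves_le (m : ℕ) : waves n ^ m ≤ Subalgebra.toSubmodule (smoothPeriodic n) := by
  induction m with
  | zero => rw [pow_zero, Submodule.one_le]; exact one_mem (smoothPeriodic n)
  | succ m ih =>
    rw [pow_succ, Submodule.mul_le]
    exact fun f hf g hg => mul_mem (S := Subalgebra ℝ (V n × ℝ → ℝ)) (ih hf) (waves_le hg)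

lemma trigPoly_le (m : ℕ) : trigPoly n m ≤ Subalgebra.toSubmodule (smoothPeriodic n) := by
  have key : ∀ M ≤ Subalgebra.toSubmodule (smoothPeriodic n),
      waves n ^ m * M ≤ Subalgebra.toSubmodule (smoothPeriodic n) := fun M hM => by
    rw [Submodule.mul_le]
    exact fun f hf g hg => mul_mem (S := Subalgebra ℝ (V n × ℝ → ℝ)) (pow_waves_le m hf) (hM hg)
  exact key _ (key _ (key _ waves_le))

lemma fg_trigPoly (m : ℕ) : (trigPoly n m).FG :=
  (fg_waves.pow m).mul ((fg_waves.pow m).mul ((fg_waves.pow m).mul fg_waves))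

/-- A nonnegative function which vanishes at `x₀` modulo the lattice only. -/
def wellAt (x₀ : V n × ℝ) : V n × ℝ → ℝ := ∑ k : Option (Fin n), (1 - cosWave k (crd k x₀))

lemma wellAt_mem (x₀ : V n × ℝ) : wellAt x₀ ∈ waves n :=
  sum_mem fun _ _ => sub_mem one_mem_waves (cosWave_mem _ _)

lemma wellAt_self (x₀ : V n × ℝ) : wellAt x₀ x₀ = 0 := by
  simp [wellAt, cosWave]

lemma exists_int_of_wellAt_eq_zero {x₀ x : V n × ℝ} (h : wellAt x₀ x = 0) :
    ∃ (m : Fin n → ℤ) (j : ℤ), x = x₀ + (intVec m, (j : ℝ)) := by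
  have h1 : ∀ k, ∃ i : ℤ, crd k x = crd k x₀ + i := by
    intro k
    simp only [wellAt, Finset.sum_apply, Pi.sub_apply, Pi.one_apply] at h
    rw [Finset.sum_eq_zero_iff_of_nonneg fun k _ =>
      sub_nonneg.2 (show cosWave k (crd k x₀) x ≤ 1 from Real.cos_le_one _)] at h
    have h2 : cosWave k (crd k x₀) x = 1 := by linarith [h k (Finset.mem_univ _)]
    obtain ⟨i, hi⟩ := (Real.cos_eq_one_iff _).1 h2
    refine ⟨i, ?_⟩
    have h3 : 2 * Real.pi * (i - (crd k x - crd k x₀)) = 0 := by linarith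
    rcases mul_eq_zero.1 h3 with h4 | h4
    · exact absurd h4 (by positivity)
    · linarith
  choose i hi using h1
  refine ⟨fun k => i (some k), i none, Prod.ext ?_ (hi none)⟩
  ext k
  exact hi (some k)

lemma prod_mem_pow {A : Type*} [CommRing A] [Algebra ℝ A] (M : Submodule ℝ A) {ι : Type*}
    (s : Finset ι) (f : ι → A) (hf : ∀ i ∈ s, f i ∈ M) : ∏ i ∈ s, f i ∈ M ^ s.card := by
  classical
  induction s using Finset.induction_on with
  | empty => simpa using Submodule.one_le.1 (le_refl (1 : Submodule ℝ A))
  | insert i s his ih =>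
    rw [Finset.prod_insert his, Finset.card_insert_of_notMem his, pow_succ']
    exact Submodule.mul_mem_mul (hf i (Finset.mem_insert_self _ _))
      (ih fun j hj => hf j (Finset.mem_insert_of_mem hj))

/-- At distinct points of the torus there is a multiplier which vanishes at all points but one. -/
lemma exists_multiplier {m : ℕ} {x : Fin m → V n × ℝ} (hx : DistinctMod x) (i : Fin m) :
    ∃ P ∈ waves n ^ m, P (x i) ≠ 0 ∧ ∀ j ≠ i, P (x j) = 0 := by
  classical
  refine ⟨∏ j : Fin m, if j = i then 1 else wellAt (x j), ?_, ?_, ?_⟩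
  · have := prod_mem_pow (waves n) Finset.univ
      (fun j : Fin m => if j = i then 1 else wellAt (x j)) fun j _ => by
        split_ifs
        · exact one_mem_waves
        · exact wellAt_mem _
    simpa using this
  · rw [Finset.prod_apply, Finset.prod_ne_zero_iff]
    intro j _
    split_ifs with h
    · simp
    · intro h0
      obtain ⟨m', k, e⟩ := exists_int_of_wellAt_eq_zero h0
      exact hx i j (Ne.symm h) m' k e
  · intro j hj
    rw [Finset.prod_apply]
    refine Finset.prod_eq_zero (Finset.mem_univ j) ?_
    rw [if_neg hj, wellAt_self]

/-- Local interpolation data suffice for interpolation. -/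
lemma exists_interpolant {A : Type*} [AddCommGroup A] [Module ℝ A] {m : ℕ}
    (f g : Fin m → A →ₗ[ℝ] ℝ)
    (h : ∀ i, ∃ u₁ u₂ : A, (∀ j ≠ i, f j u₁ = 0 ∧ g j u₁ = 0 ∧ f j u₂ = 0 ∧ g j u₂ = 0) ∧
      f i u₁ * g i u₂ - f i u₂ * g i u₁ ≠ 0) (y : Fin m → ℝ × ℝ) :
    ∃ u, ∀ i, f i u = (y i).1 ∧ g i u = (y i).2 := by
  choose u₁ u₂ hv hd using h
  -- Cramer's rule for the two equations at each point; the functions attached to the other points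
  -- do not contribute.
  set d := fun i => f i (u₁ i) * g i (u₂ i) - f i (u₂ i) * g i (u₁ i) with hdd
  set α := fun i => ((y i).1 * g i (u₂ i) - f i (u₂ i) * (y i).2) / d i with hα
  set β := fun i => (f i (u₁ i) * (y i).2 - (y i).1 * g i (u₁ i)) / d i with hβ
  refine ⟨∑ i, (α i • u₁ i + β i • u₂ i), fun i => ?_⟩
  have hdi : d i ≠ 0 := hd i
  constructor
  · rw [map_sum, Finset.sum_eq_single i]
    · simp only [map_add, map_smul, smul_eq_mul, hα, hβ]
      field_simp
      simp only [hdd]; ring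
    · intro j _ hj
      obtain ⟨a1, a2, a3, a4⟩ := hv j i hj.symm
      simp [a1, a3]
    · simp
  · rw [map_sum, Finset.sum_eq_single i]
    · simp only [map_add, map_smul, smul_eq_mul, hα, hβ]
      field_simp
      simp only [hdd]; ring
    · intro j _ hj
      obtain ⟨a1, a2, a3, a4⟩ := hv j i hj.symm
      simp [a2, a4]
    · simp

lemma contDiff_trigPoly {m : ℕ} (u : trigPoly n m) : ContDiff ℝ ∞ u.1 := (trigPoly_le m u.2).1

/-- The directional derivative at a point, as a linear functional. -/
def jetOne (m : ℕ) (v x : V n × ℝ) : trigPoly n m →ₗ[ℝ] ℝ where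
  toFun u := dirDeriv v u.1 x
  map_add' u u' := by
    have := dirDeriv_add v (contDiff_trigPoly u) (contDiff_trigPoly u')
    exact congrFun this x
  map_smul' c u := by
    have := dirDeriv_sum v {()} (fun _ => c) (q := fun _ : Unit => u.1) fun _ => contDiff_trigPoly u
    simp only [Finset.sum_singleton] at this
    exact congrFun this x

/-- The second directional derivative at a point, as a linear functional. -/
def jetTwo (m : ℕ) (v x : V n × ℝ) : trigPoly n m →ₗ[ℝ] ℝ where
  toFun u := dirDeriv v (dirDeriv v u.1) x
  map_add' u u' := by
    have h1 := dirDeriv_add v (contDiff_trigPoly u) (contDiff_trigPoly u')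
    have h2 := dirDeriv_add v (contDiff_dirDeriv v (contDiff_trigPoly u))
      (contDiff_dirDeriv v (contDiff_trigPoly u'))
    exact (congrArg (fun f => dirDeriv v f x) h1).trans (congrFun h2 x)
  map_smul' c u := by
    have h1 := dirDeriv_sum v {()} (fun _ => c) (q := fun _ : Unit => u.1) fun _ => contDiff_trigPoly u
    have h2 := dirDeriv_sum v {()} (fun _ => c) (q := fun _ : Unit => dirDeriv v u.1)
      fun _ => contDiff_dirDeriv v (contDiff_trigPoly u)
    simp only [Finset.sum_singleton] at h1 h2
    exact (congrArg (fun f => dirDeriv v f x) h1).trans (congrFun h2 x)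

/-- A bump `P³ u`. -/
def bump {m : ℕ} {P u : V n × ℝ → ℝ} (hP : P ∈ waves n ^ m) (hu : u ∈ waves n) : trigPoly n m :=
  ⟨P * (P * (P * u)), Submodule.mul_mem_mul hP (Submodule.mul_mem_mul hP (Submodule.mul_mem_mul hP hu))⟩

variable (ν : V n)

/-- At the i-th point the sine wave in τ centred there has nonzero derivative along the flow, and
one minus the cosine has zero first and nonzero second derivative. The local system is triangular,
and cubes of multipliers remove the other points. -/
lemma exists_interpolant_second {m : ℕ} {x : Fin m → V n × ℝ} (hx : DistinctMod x)
    (y : Fin m → ℝ × ℝ) :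
    ∃ u : trigPoly n m, ∀ i, jetOne m (-ν, 1) (x i) u = (y i).1 ∧
      jetTwo m (-ν, 1) (x i) u = (y i).2 := by
  refine exists_interpolant (fun i => jetOne m (-ν, 1) (x i)) (fun i => jetTwo m (-ν, 1) (x i))
    (fun i => ?_) y
  obtain ⟨P, hP, hPi, hPj⟩ := exists_multiplier hx i
  have hPc : ContDiff ℝ ∞ P := (pow_waves_le m hP).1
  set c := crd none (x i) with hc
  refine ⟨bump hP (sinWave_mem none c), bump hP (sub_mem one_mem_waves (cosWave_mem none c)),
    fun j hj => ?_, ?_⟩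
  · obtain ⟨a1, a2⟩ := cube_mul_vanish (-ν, 1) hPc (contDiff_sinWave none c) (hPj j hj)
    obtain ⟨a3, a4⟩ := cube_mul_vanish (-ν, 1) hPc
      (contDiff_one_sub_cosWave none c) (hPj j hj)
    exact ⟨a1, a2, a3, a4⟩
  · obtain ⟨a1, -⟩ := cube_mul_at_zero (-ν, 1) hPc (contDiff_sinWave none c) (x := x i)
      (by simp [sinWave, hc])
    have h1 : cosWave none c (x i) = 1 := by simp [cosWave, hc]
    have h2 : sinWave none c (x i) = 0 := by simp [sinWave, hc]
    obtain ⟨a3, a4⟩ := cube_mul_at_zero (-ν, 1) hPc (x := x i) (contDiff_one_sub_cosWave none c)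
      (by rw [Pi.sub_apply, h1, Pi.one_apply, sub_self])
    have e : dirDeriv ((-ν, 1) : V n × ℝ) (fun x => 2 * Real.pi * crd none (-ν, 1) * sinWave none c x) =
        fun x => 2 * Real.pi * dirDeriv ((-ν, 1) : V n × ℝ) (sinWave none c) x := by
      have := dirDeriv_sum ((-ν, 1) : V n × ℝ) {()} (fun _ => 2 * Real.pi)
        (q := fun _ : Unit => sinWave none c) fun _ => contDiff_sinWave none c
      simpa [crd] using this
    rw [dirDeriv_one_sub_cosWave] at a3 a4
    rw [e] at a4
    rw [dirDeriv_sinWave] at a1 a4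
    have h3 : crd none ((-ν, 1) : V n × ℝ) = 1 := rfl
    simp only [h1, h2, h3, mul_zero, mul_one, add_zero] at a1 a3 a4
    show dirDeriv _ (P * (P * (P * _))) _ * dirDeriv _ (dirDeriv _ (P * (P * (P * _)))) _ -
      dirDeriv _ (P * (P * (P * _))) _ * dirDeriv _ (dirDeriv _ (P * (P * (P * _)))) _ ≠ 0
    rw [a1, a3, a4]
    simp [hPi, Real.pi_ne_zero]

/-- The sine wave in τ moves along the flow but not along (w, 0); the sine wave in a coordinate k
with w k ≠ 0 moves along (w, 0). The local system is again triangular. -/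
lemma exists_interpolant_line {w : V n} (hw : w ≠ 0) {m : ℕ} {x : Fin m → V n × ℝ}
    (hx : DistinctMod x) (y : Fin m → ℝ × ℝ) :
    ∃ u : trigPoly n m, ∀ i, jetOne m (-ν, 1) (x i) u = (y i).1 ∧
      jetOne m (w, 0) (x i) u = (y i).2 := by
  obtain ⟨k, hk⟩ : ∃ k, w k ≠ 0 := by
    by_contra! h
    exact hw (by ext i; simp [h i])
  refine exists_interpolant (fun i => jetOne m (-ν, 1) (x i)) (fun i => jetOne m (w, 0) (x i))
    (fun i => ?_) y
  obtain ⟨P, hP, hPi, hPj⟩ := exists_multiplier hx i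
  have hPc : ContDiff ℝ ∞ P := (pow_waves_le m hP).1
  set c := crd none (x i) with hc
  set d := crd (some k) (x i) with hd
  refine ⟨bump hP (sinWave_mem none c), bump hP (sinWave_mem (some k) d), fun j hj => ?_, ?_⟩
  · exact ⟨(cube_mul_vanish (-ν, 1) hPc (contDiff_sinWave none c) (hPj j hj)).1,
      (cube_mul_vanish (w, 0) hPc (contDiff_sinWave none c) (hPj j hj)).1,
      (cube_mul_vanish (-ν, 1) hPc (contDiff_sinWave (some k) d) (hPj j hj)).1,
      (cube_mul_vanish (w, 0) hPc (contDiff_sinWave (some k) d) (hPj j hj)).1⟩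
  · have h0 : sinWave none c (x i) = 0 := by simp [sinWave, hc]
    have h1 : sinWave (some k) d (x i) = 0 := by simp [sinWave, hd]
    have a1 := (cube_mul_at_zero (-ν, 1) hPc (contDiff_sinWave none c) h0).1
    have a2 := (cube_mul_at_zero (w, 0) hPc (contDiff_sinWave none c) h0).1
    have a4 := (cube_mul_at_zero (w, 0) hPc (contDiff_sinWave (some k) d) h1).1
    rw [dirDeriv_sinWave] at a1 a2 a4
    have h2 : cosWave none c (x i) = 1 := by simp [cosWave, hc]
    have h3 : cosWave (some k) d (x i) = 1 := by simp [cosWave, hd]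
    have h4 : crd none ((-ν, 1) : V n × ℝ) = 1 := rfl
    have h5 : crd none ((w, 0) : V n × ℝ) = 0 := rfl
    have h6 : crd (some k) ((w, 0) : V n × ℝ) = w k := rfl
    simp only [h2, h3, h4, h5, h6, mul_zero, mul_one] at a1 a2 a4
    show dirDeriv _ (P * (P * (P * _))) _ * dirDeriv _ (P * (P * (P * _))) _ -
      dirDeriv _ (P * (P * (P * _))) _ * dirDeriv _ (P * (P * (P * _))) _ ≠ 0
    rw [a1, a2, a4]
    simp [hPi, Real.pi_ne_zero, hk]

/-- Finitely many smooth functions on the torus whose combinations interpolate the first and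
second derivatives along the flow, and the first derivatives in two directions, at any `m`
points. -/
theorem exists_interpolating {w : V n} (hw : w ≠ 0) (m : ℕ) :
    ∃ (N : ℕ) (q : Fin N → V n × ℝ → ℝ), (∀ j, ContDiff ℝ ∞ (q j)) ∧ (∀ j, IsPeriodicLift (q j)) ∧
      ∀ x : Fin m → V n × ℝ, DistinctMod x → ∀ y : Fin m → ℝ × ℝ,
        (∃ a : Fin N → ℝ, ∀ i, ∑ j, a j * dirDeriv (-ν, 1) (q j) (x i) = (y i).1 ∧
          ∑ j, a j * dirDeriv (-ν, 1) (dirDeriv (-ν, 1) (q j)) (x i) = (y i).2) ∧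
        ∃ a : Fin N → ℝ, ∀ i, ∑ j, a j * dirDeriv (-ν, 1) (q j) (x i) = (y i).1 ∧
          ∑ j, a j * dirDeriv (w, 0) (q j) (x i) = (y i).2 := by
  obtain ⟨N, q, hq⟩ := Submodule.fg_iff_exists_fin_generating_family.1 (fg_trigPoly (n := n) m)
  have hmem : ∀ j, q j ∈ trigPoly n m := fun j => hq.le (Submodule.subset_span (mem_range_self j))
  have hc : ∀ j, ContDiff ℝ ∞ (q j) := fun j => (trigPoly_le m (hmem j)).1
  have hrep : ∀ u : trigPoly n m, ∃ a : Fin N → ℝ, u.1 = fun x => ∑ j, a j * q j x := fun u => by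
    have hu : u.1 ∈ Submodule.span ℝ (range q) := hq.ge u.2
    obtain ⟨a, ha⟩ := (Submodule.mem_span_range_iff_exists_fun ℝ).1 hu
    refine ⟨a, ?_⟩
    rw [← ha]
    funext x
    simp
  refine ⟨N, q, hc, fun j => (trigPoly_le m (hmem j)).2, fun x hx y => ⟨?_, ?_⟩⟩
  · obtain ⟨u, hu⟩ := exists_interpolant_second ν hx y
    obtain ⟨a, ha⟩ := hrep u
    refine ⟨a, fun i => ⟨?_, ?_⟩⟩
    · have e : dirDeriv (-ν, 1) u.1 (x i) = (y i).1 := (hu i).1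
      rwa [ha, dirDeriv_sum _ _ _ hc] at e
    · have e : dirDeriv (-ν, 1) (dirDeriv (-ν, 1) u.1) (x i) = (y i).2 := (hu i).2
      rwa [ha, dirDeriv_sum _ _ _ hc, dirDeriv_sum _ _ _ fun j => contDiff_dirDeriv _ (hc j)] at e
  · obtain ⟨u, hu⟩ := exists_interpolant_line ν hw hx y
    obtain ⟨a, ha⟩ := hrep u
    refine ⟨a, fun i => ⟨?_, ?_⟩⟩
    · have e : dirDeriv (-ν, 1) u.1 (x i) = (y i).1 := (hu i).1
      rwa [ha, dirDeriv_sum _ _ _ hc] at e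
    · have e : dirDeriv (w, 0) u.1 (x i) = (y i).2 := (hu i).2
      rwa [ha, dirDeriv_sum _ _ _ hc] at e

end Trig

/-! ### Almost every perturbation is generic. -/

/-- The partial derivative of a function of class `C^{k+1}` is of class `C^k`. -/
lemma contDiffOn_fderiv_slice {P X W : Type*} [NormedAddCommGroup P] [NormedSpace ℝ P]
    [NormedAddCommGroup X] [NormedSpace ℝ X] [NormedAddCommGroup W] [NormedSpace ℝ W] {U : Set P}
    (hU : UniqueDiffOn ℝ U) {Ψ : P × X → W} {k k' : WithTop ℕ∞}
    (hΨ : ContDiffOn ℝ k' Ψ (U ×ˢ univ)) (hk : k + 1 ≤ k') :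
    ContDiffOn ℝ k (fun q : P × X => fderiv ℝ (fun x => Ψ (q.1, x)) q.2) (U ×ˢ univ) := by
  have hUD : UniqueDiffOn ℝ (U ×ˢ (univ : Set X)) := hU.prod uniqueDiffOn_univ
  have h1 := (hΨ.fderivWithin hUD hk).clm_comp
    (contDiffOn_const (c := ContinuousLinearMap.inr ℝ P X))
  refine h1.congr fun q hq => ?_
  have hk' : k' ≠ 0 := fun h0 => by
    rw [h0] at hk
    simp at hk
  have h2 := ((hΨ.differentiableOn hk') q hq).hasFDerivWithinAt
  have h3 : HasFDerivWithinAt (fun x : X => (q.1, x)) (ContinuousLinearMap.inr ℝ P X)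
      univ q.2 := ((hasFDerivAt_const q.1 q.2).prodMk (hasFDerivAt_id q.2)).hasFDerivWithinAt
  have h4 := HasFDerivWithinAt.comp (t := U ×ˢ univ) (g := Ψ) q.2 h2 h3 fun x _ => ⟨hq.1, mem_univ _⟩
  rw [hasFDerivWithinAt_univ] at h4
  exact h4.fderiv

section Generic

variable {l m N : ℕ}

/-- The set is a coset of a proper subspace; the vector `w` certifies that `V n` is nontrivial. -/
lemma volume_coincidence {w : V n} (hw : w ≠ 0) {i j : Fin m} (hij : i ≠ j) (v : V n) :
    volume {z : Fin m → V n | z i - z j = v} = 0 := by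
  set f : (Fin m → V n) →ₗ[ℝ] V n := (LinearMap.proj i : (Fin m → V n) →ₗ[ℝ] V n) - LinearMap.proj j with hf
  have h1 : volume ((LinearMap.ker f : Submodule ℝ (Fin m → V n)) : Set (Fin m → V n)) = 0 := by
    refine Measure.addHaar_submodule _ _ fun h => hw ?_
    have : Pi.single i w ∈ LinearMap.ker f := h ▸ Submodule.mem_top
    simpa [hf, hij.symm] using this
  have h2 : {z : Fin m → V n | z i - z j = v} =
      (fun z => -Pi.single i v + z) ⁻¹' (LinearMap.ker f : Submodule ℝ (Fin m → V n)) := by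
    ext z
    simp [hf, hij.symm]
    constructor
    · intro h; rw [← h]; abel
    · intro h
      have : z i - z j - v = -v + z i - z j := by abel
      exact sub_eq_zero.1 (this.trans h)
  rw [h2, measure_preimage_add, h1]

open Module in
/-- For almost every perturbation, at no parameter value the perturbed conditions hold at `m`
distinct points. -/
lemma ae_no_solution {Y : Type*} [NormedAddCommGroup Y] [NormedSpace ℝ Y] [FiniteDimensional ℝ Y]
    {U : Set (V l)} (hU : Convex ℝ U)
    {x : Fin m → (V l × Y) × (Fin m → V n) → V n × ℝ} (hx : ∀ i, ContDiff ℝ 1 (x i))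
    {A B : Fin N → V n × ℝ → ℝ} (hA : ∀ j, ContDiff ℝ 1 (A j)) (hB : ∀ j, ContDiff ℝ 1 (B j))
    {F G : V l × (V n × ℝ) → ℝ} (hF : ContDiffOn ℝ 1 F (U ×ˢ univ))
    (hG : ContDiffOn ℝ 1 G (U ×ˢ univ))
    (hint : ∀ x : Fin m → V n × ℝ, DistinctMod x → ∀ y : Fin m → ℝ × ℝ, ∃ a : Fin N → ℝ,
      ∀ i, ∑ j, a j * A j (x i) = (y i).1 ∧ ∑ j, a j * B j (x i) = (y i).2)
    (hdim : l + finrank ℝ Y < 2 * m) :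
    ∀ᵐ a : Fin N → ℝ, ∀ᵐ z : Fin m → V n, ∀ c ∈ U, ∀ y : Y,
      DistinctMod (fun i => x i ((c, y), z)) →
      ¬ ∀ i, F (c, x i ((c, y), z)) + ∑ j, a j * A j (x i ((c, y), z)) = 0 ∧
        G (c, x i ((c, y), z)) + ∑ j, a j * B j (x i ((c, y), z)) = 0 := by
  set K : Set (V l × Y) := U ×ˢ univ with hK
  set vec : Fin N → (V l × Y) × (Fin m → V n) → (Fin m → ℝ × ℝ) := fun j q i =>
    (A j (x i q), B j (x i q)) with hvec
  have hvecc : ∀ j, ContDiff ℝ 1 (vec j) := fun j => contDiff_pi.2 fun i =>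
    ((hA j).comp (hx i)).prodMk ((hB j).comp (hx i))
  -- The conditions are 2m affine equations on the coefficients `a`, with linear part `L` and
  -- right-hand side `R`. Interpolation makes `L` surjective at distinct points, and `z` plays the
  -- role of the additional generic variable.
  set L : (V l × Y) × (Fin m → V n) → ((Fin N → ℝ) →L[ℝ] (Fin m → ℝ × ℝ)) := fun q =>
    ∑ j, ContinuousLinearMap.smulRightL ℝ (Fin N → ℝ) (Fin m → ℝ × ℝ)
      (ContinuousLinearMap.proj j) (vec j q) with hL
  have hLapp : ∀ q a i, L q a i = (∑ j, a j * A j (x i q), ∑ j, a j * B j (x i q)) := fun q a i => by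
    simp only [hL, sum_apply, Finset.sum_apply]
    refine Prod.ext ?_ ?_
    · rw [Prod.fst_sum]; rfl
    · rw [Prod.snd_sum]; rfl
  have hLc : ContDiff ℝ 1 L := ContDiff.sum fun j _ =>
    (ContinuousLinearMap.contDiff _).comp (hvecc j)
  set R : (V l × Y) × (Fin m → V n) → (Fin m → ℝ × ℝ) := fun q i =>
    (-F (q.1.1, x i q), -G (q.1.1, x i q)) with hR
  have hRc : ContDiffOn ℝ 1 R (K ×ˢ univ) := by
    refine contDiffOn_pi.2 fun i => ?_
    have h1 : ContDiffOn ℝ 1 (fun q : (V l × Y) × (Fin m → V n) => (q.1.1, x i q)) (K ×ˢ univ) :=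
      ((contDiff_fst.comp contDiff_fst).prodMk (hx i)).contDiffOn
    have h2 : MapsTo (fun q : (V l × Y) × (Fin m → V n) => (q.1.1, x i q)) (K ×ˢ univ)
      (U ×ˢ univ) := fun q hq => ⟨hq.1.1, mem_univ _⟩
    exact ((hF.comp h1 h2).neg).prodMk ((hG.comp h1 h2).neg)
  have : (volume : Measure ((Fin N → ℝ) × (Fin m → V n))).IsAddHaarMeasure :=
    Measure.prod.instIsAddHaarMeasure _ _
  have key := ae_forall_ne_of_finrank_lt (volume : Measure ((Fin N → ℝ) × (Fin m → V n)))
    (hU.prod convex_univ : Convex ℝ K) hLc.contDiffOn hRc (by simpa [Module.finrank_pi_fintype, mul_comm] using hdim)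
  filter_upwards [Measure.ae_ae_of_ae_prod key] with a ha
  filter_upwards [ha] with z hz c hc y hd hall
  refine hz (c, y) ⟨hc, mem_univ _⟩ ?_ ?_
  · intro v
    obtain ⟨a', ha'⟩ := hint _ hd v
    refine ⟨a', funext fun i => ?_⟩
    rw [hLapp, (ha' i).1, (ha' i).2]
  · funext i
    rw [hLapp]
    simp only [hR, Prod.mk.injEq]
    constructor
    · linarith [(hall i).1]
    · linarith [(hall i).2]

lemma dirDeriv_add_sum {X : Type*} [NormedAddCommGroup X] [NormedSpace ℝ X] (v : X) {f : X → ℝ}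
    (hf : Differentiable ℝ f) {q : Fin N → X → ℝ} (hq : ∀ j, Differentiable ℝ (q j)) (a : Fin N → ℝ) :
    dirDeriv v (fun x => f x + ∑ j, a j * q j x) =
      fun x => dirDeriv v f x + ∑ j, a j * dirDeriv v (q j) x := by
  funext x
  have h1 : ∀ i ∈ Finset.univ, HasFDerivAt (fun x => a i * q i x) (a i • fderiv ℝ (q i) x) x :=
    fun i _ => ((hq i).differentiableAt (x := x)).hasFDerivAt.const_mul _
  simp only [dirDeriv]
  rw [(hf.differentiableAt.hasFDerivAt.fun_add (HasFDerivAt.fun_sum h1)).fderiv]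
  simp

/-- Almost all perturbations make all members of a family generic. -/
theorem ae_isGeneric {ν w : V n} (hν : ∀ j : ℤ, j ≠ 0 → ∀ m, (j : ℝ) • ν ≠ intVec m) (hw : w ≠ 0)
    (hm : l + 2 * n < m) {q : Fin N → V n × ℝ → ℝ} (hq : ∀ j, ContDiff ℝ ∞ (q j))
    (hint : ∀ x : Fin m → V n × ℝ, DistinctMod x → ∀ y : Fin m → ℝ × ℝ,
        (∃ a : Fin N → ℝ, ∀ i, ∑ j, a j * dirDeriv (-ν, 1) (q j) (x i) = (y i).1 ∧
          ∑ j, a j * dirDeriv (-ν, 1) (dirDeriv (-ν, 1) (q j)) (x i) = (y i).2) ∧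
        ∃ a : Fin N → ℝ, ∀ i, ∑ j, a j * dirDeriv (-ν, 1) (q j) (x i) = (y i).1 ∧
          ∑ j, a j * dirDeriv (w, 0) (q j) (x i) = (y i).2)
    {U : Set (V l)} (hU : Convex ℝ U) (hUD : UniqueDiffOn ℝ U) {Ψ : V l × (V n × ℝ) → ℝ}
    (hΨ : ContDiffOn ℝ 3 Ψ (U ×ˢ univ)) :
    ∀ᵐ a : Fin N → ℝ, ∀ c ∈ U, IsGeneric ν w m
      (qpTau ν fun x => Ψ (c, x) + ∑ j, a j * q j x)
      (qpTauTau ν fun x => Ψ (c, x) + ∑ j, a j * q j x)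
      (qpZeta ν fun x => Ψ (c, x) + ∑ j, a j * q j x) := by
  set e : V n × ℝ := (-ν, 1) with he
  have hdq : ∀ v j, ContDiff ℝ 1 (dirDeriv v (q j)) := fun v j =>
    (contDiff_dirDeriv v (hq j)).of_le (by exact_mod_cast le_top)
  have hddq : ∀ j, ContDiff ℝ 1 (dirDeriv e (dirDeriv e (q j))) := fun j =>
    (contDiff_dirDeriv e (contDiff_dirDeriv e (hq j))).of_le (by exact_mod_cast le_top)
  have hslice : ∀ c ∈ U, ContDiff ℝ 3 fun x => Ψ (c, x) := fun c hc => by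
    rw [← contDiffOn_univ]
    exact hΨ.comp (t := U ×ˢ univ) (f := fun x : V n × ℝ => (c, x))
      (ContDiff.contDiffOn (by fun_prop)) fun x _ => ⟨hc, mem_univ _⟩
  have hD : ∀ v, ContDiffOn ℝ 2
      (fun p : V l × (V n × ℝ) => dirDeriv v (fun x => Ψ (p.1, x)) p.2) (U ×ˢ univ) := fun v =>
    (contDiffOn_fderiv_slice hUD hΨ (by norm_num)).clm_apply contDiffOn_const
  have hDD : ContDiffOn ℝ 1
      (fun p : V l × (V n × ℝ) => dirDeriv e (dirDeriv e fun x => Ψ (p.1, x)) p.2) (U ×ˢ univ) :=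
    (contDiffOn_fderiv_slice hUD (hD e) (by norm_num)).clm_apply contDiffOn_const
  have hint1 := fun x hx y => (hint x hx y).1
  have hint2 := fun x hx y => (hint x hx y).2
  have hD1 := fun v => (hD v).of_le (by norm_num : (1 : WithTop ℕ∞) ≤ 2)
  -- Degenerate zeros at m times on one orbit: the unknowns are c, ζ and the times.
  have g1 := ae_no_solution (Y := V n × (Fin m → ℝ)) hU
    (x := fun i p => flowPt ν p.1.2.1 (p.1.2.2 i)) (fun i => by unfold flowPt; fun_prop)
    (hdq e) hddq (hD1 e) hDD hint1 (by simp; omega)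
  -- Degenerate zeros on m orbits through almost every m-tuple of points: only c and the times are
  -- unknown.
  have g2 := ae_no_solution (Y := Fin m → ℝ) hU
    (x := fun i p => flowPt ν (p.2 i) (p.1.2 i)) (fun i => by unfold flowPt; fun_prop)
    (hdq e) hddq (hD1 e) hDD hint1 (by simp; omega)
  -- Chains: the unknowns are c, ζ, b and the times. This count, l + 2n + m < 2m, is the most
  -- demanding of the three.
  have g3 := ae_no_solution (Y := V n × V n × (Fin m → ℝ)) hU
    (x := fun i p => flowPt ν (p.1.2.1 - (i : ℝ) • p.1.2.2.1) (p.1.2.2.2 i))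
    (fun i => by unfold flowPt; fun_prop)
    (hdq e) (hdq (w, 0)) (hD1 e) (hD1 (w, 0)) hint2 (by simp; omega)
  filter_upwards [g1, g2, g3] with a h1 h2 h3 c hc
  have hsd : Differentiable ℝ fun x => Ψ (c, x) := (hslice c hc).differentiable (by norm_num)
  have hqd : ∀ j, Differentiable ℝ (q j) := fun j => (hq j).differentiable (by norm_num)
  have hsdd : Differentiable ℝ (dirDeriv e fun x => Ψ (c, x)) :=
    (((hslice c hc).fderiv_right (m := 2) (by norm_num)).clm_apply contDiff_const).differentiable
      (by norm_num)
  set Φ : V n × ℝ → ℝ := fun x => Ψ (c, x) + ∑ j, a j * q j x with hΦ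
  have e1 : ∀ v, dirDeriv v Φ = fun x => dirDeriv v (fun x => Ψ (c, x)) x +
      ∑ j, a j * dirDeriv v (q j) x := fun v => dirDeriv_add_sum v hsd hqd a
  have e2 : dirDeriv e (dirDeriv e Φ) = fun x => dirDeriv e (dirDeriv e fun x => Ψ (c, x)) x +
      ∑ j, a j * dirDeriv e (dirDeriv e (q j)) x := by
    rw [e1]
    exact dirDeriv_add_sum e hsdd (fun j => (hdq e j).differentiable (by norm_num)) a
  have t1 : ∀ ζ τ, qpTau ν Φ ζ τ = dirDeriv e Φ (flowPt ν ζ τ) := fun ζ τ => rfl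
  have t2 : ∀ ζ τ, qpTauTau ν Φ ζ τ = dirDeriv e (dirDeriv e Φ) (flowPt ν ζ τ) := fun ζ τ => rfl
  have tz : ∀ ζ τ, inner ℝ (qpZeta ν Φ ζ τ) w = dirDeriv (w, 0) Φ (flowPt ν ζ τ) := fun ζ τ =>
    inner_qpZeta ζ τ w
  refine ⟨fun ζ => ?_, ?_, fun ζ b t hd hall => ?_⟩
  · by_contra hinf
    obtain ⟨z, hz⟩ := h1.exists
    obtain ⟨f, hf⟩ := Set.Infinite.natEmbedding _ hinf
    refine hz c hc (ζ, fun i => (f i : ℝ)) ?_ fun i => ?_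
    · intro i i' hne m' j heq
      simp only [flowPt, Prod.mk_add_mk, Prod.mk.injEq] at heq
      obtain ⟨a1, a2⟩ := heq
      by_cases hj : j = 0
      · subst hj
        rw [Int.cast_zero, add_zero] at a2
        exact hne (Fin.ext (hf (Subtype.ext a2)))
      · refine hν j hj (-m') ?_
        rw [a2] at a1
        rw [intVec_neg]
        have : (j : ℝ) • ν = (ζ - (f i' : ℝ) • ν) - (ζ - ((f i' : ℝ) + j) • ν) := by module
        rw [this, a1]; abel
    · have := (f i).2
      simp only [mem_ofPred_eq, t1, t2] at this
      rw [e2, e1] at this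
      exact this
  · have hco : ∀ᵐ z : Fin m → V n, ∀ i j, i ≠ j → ∀ (m' : Fin n → ℤ) (k : ℤ),
        z i - z j ≠ (k : ℝ) • ν + intVec m' := by
      simp only [ae_all_iff]
      intro i j hij m' k
      have := volume_coincidence hw hij ((k : ℝ) • ν + intVec m')
      rw [← compl_mem_ae_iff] at this
      exact this
    -- Positive outer measure of the exceptional set would give positive outer measure to its m-th
    -- power. But for almost every m-tuple the orbits are distinct modulo ℤν + ℤⁿ and do not all
    -- carry a degenerate zero. No measurability of the set is needed.
    set S : Set (V n) := {ζ | ¬ ∀ τ, qpTau ν Φ ζ τ = 0 → qpTauTau ν Φ ζ τ ≠ 0} with hS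
    have hpi : volume (Set.pi univ fun _ : Fin m => S) = 0 := by
      refine measure_mono_null ?_ ((ae_iff.1 (h2.and hco)))
      intro z hz
      simp only [mem_ofPred_eq, not_and]
      intro hz2 hz3
      have hz' : ∀ i, ∃ τ, qpTau ν Φ (z i) τ = 0 ∧ qpTauTau ν Φ (z i) τ = 0 := fun i => by
        have := hz i (mem_univ i)
        simp only [hS, mem_ofPred_eq, not_forall, not_not, ne_eq] at this
        obtain ⟨τ, a, b⟩ := this
        exact ⟨τ, a, b⟩
      choose t ht ht' using hz'
      refine hz2 c hc t ?_ fun i => ?_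
      · intro i i' hne m' j heq
        simp only [flowPt, Prod.mk_add_mk, Prod.mk.injEq] at heq
        obtain ⟨a1, a2⟩ := heq
        refine hz3 i i' hne m' j ?_
        rw [a2] at a1
        have : z i - z i' = (z i - (t i' + (j : ℝ)) • ν) - (z i' - t i' • ν) + (j : ℝ) • ν := by
          module
        rw [this, a1]; abel
      · have b1 := ht i
        have b2 := ht' i
        rw [t1, e1] at b1
        rw [t2, e2] at b2
        exact ⟨b1, b2⟩
    have hm0 : m ≠ 0 := by omega
    rw [volume_pi, Measure.pi_pi, Finset.prod_const, Finset.card_univ, Fintype.card_fin] at hpi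
    exact (pow_eq_zero_iff hm0).1 hpi
  · obtain ⟨z, hz⟩ := h3.exists
    refine hz c hc (ζ, b, t) hd fun i => ?_
    have := hall i
    rw [t1, tz, e1, e1] at this
    exact this

end Generic

/-! ### Good potentials form a typical set. -/

/-- The function `Φ(ζ - τ ν, τ)` is good. -/
def GoodAt (ν : V n) (Φ : V n × ℝ → ℝ) : Prop := IsGood (qpTau ν Φ) (qpTauTau ν Φ) (qpZeta ν Φ)

section Typical

variable {P : Type} [NormedAddCommGroup P] [NormedSpace ℝ P] {r : ℕ∞} {K U : Set P}

lemma CrSpace.contDiff_slice_two (hr : 2 ≤ r) (Θ : CrSpace n r K) {κ : P} (hκ : κ ∈ K) :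
    ContDiff ℝ 2 fun x => Θ.1 (κ, x) :=
  (Θ.contDiff_slice hκ).of_le (WithTop.coe_le_coe.2 hr)

/-- Goodness is open jointly in the potential and the parameter κ, and compactness of C makes one
neighbourhood of the potential work for all κ in C. -/
lemma isOpen_goodAt (hr : 2 ≤ r) (hUK : U ⊆ K) (hU : UniqueDiffOn ℝ U)
    (hcl : U ⊆ closure (interior U)) (ν : V n) {C : Set P} (hC : IsCompact C) (hCU : C ⊆ U) :
    IsOpen {Θ : CrSpace n r K | ∀ κ ∈ C, GoodAt ν fun x => Θ.1 (κ, x)} := by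
  have hjet := CrSpace.continuousJet (n := n) (r := r) hUK hU hcl hr
  have hq : ∀ t : CrSpace n r K × U, IsQuasiPeriodic ν (qp ν fun x => t.1.1 (t.2.1, x))
      (qpTau ν fun x => t.1.1 (t.2.1, x)) (qpTauTau ν fun x => t.1.1 (t.2.1, x))
      (qpZeta ν fun x => t.1.1 (t.2.1, x)) := fun t =>
    isQuasiPeriodic_qp (t.1.contDiff_slice_two hr (hUK t.2.2)) (t.1.isPeriodicLift (hUK t.2.2))
  have hopen : IsOpen {t : CrSpace n r K × U | GoodAt ν fun x => t.1.1 (t.2.1, x)} :=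
    isOpen_isGood (hjet.qpTau continuous_const) (hjet.qpTauTau continuous_const)
      (hjet.qpZeta continuous_const) (fun t => (hq t).periodic₁) (fun t => (hq t).periodic₂)
      fun t => (hq t).periodicz
  have hC' : IsCompact ((↑) ⁻¹' C : Set U) := by
    rw [Subtype.isCompact_iff, Subtype.image_preimage_coe, inter_eq_self_of_subset_right hCU]
    exact hC
  rw [isOpen_iff_eventually]
  intro Θ hΘ
  have key : ∀ᶠ Θ' : CrSpace n r K in 𝓝 Θ, ∀ κ ∈ ((↑) ⁻¹' C : Set U),
      GoodAt ν fun x => Θ'.1 (κ.1, x) :=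
    hC'.eventually_forall_of_forall_eventually fun κ hκ =>
      isOpen_iff_eventually.1 hopen (Θ, κ) (hΘ κ.1 hκ)
  filter_upwards [key] with Θ' h κ hκ using h ⟨κ, hCU hκ⟩ hκ

variable {N : ℕ}

/-- A perturbation by functions on the torus. -/
def CrSpace.perturb (Θ : CrSpace n r K) {q : Fin N → V n × ℝ → ℝ} (hq : ∀ j, ContDiff ℝ ∞ (q j))
    (hper : ∀ j, IsPeriodicLift (q j)) (a : Fin N → ℝ) : CrSpace n r K :=
  ⟨fun p => Θ.1 p + ∑ j, a j * q j p.2,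
    Θ.2.1.add (ContDiff.contDiffOn (ContDiff.sum fun j _ => contDiff_const.mul
      (((hq j).of_le (WithTop.coe_le_coe.2 le_top)).comp contDiff_snd))),
    fun η hη ξ τ m j => by
      have h : ∀ i, q i (ξ + intVec m, τ + (j : ℝ)) = q i (ξ, τ) := fun i => hper i ξ τ m j
      simp only [Θ.2.2 η hη ξ τ m j, h]⟩

/-- The function ignores the parameter and is periodic in the other variables, so each derivative
takes all its values on a compact set. -/
lemma exists_bound_iteratedFDeriv {q : V n × ℝ → ℝ} (hq : ContDiff ℝ ∞ q) (hper : IsPeriodicLift q)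
    (i : ℕ) : ∃ B, ∀ x : P × V n × ℝ, ‖iteratedFDeriv ℝ i (fun p : P × V n × ℝ => q p.2) x‖ ≤ B := by
  set f : P × V n × ℝ → ℝ := fun p => q p.2 with hf
  have hfc : ContDiff ℝ ∞ f := hq.comp contDiff_snd
  have hc : Continuous (iteratedFDeriv ℝ i f) :=
    hfc.continuous_iteratedFDeriv (by exact_mod_cast le_top)
  obtain ⟨B, hB⟩ := (isCompact_singleton.prod (isCompact_closedCube.prod isCompact_Icc) :
    IsCompact ({(0 : P)} ×ˢ (closedCube n ×ˢ Icc (0 : ℝ) 1))).exists_bound_of_continuousOn hc.continuousOn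
  refine ⟨B, fun x => ?_⟩
  obtain ⟨p, ξ, τ⟩ := x
  set v : P × V n × ℝ := (-p, intVec (-floorVec ξ), ((-⌊τ⌋ : ℤ) : ℝ)) with hv
  have hinv : (fun x => f (x + v)) = f := by
    funext x
    exact hper x.2.1 x.2.2 (-floorVec ξ) (-⌊τ⌋)
  have h1 := iteratedFDeriv_comp_add_right (𝕜 := ℝ) (f := f) i v (p, ξ, τ)
  rw [hinv] at h1
  rw [h1]
  refine hB _ ⟨?_, ?_, ?_⟩
  · simp [hv]
  · show ξ + intVec (-floorVec ξ) ∈ closedCube n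
    rw [← fractVec_eq]; exact unitCube_subset (fractVec_mem _)
  · show τ + ((-⌊τ⌋ : ℤ) : ℝ) ∈ Icc (0 : ℝ) 1
    have e : τ + ((-⌊τ⌋ : ℤ) : ℝ) = Int.fract τ := by
      rw [← Int.self_sub_floor]; push_cast; ring
    rw [e]
    exact ⟨Int.fract_nonneg _, (Int.fract_lt_one _).le⟩

lemma CrSpace.tendsto_perturb (Θ : CrSpace n r K) {q : Fin N → V n × ℝ → ℝ}
    (hq : ∀ j, ContDiff ℝ ∞ (q j)) (hper : ∀ j, IsPeriodicLift (q j)) :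
    Filter.Tendsto (Θ.perturb hq hper) (𝓝 0) (𝓝 Θ) := by
  rw [CrSpace.tendsto_iff]
  intro i hi
  choose B hB using fun j => exists_bound_iteratedFDeriv (P := P) (hq j) (hper j) i
  have hlim : Filter.Tendsto (fun a : Fin N → ℝ => ∑ j, |a j| * B j) (𝓝 0) (𝓝 0) := by
    have : Continuous fun a : Fin N → ℝ => ∑ j, |a j| * B j := by fun_prop
    simpa using this.tendsto 0
  rw [Metric.tendstoUniformly_iff]
  intro ε hε
  filter_upwards [hlim.eventually (gt_mem_nhds hε)] with a ha x
  have hqs : ∀ j, ContDiff ℝ i fun p : P × V n × ℝ => a j * q j p.2 := fun j =>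
    contDiff_const.mul (((hq j).of_le (by exact_mod_cast le_top)).comp contDiff_snd)
  have hqs' : ∀ j, ContDiff ℝ i fun p : P × V n × ℝ => q j p.2 := fun j =>
    ((hq j).of_le (by exact_mod_cast le_top)).comp contDiff_snd
  have hΘ : ContDiffAt ℝ i Θ.1 x.1 := by
    refine (Θ.2.1.contDiffAt ?_).of_le (by exact_mod_cast hi)
    rw [← Prod.mk.eta (p := x.1)]
    exact prod_mem_nhds (mem_interior_iff_mem_nhds.1 x.2) Filter.univ_mem
  have e1 : iteratedFDeriv ℝ i (Θ.perturb hq hper a).1 x.1 = iteratedFDeriv ℝ i Θ.1 x.1 +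
      iteratedFDeriv ℝ i (fun p : P × V n × ℝ => ∑ j, a j * q j p.2) x.1 :=
    iteratedFDeriv_add_apply hΘ (ContDiff.sum fun j _ => hqs j).contDiffAt
  have e2 : iteratedFDeriv ℝ i (fun p : P × V n × ℝ => ∑ j, a j * q j p.2) x.1 =
      ∑ j, a j • iteratedFDeriv ℝ i (fun p : P × V n × ℝ => q j p.2) x.1 := by
    rw [iteratedFDeriv_fun_sum_apply fun j _ => (hqs j).contDiffAt]
    refine Finset.sum_congr rfl fun j _ => ?_
    exact iteratedFDeriv_const_smul_apply (a := a j) (hqs' j).contDiffAt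
  rw [dist_comm, dist_eq_norm, e1, add_sub_cancel_left, e2]
  refine (norm_sum_le _ _).trans_lt (lt_of_le_of_lt (Finset.sum_le_sum fun j _ => ?_) ha)
  rw [norm_smul, Real.norm_eq_abs]
  exact mul_le_mul_of_nonneg_left (hB j _) (abs_nonneg _)

lemma CrSpace.mem_closure_of_ae (Θ : CrSpace n r K) {q : Fin N → V n × ℝ → ℝ}
    (hq : ∀ j, ContDiff ℝ ∞ (q j)) (hper : ∀ j, IsPeriodicLift (q j)) {X : Set (CrSpace n r K)}
    (h : ∀ᵐ a : Fin N → ℝ, Θ.perturb hq hper a ∈ X) : Θ ∈ closure X := by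
  rw [mem_closure_iff_nhds]
  intro W hW
  have h1 : ∀ᶠ a in 𝓝 (0 : Fin N → ℝ), Θ.perturb hq hper a ∈ W := Θ.tendsto_perturb hq hper hW
  obtain ⟨a, ha1, ha2⟩ := ((Measure.dense_of_ae h).inter_nhds_nonempty h1)
  exact ⟨_, ha2, ha1⟩

/-- Generic perturbations of a family are good. -/
lemma ae_goodAt (hr : 3 ≤ r) {ν : V n} (hν : ∀ j : ℤ, j ≠ 0 → ∀ m, (j : ℝ) • ν ≠ intVec m) (l : ℕ) :
    ∃ (N : ℕ) (q : Fin N → V n × ℝ → ℝ) (hq : ∀ j, ContDiff ℝ ∞ (q j))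
      (hper : ∀ j, IsPeriodicLift (q j)), ∀ (Θ : CrSpace n r K) (U : Set (V l)) (f : V l → P),
      Convex ℝ U → UniqueDiffOn ℝ U → ContDiff ℝ r f → MapsTo f U K →
      ∀ᵐ a : Fin N → ℝ, ∀ c ∈ U, GoodAt ν fun x => (Θ.perturb hq hper a).1 (f c, x) := by
  obtain ⟨w, hw, hinv⟩ := exists_invariant_direction hν
  obtain ⟨N, q, hq, hper, hint⟩ := exists_interpolating ν hw (l + 2 * n + 1)
  refine ⟨N, q, hq, hper, fun Θ U f hU hUD hf hmaps => ?_⟩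
  have hr3 : (3 : WithTop ℕ∞) ≤ r := WithTop.coe_le_coe.2 hr
  have hΨ : ContDiffOn ℝ 3 (fun p : V l × (V n × ℝ) => Θ.1 (f p.1, p.2)) (U ×ˢ univ) := by
    refine (Θ.2.1.comp (t := K ×ˢ univ) (f := fun p : V l × (V n × ℝ) => (f p.1, p.2)) ?_
      fun p hp => ⟨hmaps hp.1, mem_univ _⟩).of_le hr3
    exact ((hf.comp contDiff_fst).prodMk contDiff_snd).contDiffOn
  filter_upwards [ae_isGeneric hν hw (by omega) hq hint hU hUD hΨ] with a ha c hc
  have hκ := hmaps hc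
  exact (isQuasiPeriodic_qp ((Θ.perturb hq hper a).contDiff_slice_two
    ((by norm_num : (2 : ℕ∞) ≤ 3).trans hr) hκ)
    ((Θ.perturb hq hper a).isPeriodicLift hκ)).isGood hν hinv (ha c hc)

/-- Good potentials form a typical set. -/
theorem isTypical_goodAt (hr : 3 ≤ r) {ν : V n} (hν : ∀ j : ℤ, j ≠ 0 → ∀ m, (j : ℝ) • ν ≠ intVec m)
    {O : Set (V n)} (hO : IsOpen O) {η : V n} (hη : η ∈ O) :
    IsTypical {Θ : CrSpace n r (closure O) | GoodAt ν fun x => Θ.1 (η, x)} := by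
  have hr2 : 2 ≤ r := (by norm_num : (2 : ℕ∞) ≤ 3).trans hr
  have hηc : η ∈ closure O := subset_closure hη
  refine ⟨?_, fun Θ => ?_, fun l _ => ?_⟩
  · have := isOpen_goodAt hr2 subset_closure hO.uniqueDiffOn
      (by rw [hO.interior_eq]; exact subset_closure) ν isCompact_singleton
      (singleton_subset_iff.2 hη)
    simpa using this
  -- A single potential is treated as a family without parameters.
  · obtain ⟨N, q, hq, hper, h⟩ := ae_goodAt (P := V n) (K := closure O) hr hν 0
    refine Θ.mem_closure_of_ae hq hper ?_
    filter_upwards [h Θ univ (fun _ => η) convex_univ uniqueDiffOn_univ contDiff_const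
      fun _ _ => hηc] with a ha
    exact ha 0 (mem_univ _)
  · set B : Set (V l) := Metric.closedBall 0 1 with hB
    have hBc : Convex ℝ B := convex_closedBall _ _
    have hBi : interior B = Metric.ball 0 1 := interior_closedBall _ one_ne_zero
    have hBu : UniqueDiffOn ℝ B :=
      uniqueDiffOn_convex hBc (by rw [hBi]; exact ⟨0, Metric.mem_ball_self one_pos⟩)
    -- The families chosen have only good members over the closed ball. Compactness of the ball
    -- gives openness, and the count with l extra parameters gives density.
    refine ⟨{𝓕 | ∀ κ ∈ B ×ˢ {η}, GoodAt ν fun x => 𝓕.1 (κ, x)}, ?_, fun 𝓕 => ?_, ?_⟩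
    · refine isOpen_goodAt (U := B ×ˢ O) hr2 (prod_mono_right subset_closure)
        (hBu.prod hO.uniqueDiffOn) ?_ ν ((isCompact_closedBall _ _).prod isCompact_singleton)
        (prod_mono_right (singleton_subset_iff.2 hη))
      rw [interior_prod_eq, closure_prod_eq, hBi, closure_ball _ one_ne_zero, hO.interior_eq]
      exact prod_mono_right subset_closure
    · obtain ⟨N, q, hq, hper, h⟩ := ae_goodAt (P := V l × V n) (K := B ×ˢ closure O) hr hν l
      refine 𝓕.mem_closure_of_ae hq hper ?_
      filter_upwards [h 𝓕 B (fun c => (c, η)) hBc hBu (contDiff_id.prodMk contDiff_const)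
        fun c hc => ⟨hc, hηc⟩] with a ha
      rintro ⟨c, η'⟩ ⟨hc, rfl⟩
      exact ha c hc
    · intro 𝓕 h𝓕
      exact Filter.Eventually.of_forall fun c hc => h𝓕 (c, η) ⟨hc, rfl⟩

end Typical

/-! ### Averages along choices of zeros, and convexity of their closure. -/

lemma continuousAt_bracketZero {T : Type*} [TopologicalSpace T] {g₁ g₂ : T → V n → ℝ → ℝ}
    {a : ℝ × ℝ} {t₀ : T} {ζ₀ : V n}
    (hb : ∀ᶠ z : T × V n in 𝓝 (t₀, ζ₀), IsBracket (g₁ z.1) (g₂ z.1) a z.2)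
    (hd : ∀ᶠ z : T × V n in 𝓝 (t₀, ζ₀), ∀ τ, HasDerivAt (g₁ z.1 z.2) (g₂ z.1 z.2 τ) τ)
    (hc : ∀ τ, ContinuousAt (fun z : (T × V n) × ℝ => g₁ z.1.1 z.1.2 z.2) ((t₀, ζ₀), τ)) :
    ContinuousAt (fun z : T × V n => bracketZero (g₁ z.1) a z.2) (t₀, ζ₀) := by
  rw [ContinuousAt, tendsto_nhds]
  intro O hO hs
  have hb₀ := hb.self_of_nhds
  have hd₀ := hd.self_of_nhds
  -- On the compact rest of the bracket `g₁` has no zero: the sign change excludes the ends and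
  -- uniqueness excludes the interior. This persists nearby, which forces the selected zero into
  -- `O`.
  have hK : IsCompact (Icc a.1 a.2 \ O) := isCompact_Icc.diff hO
  have hne : ∀ τ ∈ Icc a.1 a.2 \ O, g₁ t₀ ζ₀ τ ≠ 0 := by
    rintro τ ⟨⟨h1, h2⟩, hτ⟩ h0
    have hmul := hb₀.2.2.2.1
    have n1 : a.1 ≠ τ := fun e => by
      subst e
      simp only at hmul h0
      rw [h0, zero_mul] at hmul
      exact lt_irrefl _ hmul
    have n2 : τ ≠ a.2 := fun e => by
      subst e
      simp only at hmul h0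
      rw [h0, mul_zero] at hmul
      exact lt_irrefl _ hmul
    have := hb₀.eq_bracketZero hd₀ ⟨lt_of_le_of_ne h1 n1, lt_of_le_of_ne h2 n2⟩ h0
    exact hτ (this ▸ hs)
  have hev : ∀ᶠ z : T × V n in 𝓝 (t₀, ζ₀), ∀ τ ∈ Icc a.1 a.2 \ O, g₁ z.1 z.2 τ ≠ 0 :=
    hK.eventually_forall_of_forall_eventually fun τ hτ =>
      (hc τ).eventually (isOpen_ne.mem_nhds (hne τ hτ))
  filter_upwards [hev, hb, hd] with z h1 h2 h3
  obtain ⟨h4, h5⟩ := h2.bracketZero_mem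
    (continuous_iff_continuousAt.2 fun τ => (h3 τ).continuousAt)
  by_contra hO'
  exact h1 _ ⟨⟨h4.1.le, h4.2.le⟩, hO'⟩ h5

/-- A closed set which contains the midpoints of its points is convex. -/
lemma convex_of_midpoint_mem {E : Type*} [NormedAddCommGroup E] [NormedSpace ℝ E] {C : Set E}
    (hC : IsClosed C) (h : ∀ x ∈ C, ∀ y ∈ C, midpoint ℝ x y ∈ C) : Convex ℝ C := by
  rw [convex_iff_segment_subset]
  intro x hx y hy
  rw [segment_eq_image_lineMap]
  rintro _ ⟨t, ht, rfl⟩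
  by_contra hn
  set f : ℝ → E := fun s => AffineMap.lineMap x y s with hf
  have hfc : Continuous f := AffineMap.lineMap_continuous
  have h1 : IsCompact (Icc 0 t ∩ f ⁻¹' C) := isCompact_Icc.inter_right (hC.preimage hfc)
  have h2 : IsCompact (Icc t 1 ∩ f ⁻¹' C) := isCompact_Icc.inter_right (hC.preimage hfc)
  -- a and b are the parameters of points of C nearest to t on the two sides; their midpoint would
  -- lie in the gap.
  obtain ⟨a, ⟨ha, haC⟩, hamax⟩ := h1.exists_isGreatest
    ⟨0, ⟨le_rfl, ht.1⟩, by simpa [hf] using hx⟩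
  obtain ⟨b, ⟨hb, hbC⟩, hbmin⟩ := h2.exists_isLeast
    ⟨1, ⟨ht.2, le_rfl⟩, by simpa [hf] using hy⟩
  have hat : a < t := lt_of_le_of_ne ha.2 fun e => hn (e ▸ haC)
  have htb : t < b := lt_of_le_of_ne hb.1 fun e => hn (e ▸ hbC)
  have hm : f ((a + b) / 2) ∈ C := by
    have := h _ haC _ hbC
    have e : midpoint ℝ (f a) (f b) = f ((a + b) / 2) := by
      simp only [hf, midpoint_eq_smul_add, AffineMap.lineMap_apply_module]
      rw [invOf_eq_inv]
      module
    rwa [e] at this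
  rcases le_total ((a + b) / 2) t with hle | hle
  · have := hamax ⟨⟨by linarith [ha.1], hle⟩, hm⟩
    linarith
  · have := hbmin ⟨⟨hle, by linarith [hb.2]⟩, hm⟩
    linarith

/-- The checkerboard in one coordinate. -/
lemma isGrid_even_floor {M : ℕ} (hM : 0 < M) (hMe : Even M) (i : Fin n) :
    IsGrid fun ζ : V n => Even ⌊(M : ℝ) * ζ i⌋ where
  periodic ζ m := by
    have e : (M : ℝ) * (ζ + intVec m) i = (M : ℝ) * ζ i + ((M * m i : ℤ) : ℝ) := by
      simp only [PiLp.add_apply, intVec_apply]; push_cast; ring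
    have hMm : Even ((M : ℤ) * m i) := (by exact_mod_cast hMe : Even (M : ℤ)).mul_right _
    show Even ⌊(M : ℝ) * (ζ + intVec m) i⌋ = Even ⌊(M : ℝ) * ζ i⌋
    rw [e, Int.floor_add_intCast, Int.even_add, iff_true_right hMm]
  finite := toFinite _
  locConst := ⟨M, hM, fun ζ hζ => by
    have h1 : ∀ j : ℤ, (M : ℝ) * ζ i ≠ j := fun j e => hζ ⟨i, j, e⟩
    have h2 : Filter.Tendsto (fun ζ' : V n => (M : ℝ) * ζ' i) (𝓝 ζ) (𝓝 ((M : ℝ) * ζ i)) :=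
      (by fun_prop : Continuous fun ζ' : V n => (M : ℝ) * ζ' i).tendsto ζ
    filter_upwards [h2.eventually (eventually_floor_eq h1)] with ζ' e
    rw [e]⟩

lemma even_floor_shift {M : ℕ} (hM : 0 < M) (i : Fin n) (ζ : V n) :
    Even ⌊(M : ℝ) * (ζ + EuclideanSpace.single i (1 / (M : ℝ))) i⌋ ↔ ¬ Even ⌊(M : ℝ) * ζ i⌋ := by
  have hM0 : (M : ℝ) ≠ 0 := by positivity
  have e : (M : ℝ) * (ζ + EuclideanSpace.single i (1 / (M : ℝ))) i = (M : ℝ) * ζ i + 1 := by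
    simp [mul_add, hM0]
  rw [e, Int.floor_add_one, Int.even_add_one]

section Average

variable {ν : V n} {g g₁ g₂ : V n → ℝ → ℝ} {gz : V n → ℝ → V n} {A : V n → ℝ × ℝ}

/-- The value of the gradient at the chosen zero. -/
def selGrad (g₁ : V n → ℝ → ℝ) (gz : V n → ℝ → V n) (A : V n → ℝ × ℝ) (ζ : V n) : V n :=
  gz ζ (bracketZero g₁ (A ζ) ζ)

lemma IsSelection.isBracket (hA : IsSelection g₁ g₂ A) (ζ : V n) : IsBracket g₁ g₂ (A ζ) ζ :=
  (hA.2 ζ).self_of_nhds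

namespace IsQuasiPeriodic

lemma periodic_selGrad (h : IsQuasiPeriodic ν g g₁ g₂ gz) (hA : IsSelection g₁ g₂ A) : IsPeriodic (selGrad g₁ gz A) := fun ζ m => by
  rw [selGrad, selGrad, h.periodicz, hA.1.periodic, bracketZero_congr (h.periodic₁ ζ m)]

lemma continuousAt_selGrad (h : IsQuasiPeriodic ν g g₁ g₂ gz) (hA : IsSelection g₁ g₂ A) {ζ : V n}
    (hζ : ∀ᶠ ζ' in 𝓝 ζ, A ζ' = A ζ) : ContinuousAt (selGrad g₁ gz A) ζ := by
  have h1 : ContinuousAt (fun z : Unit × V n => bracketZero g₁ (A ζ) z.2) ((), ζ) := by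
    refine continuousAt_bracketZero (T := Unit) (g₁ := fun _ => g₁) (g₂ := fun _ => g₂) ?_ ?_ ?_
    · have h2 : Filter.Tendsto (fun z : Unit × V n => z.2) (𝓝 ((), ζ)) (𝓝 ζ) :=
        continuous_snd.tendsto _
      filter_upwards [h2.eventually hζ] with z hz
      rw [← hz]
      exact hA.isBracket z.2
    · exact Filter.Eventually.of_forall fun z τ => h.hasDerivAt' z.2 τ
    · intro τ
      exact (h.cont₁.comp (by fun_prop : Continuous fun z : (Unit × V n) × ℝ =>
        (z.1.2, z.2))).continuousAt
  have h2 : ContinuousAt (fun ζ' => bracketZero g₁ (A ζ) ζ') ζ :=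
    ContinuousAt.comp (f := fun ζ' : V n => (((), ζ') : Unit × V n)) (x := ζ) h1
      (by fun_prop : Continuous fun ζ' : V n => (((), ζ') : Unit × V n)).continuousAt
  have h3 : ContinuousAt (fun ζ' => gz ζ' (bracketZero g₁ (A ζ) ζ')) ζ :=
    ContinuousAt.comp (f := fun ζ' => (ζ', bracketZero g₁ (A ζ) ζ')) (x := ζ)
      h.contz.continuousAt (continuousAt_id.prodMk h2)
  refine h3.congr ?_
  filter_upwards [hζ] with ζ' e
  rw [selGrad, e]

lemma aestronglyMeasurable_selGrad (h : IsQuasiPeriodic ν g g₁ g₂ gz) (hA : IsSelection g₁ g₂ A) :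
    AEStronglyMeasurable (selGrad g₁ gz A) volume := by
  obtain ⟨N, hN, hN'⟩ := hA.1.locConst
  exact aestronglyMeasurable_of_continuousAt hN fun ζ hζ => h.continuousAt_selGrad hA (hN' ζ hζ)

lemma integrableOn_selGrad (h : IsQuasiPeriodic ν g g₁ g₂ gz) (hA : IsSelection g₁ g₂ A) :
    IntegrableOn (selGrad g₁ gz A) (unitCube n) := by
  obtain ⟨L, -, hL, -⟩ := h.exists_lipschitz
  exact Integrable.of_bound (h.aestronglyMeasurable_selGrad hA).restrict L
    (Filter.Eventually.of_forall fun ζ => hL _ _)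

/-- The average over the checkerboard of two choices tends to the mean of the averages. -/
lemma exists_midpoint (h : IsQuasiPeriodic ν g g₁ g₂ gz) (i : Fin n) {A A' : V n → ℝ × ℝ} (hA : IsSelection g₁ g₂ A)
    (hA' : IsSelection g₁ g₂ A') {ε : ℝ} (hε : 0 < ε) :
    ∃ B, IsSelection g₁ g₂ B ∧ ‖(∫ ζ in unitCube n, selGrad g₁ gz B ζ) -
      midpoint ℝ (∫ ζ in unitCube n, selGrad g₁ gz A ζ) (∫ ζ in unitCube n, selGrad g₁ gz A' ζ)‖ < ε := by
  classical
  obtain ⟨L, hL0, hL, -⟩ := h.exists_lipschitz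
  set u : V n → V n := fun ζ => selGrad g₁ gz A ζ - selGrad g₁ gz A' ζ with hu
  have hui : IntegrableOn u (unitCube n) := (h.integrableOn_selGrad hA).sub (h.integrableOn_selGrad hA')
  have hum : AEStronglyMeasurable u volume :=
    (h.aestronglyMeasurable_selGrad hA).sub (h.aestronglyMeasurable_selGrad hA')
  have hub : ∀ ζ, ‖u ζ‖ ≤ L + L := fun ζ => (norm_sub_le _ _).trans (add_le_add (hL _ _) (hL _ _))
  have hper : IsPeriodic u := fun ζ m => by
    simp only [hu, h.periodic_selGrad hA ζ m, h.periodic_selGrad hA' ζ m]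
  -- A translation by one layer of a checkerboard with 2(k + 1) layers per period; the even number
  -- makes the colouring periodic.
  set e : ℕ → V n := fun k => EuclideanSpace.single i (1 / ((2 * (k + 1) : ℕ) : ℝ)) with he
  have hshift : ∀ k, IntegrableOn (fun ζ => u (ζ + e k)) (unitCube n) := fun k =>
    Integrable.of_bound ((hum.comp_measurePreserving
      (measurePreserving_add_right volume (e k))).restrict) (L + L)
      (Filter.Eventually.of_forall fun ζ => hub _)
  have hlim0 : Filter.Tendsto e Filter.atTop (𝓝 0) := by
    have h1 : Filter.Tendsto (fun k : ℕ => 1 / ((2 * (k + 1) : ℕ) : ℝ)) Filter.atTop (𝓝 0) := by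
      refine tendsto_one_div_atTop_nhds_zero_nat.comp ?_
      exact Filter.tendsto_atTop_mono (fun k => (by omega : k ≤ 2 * (k + 1))) Filter.tendsto_id
    have h2 : Continuous fun c : ℝ => (EuclideanSpace.single i c : V n) := by
      refine (PiLp.continuous_toLp 2 _).comp (continuous_pi fun j => ?_)
      by_cases hj : j = i
      · subst hj; simpa using continuous_id'
      · simpa [hj] using continuous_const
    have h3 := (h2.tendsto 0).comp h1
    have h4 : (EuclideanSpace.single i (0 : ℝ) : V n) = 0 := by simp
    rw [h4] at h3
    exact h3
  have hlim : Filter.Tendsto (fun k => ∫ ζ in unitCube n, ‖u (ζ + e k) - u ζ‖) Filter.atTop (𝓝 0) := by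
    have hz : (0 : ℝ) = ∫ ζ in unitCube n, (0 : ℝ) := by simp
    rw [hz]
    refine tendsto_integral_of_dominated_convergence (fun _ => (L + L) + (L + L)) (fun k =>
      ((hshift k).sub hui).aestronglyMeasurable.norm) (integrable_const _) (fun k =>
      Filter.Eventually.of_forall fun ζ => ?_) ?_
    · rw [norm_norm]
      exact (norm_sub_le _ _).trans (add_le_add (hub _) (hub _))
    · refine ae_restrict_of_ae ?_
      obtain ⟨N, hN, hN'⟩ := hA.1.locConst
      obtain ⟨N', hM, hM'⟩ := hA'.1.locConst
      have z1 : ∀ᵐ ζ : V n, ζ ∉ gridPlanes n N := by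
        rw [ae_iff]; simpa using volume_gridPlanes hN
      have z2 : ∀ᵐ ζ : V n, ζ ∉ gridPlanes n N' := by
        rw [ae_iff]; simpa using volume_gridPlanes hM
      filter_upwards [z1, z2] with ζ h1 h2
      have hc : ContinuousAt u ζ :=
        (h.continuousAt_selGrad hA (hN' ζ h1)).sub (h.continuousAt_selGrad hA' (hM' ζ h2))
      have h3 : Filter.Tendsto (fun k => ζ + e k) Filter.atTop (𝓝 ζ) := by
        simpa using (tendsto_const_nhds (x := ζ)).add hlim0
      have h4 := ((hc.tendsto.comp h3).sub_const (u ζ)).norm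
      simpa using h4
  obtain ⟨k, hk⟩ := (hlim.eventually (gt_mem_nhds hε)).exists
  set M := 2 * (k + 1) with hM
  have hM0 : 0 < M := by omega
  set c : V n → Prop := fun ζ => Even ⌊(M : ℝ) * ζ i⌋ with hc
  have hcg : IsGrid c := isGrid_even_floor hM0 (even_two_mul _) i
  have hce : ∀ ζ, c (ζ + e k) ↔ ¬ c ζ := fun ζ => even_floor_shift hM0 i ζ
  set B : V n → ℝ × ℝ := fun ζ => if c ζ then A ζ else A' ζ with hB
  have hBs : IsSelection g₁ g₂ B := ⟨hA.1.ite hA'.1 hcg, fun ζ => by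
    filter_upwards [hA.2 ζ, hA'.2 ζ] with ζ' h1 h2
    simp only [hB]
    split_ifs
    · exact h1
    · exact h2⟩
  refine ⟨B, hBs, ?_⟩
  -- Translation by `e k` exchanges the colours, so the integral of u over one colour equals that of
  -- u(· + e k) over the other. Twice the former is the integral of u up to ∫ ‖u(ζ + e k) - u(ζ)‖,
  -- which is small because u is bounded and continuous off a null set.
  set X : V n → V n := fun ζ => if c ζ then u ζ else 0 with hX
  set X' : V n → V n := fun ζ => if c ζ then 0 else u (ζ + e k) with hX'
  have hBX : ∀ ζ, selGrad g₁ gz B ζ = selGrad g₁ gz A' ζ + X ζ := fun ζ => by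
    simp only [selGrad, hB, hX, hu]
    split_ifs <;> abel
  have hXi : IntegrableOn X (unitCube n) := by
    have := (h.integrableOn_selGrad hBs).sub (h.integrableOn_selGrad hA')
    refine this.congr (Filter.Eventually.of_forall fun ζ => ?_)
    simp [hBX]
  have hXper : IsPeriodic X := fun ζ m => by
    have h1 : c (ζ + intVec m) = c ζ := hcg.periodic ζ m
    simp only [hX, hper ζ m, h1]
  have hXX' : ∀ ζ, X (ζ + e k) = X' ζ := fun ζ => by
    simp only [hX, hX']
    by_cases hh : c ζ
    · rw [if_neg ((hce ζ).not.2 (not_not.2 hh)), if_pos hh]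
    · rw [if_pos ((hce ζ).2 hh), if_neg hh]
  have hX'i : IntegrableOn X' (unitCube n) := by
    have hXm : AEStronglyMeasurable X volume := by
      have : X = fun ζ => selGrad g₁ gz B ζ - selGrad g₁ gz A' ζ := funext fun ζ => by simp [hBX]
      rw [this]
      exact (h.aestronglyMeasurable_selGrad hBs).sub (h.aestronglyMeasurable_selGrad hA')
    have h1 : IntegrableOn (fun ζ => X (ζ + e k)) (unitCube n) :=
      Integrable.of_bound ((hXm.comp_measurePreserving
        (measurePreserving_add_right volume (e k))).restrict) (L + L)
        (Filter.Eventually.of_forall fun ζ => by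
          simp only [hX]
          split_ifs
          · exact hub _
          · simpa using add_nonneg hL0 hL0)
    exact h1.congr (Filter.Eventually.of_forall hXX')
  have hXe : ∫ ζ in unitCube n, X ζ = ∫ ζ in unitCube n, X' ζ := by
    rw [← hXper.setIntegral_add (e k)]
    simp only [hXX']
  have hdiff : ‖(∫ ζ in unitCube n, X ζ) + (∫ ζ in unitCube n, X ζ) - ∫ ζ in unitCube n, u ζ‖ ≤
      ∫ ζ in unitCube n, ‖u (ζ + e k) - u ζ‖ := by
    nth_rewrite 2 [hXe]
    have hadd : IntegrableOn (fun ζ => X ζ + X' ζ) (unitCube n) := hXi.add hX'i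
    rw [← integral_add hXi hX'i, ← integral_sub hadd hui]
    refine norm_integral_le_of_norm_le ((hshift k).sub hui).norm
      (Filter.Eventually.of_forall fun ζ => ?_)
    simp only [hX, hX']
    split_ifs
    · simp
    · simp
  have hfin : (∫ ζ in unitCube n, selGrad g₁ gz B ζ) -
      midpoint ℝ (∫ ζ in unitCube n, selGrad g₁ gz A ζ) (∫ ζ in unitCube n, selGrad g₁ gz A' ζ) =
      (1 / 2 : ℝ) • ((∫ ζ in unitCube n, X ζ) + (∫ ζ in unitCube n, X ζ) - ∫ ζ in unitCube n, u ζ) := by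
    have e1 : ∫ ζ in unitCube n, selGrad g₁ gz B ζ =
        (∫ ζ in unitCube n, selGrad g₁ gz A' ζ) + ∫ ζ in unitCube n, X ζ := by
      rw [← integral_add (h.integrableOn_selGrad hA') hXi]
      simp only [hBX]
    have e2 : ∫ ζ in unitCube n, u ζ = (∫ ζ in unitCube n, selGrad g₁ gz A ζ) -
        ∫ ζ in unitCube n, selGrad g₁ gz A' ζ :=
      integral_sub (h.integrableOn_selGrad hA) (h.integrableOn_selGrad hA')
    rw [e1, e2, midpoint_eq_smul_add, invOf_eq_inv]
    module
  rw [hfin, norm_smul]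
  have : ‖(1 / 2 : ℝ)‖ = 1 / 2 := by norm_num
  rw [this]
  have := norm_nonneg ((∫ ζ in unitCube n, X ζ) + (∫ ζ in unitCube n, X ζ) - ∫ ζ in unitCube n, u ζ)
  linarith

/-- Good functions have choices of zeros with average close to any vector of some fixed length. -/
theorem exists_average (h : IsQuasiPeriodic ν g g₁ g₂ gz) (i : Fin n) (hgood : IsGood g₁ g₂ gz) :
    ∃ lam : ℝ, 0 < lam ∧ ∀ β : V n, ‖β‖ = 1 → ∀ ε > 0, ∃ A, IsSelection g₁ g₂ A ∧
      ‖(∫ ζ in unitCube n, selGrad g₁ gz A ζ) - lam • β‖ < ε := by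
  set D : Set (V n) := {v | ∃ A, IsSelection g₁ g₂ A ∧ v = ∫ ζ in unitCube n, selGrad g₁ gz A ζ} with hD
  have hmid : ∀ x ∈ D, ∀ y ∈ D, midpoint ℝ x y ∈ closure D := by
    rintro _ ⟨A, hA, rfl⟩ _ ⟨A', hA', rfl⟩
    rw [Metric.mem_closure_iff]
    intro ε hε
    obtain ⟨B, hB, hlt⟩ := h.exists_midpoint i hA hA' hε
    exact ⟨_, ⟨B, hB, rfl⟩, by rwa [dist_comm, dist_eq_norm]⟩
  have hconv : Convex ℝ (closure D) := by
    refine convex_of_midpoint_mem isClosed_closure fun x hx y hy => ?_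
    have hc : Continuous (fun z : V n × V n => midpoint ℝ z.1 z.2) := by
      simp only [midpoint_eq_smul_add]; fun_prop
    have := map_mem_closure₂ (f := fun x y : V n => midpoint ℝ x y) hc hx hy hmid
    rwa [closure_closure] at this
  have hpos : ∀ b : V n, ‖b‖ = 1 → ∃ v ∈ D, 0 < inner ℝ v b := by
    intro b hb
    obtain ⟨A, hA, hint, hbr⟩ := hgood b hb
    have hS : IsSelection g₁ g₂ fun ζ => (A ζ).1 :=
      ⟨hA.comp Prod.fst, fun ζ => (hbr ζ).mono fun ζ' h' => h'.1⟩
    refine ⟨_, ⟨_, hS, rfl⟩, hint.trans_le ?_⟩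
    have hi := h.integrableOn_selGrad hS
    have e : inner ℝ (∫ ζ in unitCube n, selGrad g₁ gz (fun ζ => (A ζ).1) ζ) b =
        ∫ ζ in unitCube n, inner ℝ b (selGrad g₁ gz (fun ζ => (A ζ).1) ζ) := by
      rw [real_inner_comm, integral_inner hi]
    rw [e]
    refine integral_mono (hA.comp Prod.snd).integrable (hi.const_inner b) fun ζ => ?_
    obtain ⟨h1, h2⟩ := (hbr ζ).self_of_nhds
    have hc : Continuous (g₁ ζ) := h.cont₁.comp (by fun_prop : Continuous fun τ : ℝ => (ζ, τ))
    have h3 := (h1.bracketZero_mem hc).1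
    have := h2 _ ⟨h3.1.le, h3.2.le⟩
    rw [real_inner_comm] at this
    exact this.le
  -- An average with positive component along b serves nearby directions with a definite margin;
  -- compactness yields one margin for the whole sphere.
  have hlam : ∀ᶠ lam in 𝓝 (0 : ℝ), ∀ b ∈ Metric.sphere (0 : V n) 1, ∃ v ∈ D, lam < inner ℝ v b := by
    refine (isCompact_sphere _ _).eventually_forall_of_forall_eventually fun b hb => ?_
    obtain ⟨v, hv, h0⟩ := hpos b (by simpa using hb)
    have hc : Continuous fun z : ℝ × V n => inner ℝ v z.2 - z.1 := by fun_prop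
    have h1 : ∀ᶠ z in 𝓝 ((0 : ℝ), b), 0 < inner ℝ v z.2 - z.1 :=
      (hc.tendsto _).eventually (lt_mem_nhds (by simpa using h0))
    filter_upwards [h1] with z hz
    exact ⟨v, hv, by linarith⟩
  obtain ⟨lam, hl, hl0⟩ := ((hlam.filter_mono nhdsWithin_le_nhds).and
    (self_mem_nhdsWithin (a := (0 : ℝ)) (s := Ioi 0))).exists
  refine ⟨lam, hl0, fun β hβ => ?_⟩
  have hmem : lam • β ∈ closure D := by
    by_contra hn
    -- A separating functional ⟨y, ·⟩ would bound all averages by ⟨y, lam β⟩ ≤ lam ‖y‖, against the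
    -- margin in the direction of y.
    obtain ⟨f, u, hf1, hf2⟩ := geometric_hahn_banach_closed_point hconv isClosed_closure hn
    set y := (InnerProductSpace.toDual ℝ (V n)).symm f with hy
    have hfy : ∀ x, f x = inner ℝ y x := fun x => by
      rw [hy, InnerProductSpace.toDual_symm_apply]
    have hy0 : y ≠ 0 := fun h0 => by
      obtain ⟨v, hv, -⟩ := hpos β hβ
      have h1 := hf1 v (subset_closure hv)
      rw [hfy, h0, inner_zero_left] at h1 hf2
      linarith
    have hyn : 0 < ‖y‖ := norm_pos_iff.2 hy0
    obtain ⟨v, hv, hlt⟩ := hl (‖y‖⁻¹ • y) (by simp [norm_smul, hy0])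
    have h1 := hf1 v (subset_closure hv)
    rw [hfy] at h1 hf2
    rw [inner_smul_right, real_inner_comm] at hlt
    rw [inner_smul_right] at hf2
    have h2 : inner ℝ y β ≤ ‖y‖ := by
      have := real_inner_le_norm y β
      rwa [hβ, mul_one] at this
    have h3 : lam * ‖y‖ < inner ℝ y v := by
      have := mul_lt_mul_of_pos_right hlt hyn
      field_simp at this
      linarith
    have hl0' : 0 < lam := hl0
    nlinarith
  intro ε hε
  obtain ⟨_, ⟨A, hA, rfl⟩, hlt⟩ := Metric.mem_closure_iff.1 hmem ε hε
  exact ⟨A, hA, by rwa [dist_comm, dist_eq_norm] at hlt⟩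

end IsQuasiPeriodic

end Average

/-! ### The unperturbed frequencies and the potential along the flow. -/

lemma eventually_isBracket {T : Type*} [TopologicalSpace T] {g₁ g₂ : T → V n → ℝ → ℝ}
    {a : ℝ × ℝ} {t₀ : T} {ζ₀ : V n} (hb : IsBracket (g₁ t₀) (g₂ t₀) a ζ₀)
    (h₁ : ∀ τ, ContinuousAt (fun z : (T × V n) × ℝ => g₁ z.1.1 z.1.2 z.2) ((t₀, ζ₀), τ))
    (h₂ : ∀ τ, ContinuousAt (fun z : (T × V n) × ℝ => g₂ z.1.1 z.1.2 z.2) ((t₀, ζ₀), τ)) :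
    ∀ᶠ z : T × V n in 𝓝 (t₀, ζ₀), IsBracket (g₁ z.1) (g₂ z.1) a z.2 := by
  obtain ⟨b1, b2, b3, b4, b5⟩ := hb
  have e : ∀ τ : ℝ, ContinuousAt (fun z : T × V n => g₁ z.1 z.2 τ) (t₀, ζ₀) := fun τ =>
    ContinuousAt.comp (f := fun z : T × V n => (z, τ)) (x := (t₀, ζ₀)) (h₁ τ)
      (by fun_prop : Continuous fun z : T × V n => (z, τ)).continuousAt
  have e1 : ∀ᶠ z : T × V n in 𝓝 (t₀, ζ₀), g₁ z.1 z.2 a.1 * g₁ z.1 z.2 a.2 < 0 :=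
    ((e a.1).mul (e a.2)).eventually (gt_mem_nhds b4)
  have e2 : ∀ᶠ z : T × V n in 𝓝 (t₀, ζ₀), ∀ τ ∈ Icc a.1 a.2, g₂ z.1 z.2 τ ≠ 0 :=
    isCompact_Icc.eventually_forall_of_forall_eventually fun τ hτ =>
      (h₂ τ).eventually (isOpen_ne.mem_nhds (b5 τ hτ))
  filter_upwards [e1, e2] with z h1 h2 using ⟨b1, b2, b3, h1, h2⟩

lemma UnperturbedSystem.contDiffAt_freq {r : ℕ∞} (S : UnperturbedSystem n r) {p : V n}
    (hp : p ∈ closure S.dom) : ContDiffAt ℝ r S.freq p := by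
  have hE : ContDiffAt ℝ ((r : WithTop ℕ∞) + 1) S.E p :=
    (S.contDiffAt_F p hp 0 S.zero_mem_D).comp p
      (by fun_prop : ContDiff ℝ ((r : WithTop ℕ∞) + 1) fun y : V n => (y, S.f 0)).contDiffAt
  have h1 : ContDiffAt ℝ r (fderiv ℝ S.E) p := hE.fderiv_right le_rfl
  refine contDiffAt_euclidean.2 fun i => ?_
  have e : (fun y => S.freq y i) = fun y => fderiv ℝ S.E y (EuclideanSpace.single i 1) := by
    funext y
    have : inner ℝ (S.freq y) (EuclideanSpace.single i 1) = fderiv ℝ S.E y (EuclideanSpace.single i 1) := by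
      rw [UnperturbedSystem.freq, gradient, InnerProductSpace.toDual_symm_apply]
    rw [← this, EuclideanSpace.inner_single_right]
    simp
  rw [e]
  exact h1.clm_apply contDiffAt_const

/-- A frequency vector on a simple resonance has no integer multiples. -/
lemma UnperturbedSystem.freq_not_integer {r : ℕ∞} (S : UnperturbedSystem n r) (hn : 2 ≤ n)
    {k : (Fin n → ℤ) × ℤ} (hk : k ≠ 0) {η : V n}
    (hsimple : ∀ l : (Fin n → ℤ) × ℤ, S.Resonant η l → ¬ LinearIndependent ℤ ![k, l]) :
    ∀ j : ℤ, j ≠ 0 → ∀ m, (j : ℝ) • S.freq η ≠ intVec m := by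
  intro j hj m heq
  -- If jν = m, each coordinate i gives a resonance with vector j times the i-th basis vector and
  -- constant term m i.
  have hres : ∀ i, S.Resonant η (Pi.single i j, m i) := by
    intro i
    have h1 : (intVec (Pi.single i j) : V n) = EuclideanSpace.single i (j : ℝ) := by
      ext i'
      by_cases h : i' = i
      · subst h; simp [intVec]
      · simp [intVec, h]
    have h2 : (j : ℝ) * S.freq η i = m i := by
      have := congrArg (fun v : V n => v i) heq
      simpa [intVec] using this
    rw [UnperturbedSystem.Resonant, h1, EuclideanSpace.inner_single_right]
    simp
    linarith
  -- Being collinear with the i-th resonance forces every other component of k̂ to vanish. Two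
  -- different indices, available since n ≥ 2, give k̂ = 0 and then k = 0.
  have key : ∀ i i' : Fin n, i ≠ i' → k.1 i' = 0 ∧ (k.1 i = 0 → k = 0) := by
    intro i i' hne
    have h := hsimple _ (hres i)
    rw [LinearIndependent.pair_iff] at h
    push Not at h
    obtain ⟨s, t, h1, h2⟩ := h
    have c0 : s * k.2 + t * m i = 0 := congrArg Prod.snd h1
    have ci : s * k.1 i + t * j = 0 := by
      have := congrFun (congrArg Prod.fst h1) i
      simpa using this
    have ci' : s * k.1 i' = 0 := by
      have := congrFun (congrArg Prod.fst h1) i'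
      simpa [hne.symm] using this
    have hs : s ≠ 0 := fun h0 => by
      rw [h0, zero_mul, zero_add] at ci
      exact h2 h0 ((mul_eq_zero.1 ci).resolve_right hj)
    refine ⟨(mul_eq_zero.1 ci').resolve_left hs, fun hi => ?_⟩
    have ht : t = 0 := by
      rw [hi, mul_zero, zero_add] at ci
      exact (mul_eq_zero.1 ci).resolve_right hj
    rw [ht, zero_smul, add_zero] at h1
    exact (smul_eq_zero.1 h1).resolve_left hs
  have hne : (⟨0, by omega⟩ : Fin n) ≠ ⟨1, by omega⟩ := by simp
  exact hk ((key _ _ hne).2 (key _ _ hne.symm).1)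

section Potential

variable {r : ℕ∞} (S : UnperturbedSystem n r) (Θ : CrSpace n r (closure S.dom))

/-- The derivative of the potential along the unperturbed flow. -/
def flowTau (p ζ : V n) (τ : ℝ) : ℝ := qpTau (S.freq p) (fun x => Θ.1 (p, x)) ζ τ

/-- The second derivative of the potential along the unperturbed flow. -/
def flowTauTau (p ζ : V n) (τ : ℝ) : ℝ := qpTauTau (S.freq p) (fun x => Θ.1 (p, x)) ζ τ

/-- The gradient of the potential along the unperturbed flow. -/
def flowZeta (p ζ : V n) (τ : ℝ) : V n := qpZeta (S.freq p) (fun x => Θ.1 (p, x)) ζ τ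

variable {S Θ} {p : V n}

lemma isQuasiPeriodic_flow (hr : 2 ≤ r) (hp : p ∈ closure S.dom) :
    IsQuasiPeriodic (S.freq p) (qp (S.freq p) fun x => Θ.1 (p, x)) (flowTau S Θ p)
      (flowTauTau S Θ p) (flowZeta S Θ p) :=
  isQuasiPeriodic_qp (Θ.contDiff_slice_two hr hp) (Θ.isPeriodicLift hp)

lemma hatTau_eq (hr : 2 ≤ r) (hp : p ∈ closure S.dom) (ζ : V n) (τ : ℝ) :
    hatTau S Θ.1 p ζ τ = flowTau S Θ p ζ τ :=
  ((isQuasiPeriodic_flow (Θ := Θ) hr hp).hasDerivAt ζ τ).deriv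

lemma hatZeta_eq (hr : 2 ≤ r) (hp : p ∈ closure S.dom) (ζ : V n) (τ : ℝ) :
    hatZeta S Θ.1 p ζ τ = flowZeta S Θ p ζ τ := by
  have h : fderiv ℝ (fun z => hat S Θ.1 p z τ) ζ = innerSL ℝ (flowZeta S Θ p ζ τ) :=
    ((isQuasiPeriodic_flow (Θ := Θ) hr hp).hasFDerivAt ζ τ).fderiv
  rw [hatZeta, gradient, h]
  exact (InnerProductSpace.toDual ℝ (V n)).symm_apply_apply _

lemma dNu_eq (hr : 2 ≤ r) (hp : p ∈ closure S.dom) (x : V n × ℝ) :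
    dNu S Θ.1 (p, x) = fderiv ℝ (fun x => Θ.1 (p, x)) x (-S.freq p, 1) :=
  ((Θ.contDiff_slice_two hr hp).differentiable (by norm_num)).differentiableAt.lineDeriv_eq_fderiv

lemma dNu_dNu_eq (hr : 2 ≤ r) (hp : p ∈ closure S.dom) (x : V n × ℝ) :
    dNu S (dNu S Θ.1) (p, x) =
      fderiv ℝ (fun x => fderiv ℝ (fun x => Θ.1 (p, x)) x (-S.freq p, 1)) x (-S.freq p, 1) := by
  have h : ContDiff ℝ 1 fun x => fderiv ℝ (fun x => Θ.1 (p, x)) x (-S.freq p, 1) :=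
    ((Θ.contDiff_slice_two hr hp).fderiv_right (m := 1) (by norm_num)).clm_apply contDiff_const
  have e : (fun x => dNu S Θ.1 (p, x)) = fun x => fderiv ℝ (fun x => Θ.1 (p, x)) x (-S.freq p, 1) :=
    funext fun x => dNu_eq hr hp x
  rw [dNu]
  simp only [e]
  exact (h.differentiable (by norm_num)).differentiableAt.lineDeriv_eq_fderiv

/-- The operator ∂ is differentiation along the line τ ↦ (ζ - τν, τ), so J₀ collects the
nondegenerate critical points of the potential on these lines. -/
lemma mem_J₀_iff (hr : 2 ≤ r) (hp : p ∈ closure S.dom) (ζ : V n) (τ : ℝ) :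
    (p, ζ - τ • S.freq p, τ) ∈ J₀ S Θ.1 ↔ flowTau S Θ p ζ τ = 0 ∧ flowTauTau S Θ p ζ τ ≠ 0 := by
  have h1 := dNu_eq (Θ := Θ) hr hp (flowPt (S.freq p) ζ τ)
  have h2 := dNu_dNu_eq (Θ := Θ) hr hp (flowPt (S.freq p) ζ τ)
  constructor
  · rintro ⟨-, h3, h4⟩
    exact ⟨h1.symm.trans h3, fun h0 => h4 (h2.trans h0)⟩
  · rintro ⟨h3, h4⟩
    exact ⟨hp, h1.trans h3, fun h0 => h4 (h2.symm.trans h0)⟩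

lemma contDiffOn_fderiv_potential (hr : 2 ≤ r) :
    ContDiffOn ℝ ((r - 1 : ℕ∞) : WithTop ℕ∞)
      (fun q : V n × V n × ℝ => fderiv ℝ (fun x => Θ.1 (q.1, x)) q.2) (S.dom ×ˢ univ) := by
  refine contDiffOn_fderiv_slice S.isOpen_dom.uniqueDiffOn
    (Θ.2.1.mono (prod_mono_left subset_closure)) ?_
  have : (r - 1) + 1 = r := tsub_add_cancel_of_le ((by norm_num : (1 : ℕ∞) ≤ 2).trans hr)
  exact_mod_cast this.le

lemma contDiffAt_flowTau (hr : 2 ≤ r) (hp : p ∈ S.dom) (ζ : V n) (τ : ℝ) :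
    ContDiffAt ℝ ((r - 1 : ℕ∞) : WithTop ℕ∞)
      (fun q : V n × V n × ℝ => flowTau S Θ q.1 q.2.1 q.2.2) (p, ζ, τ) := by
  have hν : ContDiffAt ℝ ((r - 1 : ℕ∞) : WithTop ℕ∞) (fun q : V n × V n × ℝ => S.freq q.1) (p, ζ, τ) :=
    ((S.contDiffAt_freq (subset_closure hp)).of_le (WithTop.coe_le_coe.2 tsub_le_self)).comp _
      contDiffAt_fst
  have h1 : ContDiffAt ℝ ((r - 1 : ℕ∞) : WithTop ℕ∞)
      (fun q : V n × V n × ℝ => (q.1, flowPt (S.freq q.1) q.2.1 q.2.2)) (p, ζ, τ) := by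
    unfold flowPt; fun_prop
  have h2 := (contDiffOn_fderiv_potential (Θ := Θ) hr).contDiffAt
    ((S.isOpen_dom.prod isOpen_univ).mem_nhds
      (show (p, flowPt (S.freq p) ζ τ) ∈ S.dom ×ˢ univ from ⟨hp, mem_univ _⟩))
  have h3 := ContDiffAt.comp (g := fun q : V n × V n × ℝ => fderiv ℝ (fun x => Θ.1 (q.1, x)) q.2)
    (p, ζ, τ) h2 h1
  exact h3.clm_apply (hν.neg.prodMk contDiffAt_const)

lemma continuousAt_flowZeta (hr : 2 ≤ r) (hp : p ∈ S.dom) (ζ : V n) (τ : ℝ) :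
    ContinuousAt (fun q : V n × V n × ℝ => flowZeta S Θ q.1 q.2.1 q.2.2) (p, ζ, τ) := by
  have hν : ContinuousAt (fun q : V n × V n × ℝ => S.freq q.1) (p, ζ, τ) :=
    ContinuousAt.comp (f := fun q : V n × V n × ℝ => q.1) (x := (p, ζ, τ))
      (S.contDiffAt_freq (subset_closure hp)).continuousAt continuousAt_fst
  have h1 : ContinuousAt (fun q : V n × V n × ℝ => (q.1, flowPt (S.freq q.1) q.2.1 q.2.2))
      (p, ζ, τ) := by
    unfold flowPt; fun_prop
  have h2 := ((contDiffOn_fderiv_potential (Θ := Θ) hr).contDiffAt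
    ((S.isOpen_dom.prod isOpen_univ).mem_nhds
      (show (p, flowPt (S.freq p) ζ τ) ∈ S.dom ×ˢ univ from ⟨hp, mem_univ _⟩))).continuousAt
  have h3 := ContinuousAt.comp (g := fun q : V n × V n × ℝ => fderiv ℝ (fun x => Θ.1 (q.1, x)) q.2)
    (x := (p, ζ, τ)) h2 h1
  refine ContinuousAt.comp (g := WithLp.toLp 2) (PiLp.continuous_toLp 2 _).continuousAt
    (continuousAt_pi.2 fun i => ?_)
  exact h3.clm_apply continuousAt_const

/-- The second derivative along the flow is the τ-derivative of `flowTau`, which is of class C^{r-1}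
in all variables jointly. -/
lemma continuousAt_flowTauTau (hr : 3 ≤ r) (hp : p ∈ S.dom) (ζ : V n) (τ : ℝ) :
    ContinuousAt (fun q : V n × V n × ℝ => flowTauTau S Θ q.1 q.2.1 q.2.2) (p, ζ, τ) := by
  have hr2 : 2 ≤ r := (by norm_num : (2 : ℕ∞) ≤ 3).trans hr
  have hr1 : ((r - 1 : ℕ∞) : WithTop ℕ∞) ≠ 0 := by
    have : (r - 1 : ℕ∞) ≠ 0 := (tsub_pos_of_lt ((by norm_num : (1 : ℕ∞) < 2).trans_le hr2)).ne'
    exact_mod_cast this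
  have h1 : ∀ᶠ q : V n × V n × ℝ in 𝓝 (p, ζ, τ), flowTauTau S Θ q.1 q.2.1 q.2.2 =
      fderiv ℝ (fun q : V n × V n × ℝ => flowTau S Θ q.1 q.2.1 q.2.2) q (0, 0, 1) := by
    have hdom : ∀ᶠ q : V n × V n × ℝ in 𝓝 (p, ζ, τ), q.1 ∈ S.dom :=
      continuousAt_fst.eventually (S.isOpen_dom.mem_nhds hp)
    filter_upwards [hdom] with q hq
    have h2 := ((contDiffAt_flowTau (Θ := Θ) hr2 hq q.2.1 q.2.2).differentiableAt hr1).hasFDerivAt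
    have h3 : HasDerivAt (fun t : ℝ => (q.1, q.2.1, t)) ((0, 0, 1) : V n × V n × ℝ) q.2.2 :=
      (hasDerivAt_const _ _).prodMk ((hasDerivAt_const _ _).prodMk (hasDerivAt_id _))
    have h4 := HasFDerivAt.comp_hasDerivAt q.2.2 h2 h3
    exact ((isQuasiPeriodic_flow (Θ := Θ) hr2 (subset_closure hq)).hasDerivAt' q.2.1 q.2.2).unique h4
  have h5 : ContinuousAt (fun q : V n × V n × ℝ =>
      fderiv ℝ (fun q : V n × V n × ℝ => flowTau S Θ q.1 q.2.1 q.2.2) q (0, 0, 1)) (p, ζ, τ) := by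
    have h6 : ContDiffAt ℝ 1 (fun q : V n × V n × ℝ => flowTau S Θ q.1 q.2.1 q.2.2) (p, ζ, τ) :=
      (contDiffAt_flowTau (Θ := Θ) hr2 hp ζ τ).of_le (by
        rw [ENat.one_le_iff_ne_zero_withTop]; exact hr1)
    exact (h6.continuousAt_fderiv one_ne_zero).clm_apply continuousAt_const
  exact h5.congr (h1.mono fun _ e => e.symm)

end Potential

/-! ### Dependence of the zeros on action, angle and level. -/

section Zeros

variable {r : ℕ∞} (S : UnperturbedSystem n r) (Θ : CrSpace n r (closure S.dom))

/-- The interval `a` brackets a solution `τ` of `Θ̂_τ(p, ζ, τ) = z`, where `x = ((p, z), ζ)`. -/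
def IsBracketAt (a : ℝ × ℝ) (x : (V n × ℝ) × V n) : Prop :=
  x.1.1 ∈ S.dom ∧
    IsBracket (fun ζ τ => flowTau S Θ x.1.1 ζ τ - x.1.2) (flowTauTau S Θ x.1.1) a x.2

/-- The solution `τ` of `Θ̂_τ(p, ζ, τ) = z` in the interval `a`, where `x = ((p, z), ζ)`. -/
def zeroAt (a : ℝ × ℝ) (x : (V n × ℝ) × V n) : ℝ :=
  bracketZero (fun ζ τ => flowTau S Θ x.1.1 ζ τ - x.1.2) a x.2

variable {S Θ} {a : ℝ × ℝ} {x : (V n × ℝ) × V n}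

lemma zeroAt_zero (p ζ : V n) : zeroAt S Θ a ((p, 0), ζ) = bracketZero (flowTau S Θ p) a ζ :=
  bracketZero_congr (by simp)

lemma isBracketAt_zero {p : V n} (hp : p ∈ S.dom) (ζ : V n) :
    IsBracketAt S Θ a ((p, 0), ζ) ↔ IsBracket (flowTau S Θ p) (flowTauTau S Θ p) a ζ := by
  simp [IsBracketAt, IsBracket, hp]

lemma continuous_flowTau (hr : 2 ≤ r) {p : V n} (hp : p ∈ closure S.dom) (ζ : V n) :
    Continuous (flowTau S Θ p ζ) :=
  (isQuasiPeriodic_flow (Θ := Θ) hr hp).cont₁.comp (by fun_prop : Continuous fun τ : ℝ => (ζ, τ))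

lemma IsBracketAt.zeroAt_mem (h : IsBracketAt S Θ a x) (hr : 2 ≤ r) :
    zeroAt S Θ a x ∈ Ioo a.1 a.2 ∧ flowTau S Θ x.1.1 x.2 (zeroAt S Θ a x) = x.1.2 := by
  have := h.2.bracketZero_mem
    ((continuous_flowTau (Θ := Θ) hr (subset_closure h.1) x.2).sub continuous_const)
  exact ⟨this.1, sub_eq_zero.1 this.2⟩

lemma contDiffAt_flowTau_sub (hr : 2 ≤ r) (hx : x.1.1 ∈ S.dom) (τ : ℝ) :
    ContDiffAt ℝ ((r - 1 : ℕ∞) : WithTop ℕ∞)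
      (fun y : ((V n × ℝ) × V n) × ℝ => flowTau S Θ y.1.1.1 y.1.2 y.2 - y.1.1.2) (x, τ) := by
  have h := ContDiffAt.comp (f := fun y : ((V n × ℝ) × V n) × ℝ => (y.1.1.1, y.1.2, y.2)) (x, τ)
    (contDiffAt_flowTau (Θ := Θ) hr hx x.2 τ) (by fun_prop)
  exact h.sub (by fun_prop)

lemma IsBracketAt.eventually (h : IsBracketAt S Θ a x) (hr : 3 ≤ r) :
    ∀ᶠ y in 𝓝 x, IsBracketAt S Θ a y := by
  have hr2 : 2 ≤ r := (by norm_num : (2 : ℕ∞) ≤ 3).trans hr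
  have h1 : ∀ᶠ y : (V n × ℝ) × V n in 𝓝 x, y.1.1 ∈ S.dom :=
    (by fun_prop : Continuous fun y : (V n × ℝ) × V n => y.1.1).continuousAt.eventually
      (S.isOpen_dom.mem_nhds h.1)
  refine h1.and (eventually_isBracket (T := V n × ℝ)
    (g₁ := fun t ζ τ => flowTau S Θ t.1 ζ τ - t.2) (g₂ := fun t => flowTauTau S Θ t.1) h.2
    (fun τ => (contDiffAt_flowTau_sub hr2 h.1 τ).continuousAt) fun τ => ?_)
  exact ContinuousAt.comp (f := fun y : ((V n × ℝ) × V n) × ℝ => (y.1.1.1, y.1.2, y.2))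
    (x := (x, τ)) (continuousAt_flowTauTau (Θ := Θ) hr h.1 x.2 τ) (by fun_prop)

lemma IsBracketAt.continuousAt (h : IsBracketAt S Θ a x) (hr : 3 ≤ r) :
    ContinuousAt (zeroAt S Θ a) x := by
  have hr2 : 2 ≤ r := (by norm_num : (2 : ℕ∞) ≤ 3).trans hr
  refine continuousAt_bracketZero (T := V n × ℝ)
    (g₁ := fun t ζ τ => flowTau S Θ t.1 ζ τ - t.2) (g₂ := fun t => flowTauTau S Θ t.1)
    ((h.eventually hr).mono fun y hy => hy.2) ?_
    fun τ => (contDiffAt_flowTau_sub hr2 h.1 τ).continuousAt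
  filter_upwards [h.eventually hr] with y hy τ
  exact ((isQuasiPeriodic_flow (Θ := Θ) hr2 (subset_closure hy.1)).hasDerivAt' y.2 τ).sub_const _

lemma coe_sub_one_ne_zero (hr : 2 ≤ r) : ((r - 1 : ℕ∞) : WithTop ℕ∞) ≠ 0 := by
  have : (r - 1 : ℕ∞) ≠ 0 := (tsub_pos_of_lt ((by norm_num : (1 : ℕ∞) < 2).trans_le hr)).ne'
  exact_mod_cast this

/-- The implicit function theorem for the equation `Θ̂_τ(p, ζ, τ) = z`. -/
lemma IsBracketAt.contDiffAt (h : IsBracketAt S Θ a x) (hr : 3 ≤ r) :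
    ContDiffAt ℝ ((r - 1 : ℕ∞) : WithTop ℕ∞) (zeroAt S Θ a) x := by
  have hr2 : 2 ≤ r := (by norm_num : (2 : ℕ∞) ≤ 3).trans hr
  have hr1 := coe_sub_one_ne_zero hr2
  set τ := zeroAt S Θ a x with hτ
  set f : ((V n × ℝ) × V n) × ℝ → ℝ := fun y => flowTau S Θ y.1.1.1 y.1.2 y.2 - y.1.1.2 with hf
  have hc : ContDiffAt ℝ ((r - 1 : ℕ∞) : WithTop ℕ∞) f (x, τ) := contDiffAt_flowTau_sub hr2 h.1 τ
  have h0 : f (x, τ) = 0 := sub_eq_zero.2 (h.zeroAt_mem hr2).2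
  have hd : fderiv ℝ f (x, τ) (0, 1) = flowTauTau S Θ x.1.1 x.2 τ := by
    have h1 := (hc.differentiableAt hr1).hasFDerivAt
    have h2 : HasDerivAt (fun t : ℝ => (x, t)) ((0, 1) : ((V n × ℝ) × V n) × ℝ) τ :=
      (hasDerivAt_const _ _).prodMk (hasDerivAt_id _)
    have h3 := HasFDerivAt.comp_hasDerivAt τ h1 h2
    have h4 : HasDerivAt (f ∘ Prod.mk x) (flowTauTau S Θ x.1.1 x.2 τ) τ :=
      ((isQuasiPeriodic_flow (Θ := Θ) hr2
        (subset_closure h.1)).hasDerivAt' x.2 τ).sub_const x.1.2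
    exact h3.unique h4
  have hne : fderiv ℝ f (x, τ) (0, 1) ≠ 0 := by
    rw [hd]; exact h.2.2.2.2.2 τ (Ioo_subset_Icc_self (h.zeroAt_mem hr2).1)
  have hinv : (fderiv ℝ f (x, τ) ∘L .inr ℝ ((V n × ℝ) × V n) ℝ).IsInvertible := by
    refine ⟨ContinuousLinearEquiv.unitsEquivAut ℝ (Units.mk0 _ hne), ?_⟩
    ext
    simp
  -- Continuity keeps the selected zero where the implicit solution is the only one, so the two
  -- agree near `x`.
  have h1 := hc.eventually_apply_eq_iff_implicitFunction hr1 hinv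
  have h2 : Filter.Tendsto (fun y => (y, zeroAt S Θ a y)) (𝓝 x) (𝓝 (x, τ)) :=
    continuousAt_id.prodMk (h.continuousAt hr)
  refine (hc.contDiffAt_implicitFunction hr1 hinv).congr_of_eventuallyEq ?_
  filter_upwards [h2.eventually h1, h.eventually hr] with y h3 h4
  exact (h3.1 (h0.symm ▸ sub_eq_zero.2 (h4.zeroAt_mem hr2).2)).symm

lemma IsBracketAt.exists_bound (h : IsBracketAt S Θ a x) (hr : 3 ≤ r) :
    ∃ B, ∀ᶠ y in 𝓝 x, IsBracketAt S Θ a y ∧ ‖fderiv ℝ (zeroAt S Θ a) y‖ ≤ B := by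
  have hr2 : 2 ≤ r := (by norm_num : (2 : ℕ∞) ≤ 3).trans hr
  have h1 : ContDiffAt ℝ 1 (zeroAt S Θ a) x := (h.contDiffAt hr).of_le (by
    rw [ENat.one_le_iff_ne_zero_withTop]; exact coe_sub_one_ne_zero hr2)
  have h2 := (h1.continuousAt_fderiv one_ne_zero).norm
  refine ⟨‖fderiv ℝ (zeroAt S Θ a) x‖ + 1, (h.eventually hr).and ?_⟩
  exact (h2.eventually (gt_mem_nhds (lt_add_one _))).mono fun _ h => le_of_lt h

lemma flowTau_shift (hr : 2 ≤ r) {p : V n} (hp : p ∈ closure S.dom) (ζ : V n) (τ : ℝ) (j : ℤ) :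
    flowTau S Θ p (ζ + (j : ℝ) • S.freq p) (τ + j) = flowTau S Θ p ζ τ := by
  have H := isQuasiPeriodic_flow (Θ := Θ) hr hp
  have h1 := (H.hasDerivAt (ζ + (j : ℝ) • S.freq p) (τ + j)).comp_add_const τ (j : ℝ)
  simp only [H.shift] at h1
  exact h1.unique (H.hasDerivAt ζ τ)

lemma flowTauTau_shift (hr : 2 ≤ r) {p : V n} (hp : p ∈ closure S.dom) (ζ : V n) (τ : ℝ) (j : ℤ) :
    flowTauTau S Θ p (ζ + (j : ℝ) • S.freq p) (τ + j) = flowTauTau S Θ p ζ τ := by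
  have H := isQuasiPeriodic_flow (Θ := Θ) hr hp
  have h1 := (H.hasDerivAt' (ζ + (j : ℝ) • S.freq p) (τ + j)).comp_add_const τ (j : ℝ)
  simp only [flowTau_shift hr hp] at h1
  exact h1.unique (H.hasDerivAt' ζ τ)

lemma zeroAt_periodic (hr : 2 ≤ r) {t : V n × ℝ} (ht : t.1 ∈ closure S.dom) (ζ : V n)
    (m : Fin n → ℤ) : zeroAt S Θ a (t, ζ + intVec m) = zeroAt S Θ a (t, ζ) :=
  bracketZero_congr (by simp only [(isQuasiPeriodic_flow (Θ := Θ) hr ht).periodic₁ ζ m])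

lemma isBracketAt_periodic (hr : 2 ≤ r) {t : V n × ℝ} (ζ : V n) (m : Fin n → ℤ)
    (h : IsBracketAt S Θ a (t, ζ)) : IsBracketAt S Θ a (t, ζ + intVec m) := by
  have H := isQuasiPeriodic_flow (Θ := Θ) hr (subset_closure h.1)
  refine ⟨h.1, ?_⟩
  have := h.2
  simp only [IsBracket, H.periodic₁ ζ m, H.periodic₂ ζ m] at this ⊢
  exact this

lemma fderiv_zeroAt_periodic (hr : 2 ≤ r) {t : V n × ℝ} (ht : t.1 ∈ S.dom) (ζ : V n)
    (m : Fin n → ℤ) :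
    fderiv ℝ (zeroAt S Θ a) (t, ζ + intVec m) = fderiv ℝ (zeroAt S Θ a) (t, ζ) := by
  have h : (fun y : (V n × ℝ) × V n => zeroAt S Θ a (y + (0, intVec m))) =ᶠ[𝓝 (t, ζ)]
      zeroAt S Θ a := by
    have h1 : ∀ᶠ y : (V n × ℝ) × V n in 𝓝 (t, ζ), y.1.1 ∈ S.dom :=
      (by fun_prop : Continuous fun y : (V n × ℝ) × V n => y.1.1).continuousAt.eventually
        (S.isOpen_dom.mem_nhds ht)
    filter_upwards [h1] with y hy
    have := zeroAt_periodic (a := a) (Θ := Θ) hr (subset_closure hy) y.2 m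
    simpa [Prod.add_def] using this
  have h2 := h.fderiv_eq (𝕜 := ℝ)
  rw [fderiv_comp_add_right] at h2
  simpa using h2

end Zeros

/-- Local bounds along a grid function are uniform. -/
lemma IsGrid.exists_uniform {T X : Type*} [PseudoMetricSpace T] {A : V n → X} (hA : IsGrid A)
    {t₀ : T} {Q : X → T × V n → ℝ → Prop} (hQ : ∀ a x B B', B ≤ B' → Q a x B → Q a x B')
    (h : ∀ ζ, ∀ᶠ ζ' in 𝓝 ζ, ∃ B, ∀ᶠ x in 𝓝 (t₀, ζ), Q (A ζ') x B) :
    ∃ δ : ℝ, 0 < δ ∧ ∀ ζ ∈ closedCube n, ∀ x, dist x (t₀, ζ) < δ → Q (A ζ) x (1 / δ) := by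
  -- One number δ is both the radius and, through 1/δ, the bound: every local bound falls below 1/δ
  -- for small δ, and finitely many values of `A` make this uniform.
  have key : ∀ᶠ δ : ℝ in 𝓝 0, ∀ ζ ∈ closedCube n, 0 < δ → ∀ x, dist x (t₀, ζ) < δ →
      Q (A ζ) x (1 / δ) := by
    refine isCompact_closedCube.eventually_forall_of_forall_eventually
      (P := fun δ ζ => 0 < δ → ∀ x, dist x (t₀, ζ) < δ → Q (A ζ) x (1 / δ)) fun ζ₀ _ => ?_
    have h1 : ∀ᶠ z : ℝ × V n in 𝓝 (0, ζ₀), ∀ a ∈ range A,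
        (∃ B, ∀ᶠ x in 𝓝 (t₀, ζ₀), Q a x B) → 0 < z.1 → ∀ x, dist x (t₀, z.2) < z.1 →
          Q a x (1 / z.1) := by
      rw [Filter.eventually_all_finite hA.finite]
      intro a _
      by_cases hq : ∃ B, ∀ᶠ x in 𝓝 (t₀, ζ₀), Q a x B
      · obtain ⟨B, hB⟩ := hq
        obtain ⟨ρ, hρ, hball⟩ := Metric.eventually_nhds_iff.1 hB
        have e1 : ∀ᶠ z : ℝ × V n in 𝓝 (0, ζ₀), z.1 < min (ρ / 2) (1 / (|B| + 1)) :=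
          continuousAt_fst.eventually (gt_mem_nhds (lt_min (by positivity) (by positivity)))
        have e2 : ∀ᶠ z : ℝ × V n in 𝓝 (0, ζ₀), dist z.2 ζ₀ < ρ / 2 :=
          (continuous_snd.tendsto ((0 : ℝ), ζ₀)).eventually (Metric.ball_mem_nhds ζ₀ (half_pos hρ))
        filter_upwards [e1, e2] with z h1 h2 _ hz x hx
        obtain ⟨h1, h1'⟩ := lt_min_iff.1 h1
        refine hQ a x B _ ?_ (hball ?_)
        · have : |B| + 1 < 1 / z.1 := by
            rw [lt_div_iff₀ (by positivity)] at h1'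
            rw [lt_div_iff₀ hz]
            linarith
          linarith [le_abs_self B]
        · have h3 : dist (t₀, z.2) (t₀, ζ₀) = dist z.2 ζ₀ := by
            rw [Prod.dist_eq]; simp
          linarith [dist_triangle x (t₀, z.2) (t₀, ζ₀), h1]
      · exact Filter.Eventually.of_forall fun z h' => absurd h' hq
    have h2 : ∀ᶠ z : ℝ × V n in 𝓝 (0, ζ₀), ∃ B, ∀ᶠ x in 𝓝 (t₀, ζ₀), Q (A z.2) x B :=
      (continuous_snd.tendsto ((0 : ℝ), ζ₀)).eventually (h ζ₀)
    filter_upwards [h1, h2] with z hz1 hz2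
    exact hz1 _ ⟨_, rfl⟩ hz2
  obtain ⟨ρ, hρ, hball⟩ := Metric.eventually_nhds_iff.1 key
  refine ⟨ρ / 2, half_pos hρ, fun ζ hζ => hball ?_ ζ hζ (half_pos hρ)⟩
  rw [Real.dist_eq, sub_zero, abs_of_pos (half_pos hρ)]
  exact half_lt_self hρ

section Uniform

variable {r : ℕ∞} {S : UnperturbedSystem n r} {Θ : CrSpace n r (closure S.dom)} {p : V n}

/-- The solutions chosen by a selection extend to neighbourhoods of uniform size, with uniformly
bounded derivatives. -/
lemma IsSelection.exists_uniform (hr : 3 ≤ r) (hp : p ∈ S.dom) {A : V n → ℝ × ℝ}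
    (hA : IsSelection (flowTau S Θ p) (flowTauTau S Θ p) A) :
    ∃ δ : ℝ, 0 < δ ∧ ∀ ζ, ∀ x, dist x ((p, 0), ζ) < δ →
      IsBracketAt S Θ (A ζ) x ∧ ‖fderiv ℝ (zeroAt S Θ (A ζ)) x‖ ≤ 1 / δ := by
  have hr2 : 2 ≤ r := (by norm_num : (2 : ℕ∞) ≤ 3).trans hr
  obtain ⟨δ, hδ, h⟩ := hA.1.exists_uniform (t₀ := (p, (0 : ℝ)))
    (Q := fun a x B => IsBracketAt S Θ a x ∧ ‖fderiv ℝ (zeroAt S Θ a) x‖ ≤ B)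
    (fun a x B B' hB h => ⟨h.1, h.2.trans hB⟩) fun ζ => by
      filter_upwards [hA.2 ζ] with ζ' h
      exact ((isBracketAt_zero hp ζ).2 h).exists_bound hr
  refine ⟨δ, hδ, fun ζ x hx => ?_⟩
  have h1 := h (fractVec ζ) (unitCube_subset (fractVec_mem ζ)) (x.1, x.2 + intVec (-floorVec ζ)) (by
    rw [fractVec_eq]
    rw [Prod.dist_eq] at hx ⊢
    simpa using hx)
  rw [hA.1.periodic.fractVec] at h1
  have hx1 : x.1.1 ∈ S.dom := h1.1.1
  refine ⟨?_, ?_⟩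
  · have := isBracketAt_periodic hr2 _ (floorVec ζ) h1.1
    simpa [intVec_neg] using this
  · have := h1.2
    rwa [fderiv_zeroAt_periodic hr2 hx1] at this

end Uniform

/-! ### Membership in the good set. -/

section GoodSet

variable {r : ℕ∞} {S : UnperturbedSystem n r} {Θ : CrSpace n r (closure S.dom)} {η : V n}

lemma UnperturbedSystem.exists_freq_bound (S : UnperturbedSystem n r) (hr : 2 ≤ r)
    (hη : η ∈ S.dom) : ∃ ρ : ℝ, 0 < ρ ∧ ∃ L : ℝ, 0 ≤ L ∧
      ∀ q ∈ Metric.ball η ρ, q ∈ S.dom ∧ ‖fderiv ℝ S.freq q‖ ≤ L := by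
  have h1 : ContDiffAt ℝ 1 S.freq η := (S.contDiffAt_freq (subset_closure hη)).of_le
    (by exact_mod_cast (by norm_num : (1 : ℕ∞) ≤ 2).trans hr)
  have h2 := (h1.continuousAt_fderiv one_ne_zero).norm.eventually (gt_mem_nhds (lt_add_one _))
  obtain ⟨ρ, hρ, h⟩ := Metric.eventually_nhds_iff.1 (h2.and (S.isOpen_dom.mem_nhds hη))
  exact ⟨ρ, hρ, ‖fderiv ℝ S.freq η‖ + 1, by positivity, fun q hq => ⟨(h hq).2, (h hq).1.le⟩⟩

lemma UnperturbedSystem.norm_freq_sub_le (S : UnperturbedSystem n r) (hr : 2 ≤ r) {ρ L : ℝ}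
    (h : ∀ q ∈ Metric.ball η ρ, q ∈ S.dom ∧ ‖fderiv ℝ S.freq q‖ ≤ L) {p q : V n}
    (hp : p ∈ Metric.ball η ρ) (hq : q ∈ Metric.ball η ρ) :
    ‖S.freq q - S.freq p‖ ≤ L * ‖q - p‖ := by
  refine (convex_ball η ρ).norm_image_sub_le_of_norm_fderiv_le (𝕜 := ℝ) (fun x hx => ?_)
    (fun x hx => (h x hx).2) hp hq
  refine (S.contDiffAt_freq (subset_closure (h x hx).1)).differentiableAt ?_
  have : r ≠ 0 := ((by norm_num : (0 : ℕ∞) < 2).trans_le hr).ne'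
  exact_mod_cast this

/-- The points of `nbhd` in coordinates in which the frequency shift is undone. -/
def shiftPt (S : UnperturbedSystem n r) (eps : ℝ) (N : ℤ) (w : V n × V n × ℝ) :
    (V n × ℝ) × V n :=
  ((eps • w.1, w.2.2), w.2.1 + (N : ℝ) • S.freq (eps • w.1))

section Derivatives

variable {a : ℝ × ℝ} {eps : ℝ} {N : ℤ} {w : V n × V n × ℝ} {B : ℝ}

/-- The variable ρ enters through ερ in the action and through Nν(ερ) in the angle. Both carry a
factor ε, and the second is multiplied by at most TL. -/
lemma norm_fderiv_zeroAt_fst_le (hr : 3 ≤ r) (h : IsBracketAt S Θ a (shiftPt S eps N w))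
    (hB : ‖fderiv ℝ (zeroAt S Θ a) (shiftPt S eps N w)‖ ≤ B) (heps : 0 < eps) {L T : ℝ}
    (hT : |(N : ℝ)| ≤ T) (hL : ‖fderiv ℝ S.freq (eps • w.1)‖ ≤ L) :
    ‖fderiv ℝ (fun ρ => zeroAt S Θ a (shiftPt S eps N (ρ, w.2.1, w.2.2)) - N) w.1‖
      ≤ B * (eps * (1 + T * L)) := by
  have hr2 : 2 ≤ r := (by norm_num : (2 : ℕ∞) ≤ 3).trans hr
  have hr0 : (r : WithTop ℕ∞) ≠ 0 := by
    have : r ≠ 0 := ((by norm_num : (0 : ℕ∞) < 2).trans_le hr2).ne'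
    exact_mod_cast this
  have hB0 : 0 ≤ B := (norm_nonneg _).trans hB
  have hL0 : 0 ≤ L := (norm_nonneg _).trans hL
  have hT0 : 0 ≤ T := (abs_nonneg _).trans hT
  have h1 := ((h.contDiffAt hr).differentiableAt (coe_sub_one_ne_zero hr2)).hasFDerivAt
  have h2 : HasFDerivAt S.freq (fderiv ℝ S.freq (eps • w.1)) (eps • w.1) :=
    ((S.contDiffAt_freq (subset_closure h.1)).differentiableAt hr0).hasFDerivAt
  have h3 : HasFDerivAt (fun ρ : V n => eps • ρ) (eps • ContinuousLinearMap.id ℝ (V n)) w.1 :=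
    (hasFDerivAt_id w.1).const_smul eps
  have h4 := (h2.comp w.1 h3).const_smul (N : ℝ)
  have h5 := (h3.prodMk (hasFDerivAt_const w.2.2 w.1)).prodMk (h4.const_add w.2.1)
  have h6 := (HasFDerivAt.comp (f := fun ρ => shiftPt S eps N (ρ, w.2.1, w.2.2)) w.1 h1 h5).sub_const
    (N : ℝ)
  have h7 : ‖fderiv ℝ (zeroAt S Θ a) (shiftPt S eps N w)‖ *
      ‖((eps • ContinuousLinearMap.id ℝ (V n)).prod (0 : V n →L[ℝ] ℝ)).prod
        ((N : ℝ) • (fderiv ℝ S.freq (eps • w.1)).comp (eps • ContinuousLinearMap.id ℝ (V n)))‖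
      ≤ B * (eps * (1 + T * L)) := by
    refine mul_le_mul hB (ContinuousLinearMap.opNorm_le_bound _ (by positivity) fun v => ?_)
      (norm_nonneg _) hB0
    have e1 : ‖eps • v‖ = eps * ‖v‖ := by rw [norm_smul, Real.norm_of_nonneg heps.le]
    have e2 : ‖(N : ℝ) • fderiv ℝ S.freq (eps • w.1) (eps • v)‖ ≤ T * (L * (eps * ‖v‖)) := by
      rw [norm_smul, Real.norm_eq_abs]
      refine mul_le_mul hT ?_ (norm_nonneg _) hT0
      rw [← e1]
      exact (ContinuousLinearMap.le_opNorm _ _).trans (by gcongr)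
    have e3 : 0 ≤ T * (L * (eps * ‖v‖)) := by positivity
    have e4 : 0 ≤ eps * ‖v‖ := by positivity
    refine max_le (max_le ?_ ?_) ?_
    · show ‖eps • v‖ ≤ _
      rw [e1]; linarith
    · show ‖(0 : ℝ)‖ ≤ _
      rw [norm_zero]; linarith
    · show ‖(N : ℝ) • fderiv ℝ S.freq (eps • w.1) (eps • v)‖ ≤ _
      linarith
  refine (le_of_eq ?_).trans ((ContinuousLinearMap.opNorm_comp_le _ _).trans h7)
  exact congrArg _ h6.fderiv

lemma norm_fderiv_zeroAt_snd_le (hr : 3 ≤ r) (h : IsBracketAt S Θ a (shiftPt S eps N w))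
    (hB : ‖fderiv ℝ (zeroAt S Θ a) (shiftPt S eps N w)‖ ≤ B) :
    ‖fderiv ℝ (fun ζ => zeroAt S Θ a (shiftPt S eps N (w.1, ζ, w.2.2)) - N) w.2.1‖ ≤ B := by
  have hr2 : 2 ≤ r := (by norm_num : (2 : ℕ∞) ≤ 3).trans hr
  have hB0 : 0 ≤ B := (norm_nonneg _).trans hB
  have h1 := ((h.contDiffAt hr).differentiableAt (coe_sub_one_ne_zero hr2)).hasFDerivAt
  have h5 := (hasFDerivAt_const (eps • w.1, w.2.2) w.2.1).prodMk
    ((hasFDerivAt_id (𝕜 := ℝ) w.2.1).add_const ((N : ℝ) • S.freq (eps • w.1)))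
  have h6 := (HasFDerivAt.comp (f := fun ζ => shiftPt S eps N (w.1, ζ, w.2.2)) w.2.1 h1 h5).sub_const
    (N : ℝ)
  refine (congrArg _ h6.fderiv).le.trans (ContinuousLinearMap.opNorm_le_bound _ hB0 fun v => ?_)
  refine (ContinuousLinearMap.le_of_opNorm_le _ hB _).trans (mul_le_mul_of_nonneg_left ?_ hB0)
  refine max_le ?_ le_rfl
  show ‖(0 : V n × ℝ)‖ ≤ _
  rw [norm_zero]; exact norm_nonneg _

lemma abs_deriv_zeroAt_le (hr : 3 ≤ r) (h : IsBracketAt S Θ a (shiftPt S eps N w))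
    (hB : ‖fderiv ℝ (zeroAt S Θ a) (shiftPt S eps N w)‖ ≤ B) :
    |deriv (fun z => zeroAt S Θ a (shiftPt S eps N (w.1, w.2.1, z)) - N) w.2.2| ≤ B := by
  have hr2 : 2 ≤ r := (by norm_num : (2 : ℕ∞) ≤ 3).trans hr
  have h1 := ((h.contDiffAt hr).differentiableAt (coe_sub_one_ne_zero hr2)).hasFDerivAt
  have h5 : HasDerivAt (fun z => shiftPt S eps N (w.1, w.2.1, z)) (((0, 1), 0) : (V n × ℝ) × V n)
      w.2.2 :=
    ((hasDerivAt_const w.2.2 (eps • w.1)).prodMk (hasDerivAt_id w.2.2)).prodMk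
      (hasDerivAt_const w.2.2 (w.2.1 + (N : ℝ) • S.freq (eps • w.1)))
  have h6 := (HasFDerivAt.comp_hasDerivAt w.2.2 h1 h5).sub_const (N : ℝ)
  refine (congrArg _ h6.deriv).le.trans ?_
  rw [← Real.norm_eq_abs]
  refine (ContinuousLinearMap.le_of_opNorm_le _ hB _).trans ?_
  simp [Prod.norm_def]

lemma contDiffAt_shiftPt (hw : eps • w.1 ∈ S.dom) :
    ContDiffAt ℝ ((r - 1 : ℕ∞) : WithTop ℕ∞) (shiftPt S eps N) w := by
  have h1 : ContDiffAt ℝ ((r - 1 : ℕ∞) : WithTop ℕ∞) S.freq (eps • w.1) :=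
    (S.contDiffAt_freq (subset_closure hw)).of_le (WithTop.coe_le_coe.2 tsub_le_self)
  have h2 : ContDiffAt ℝ ((r - 1 : ℕ∞) : WithTop ℕ∞) (fun w : V n × V n × ℝ => S.freq (eps • w.1)) w :=
    ContDiffAt.comp (f := fun w : V n × V n × ℝ => eps • w.1) w h1 (by fun_prop)
  unfold shiftPt
  fun_prop

end Derivatives

/-- A bracketed zero whose continuation is controlled lies in the good set. -/
lemma mem_J (hr : 3 ≤ r) {a : ℝ × ℝ} {ζ : V n} {δ : ℝ} (hδ : 0 < δ)
    (hU : ∀ x, dist x ((η, 0), ζ) < δ →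
      IsBracketAt S Θ a x ∧ ‖fderiv ℝ (zeroAt S Θ a) x‖ ≤ 1 / δ)
    {ρ L T : ℝ} (hL0 : 0 ≤ L)
    (hL : ∀ q ∈ Metric.ball η ρ, q ∈ S.dom ∧ ‖fderiv ℝ S.freq q‖ ≤ L) (hT : a.2 ≤ T)
    {eps c₁ c₂ : ℝ} (heps : 0 < eps) (heps1 : eps < 1) (hc₁ : 0 < c₁) (hc₂ : 0 < c₂) {p : V n}
    (h1 : ‖p - η‖ + c₁ < ρ) (h2 : ‖p - η‖ + c₁ < δ) (h3 : c₁ * (1 + T * L) < δ)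
    (h4 : c₂ * (1 + T * L) < δ) :
    (p, ζ - zeroAt S Θ a ((p, 0), ζ) • S.freq p, Int.fract (zeroAt S Θ a ((p, 0), ζ))) ∈
      J S Θ.1 eps c₁ c₂ := by
  have hr2 : 2 ≤ r := (by norm_num : (2 : ℕ∞) ≤ 3).trans hr
  have hpρ : p ∈ Metric.ball η ρ := by rw [mem_ball_iff_norm]; linarith
  have hp : p ∈ S.dom := (hL p hpρ).1
  have hpc := subset_closure hp
  have hb : IsBracketAt S Θ a ((p, 0), ζ) := (hU _ (by
    rw [Prod.dist_eq, Prod.dist_eq]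
    simp only [dist_self, dist_eq_norm p η]
    rw [max_eq_left (norm_nonneg _), max_eq_left (norm_nonneg _)]
    linarith)).1
  obtain ⟨hsmem, hs0⟩ := hb.zeroAt_mem hr2
  set s := zeroAt S Θ a ((p, 0), ζ) with hs
  -- The set 𝒥₀ requires |τ| < 1, so s is replaced by its fractional part and ζ by ζ - Nν(p). For
  -- neighbouring actions the frequency in this shift varies; `shiftPt` undoes the shift, at the
  -- cost of the factor 1 + TL.
  set N : ℤ := ⌊s⌋ with hN
  have ha0 : 0 < a.1 := hb.2.1
  have ha1 : a.2 < a.1 + 1 := hb.2.2.2.1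
  have hs_pos : 0 < s := ha0.trans hsmem.1
  have hN0 : (0 : ℝ) ≤ N := by exact_mod_cast Int.floor_nonneg.2 hs_pos.le
  have hNs : (N : ℝ) ≤ s := Int.floor_le s
  have hsN : s < N + 1 := Int.lt_floor_add_one s
  have hT0 : 0 ≤ T := by linarith [hsmem.2]
  have hNT : |(N : ℝ)| ≤ T := by rw [abs_of_nonneg hN0]; linarith [hsmem.2]
  have hTL : 0 ≤ T * L := mul_nonneg hT0 hL0
  have hfr : Int.fract s + N = s := Int.fract_add_floor s
  have hpp : eps • eps⁻¹ • p = p := smul_inv_smul₀ heps.ne' p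
  have hζ : ζ - (N : ℝ) • S.freq p - Int.fract s • S.freq p = ζ - s • S.freq p := by
    rw [sub_sub, ← add_smul, Int.floor_add_fract]
  have hζ' : ζ - (N : ℝ) • S.freq p + (N : ℝ) • S.freq p = ζ := sub_add_cancel _ _
  have hJ₀ : (p, ζ - s • S.freq p, Int.fract s) ∈ J₀ S Θ.1 := by
    rw [← hζ, mem_J₀_iff hr2 hpc, ← flowTau_shift hr2 hpc _ _ N, ← flowTauTau_shift hr2 hpc _ _ N,
      hζ', hfr]
    exact ⟨hs0, hb.2.2.2.2.2 s (Ioo_subset_Icc_self hsmem)⟩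
  -- This comparison bounds the action displacement inside `nbhd` by c₁, and makes a ρ-derivative of
  -- order ε fit the allowance ε^{3/4}.
  have heps34 : eps ≤ eps ^ (3 / 4 : ℝ) := by
    conv_lhs => rw [← Real.rpow_one eps]
    exact Real.rpow_le_rpow_of_exponent_ge heps heps1.le (by norm_num)
  have key : ∀ w ∈ nbhd S eps c₁ (eps⁻¹ • p) (ζ - (N : ℝ) • S.freq p),
      dist (shiftPt S eps N w) ((η, 0), ζ) < δ ∧ eps • w.1 ∈ Metric.ball η ρ := by
    rintro ⟨ρ', ζ', z⟩ ⟨-, hw1, hw2, hw3⟩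
    dsimp only at hw1 hw2 hw3
    have k1 : ‖eps • ρ' - p‖ < c₁ := by
      have : eps • ρ' - p = eps • (ρ' - eps⁻¹ • p) := by rw [smul_sub, hpp]
      rw [this, norm_smul, Real.norm_of_nonneg heps.le]
      exact (mul_le_mul_of_nonneg_right heps34 (norm_nonneg _)).trans_lt hw1
    have k2 : ‖eps • ρ' - η‖ < ‖p - η‖ + c₁ := by
      have : eps • ρ' - η = (eps • ρ' - p) + (p - η) := by abel
      rw [this]
      linarith [norm_add_le (eps • ρ' - p) (p - η)]
    have k3 : eps • ρ' ∈ Metric.ball η ρ := by rw [mem_ball_iff_norm]; linarith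
    refine ⟨?_, k3⟩
    have k4 : ‖ζ' + (N : ℝ) • S.freq (eps • ρ') - ζ‖ < δ := by
      have : ζ' + (N : ℝ) • S.freq (eps • ρ') - ζ = (ζ' - (ζ - (N : ℝ) • S.freq p)) +
          (N : ℝ) • (S.freq (eps • ρ') - S.freq p) := by module
      rw [this]
      have k5 : ‖(N : ℝ) • (S.freq (eps • ρ') - S.freq p)‖ ≤ T * (L * c₁) := by
        rw [norm_smul, Real.norm_eq_abs]
        refine mul_le_mul hNT ?_ (norm_nonneg _) hT0
        exact (S.norm_freq_sub_le hr2 hL hpρ k3).trans (by gcongr)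
      linarith [norm_add_le (ζ' - (ζ - (N : ℝ) • S.freq p))
        ((N : ℝ) • (S.freq (eps • ρ') - S.freq p))]
    refine max_lt (max_lt ?_ ?_) ?_
    · show dist (eps • ρ') η < δ
      rw [dist_eq_norm]; linarith
    · show dist z 0 < δ
      rw [Real.dist_eq, sub_zero]; linarith [norm_nonneg (p - η)]
    · show dist (ζ' + (N : ℝ) • S.freq (eps • ρ')) ζ < δ
      rw [dist_eq_norm]; exact k4
  refine ⟨hJ₀, (eps⁻¹ • p, ζ - (N : ℝ) • S.freq p, Int.fract s), ⟨⟨?_, ?_, Int.fract_lt_one s⟩,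
    fun w => zeroAt S Θ a (shiftPt S eps N w) - N, ?_, ?_, ?_⟩, 0, 0, ?_⟩
  · show (eps • eps⁻¹ • p, ζ - (N : ℝ) • S.freq p - Int.fract s • S.freq (eps • eps⁻¹ • p),
      Int.fract s) ∈ J₀ S Θ.1
    rw [hpp, hζ]; exact hJ₀
  · show -1 < Int.fract s
    linarith [Int.fract_nonneg s]
  · intro w hw
    obtain ⟨k1, k2⟩ := key w hw
    have h5 := ((hU _ k1).1.contDiffAt hr).comp w (contDiffAt_shiftPt (hL _ k2).1)
    exact (h5.sub contDiffAt_const).contDiffWithinAt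
  · show zeroAt S Θ a ((eps • eps⁻¹ • p, 0), ζ - (N : ℝ) • S.freq p +
      (N : ℝ) • S.freq (eps • eps⁻¹ • p)) - N = Int.fract s
    rw [hpp, hζ', ← hs]; exact Int.self_sub_floor s
  · intro w hw
    obtain ⟨k1, k2⟩ := key w hw
    have hdom := (hL _ k2).1
    obtain ⟨k3, k4⟩ := hU _ k1
    obtain ⟨k5, k6⟩ := k3.zeroAt_mem hr2
    set σ := zeroAt S Θ a (shiftPt S eps N w) with hσ
    have hδ2 : (1 + T * L) / δ < 1 / c₂ := by
      rw [div_lt_div_iff₀ hδ hc₂]; linarith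
    have hδ1 : 1 / δ < 1 / c₂ := by
      refine lt_of_le_of_lt ?_ hδ2
      gcongr; linarith
    refine ⟨?_, ?_, ?_, ?_, ?_⟩
    · rw [hatTau_eq hr2 (subset_closure hdom), ← flowTau_shift hr2 (subset_closure hdom) _ _ N]
      have : σ - N + N = σ := by ring
      rw [this]; exact k6
    -- σ and s lie in one positive bracket of length less than 1, and 0 ≤ s - N < 1.
    · rw [abs_lt]
      have := hsmem.1
      have := hsmem.2
      constructor <;> linarith [k5.1, k5.2]
    · have hnhds : {ρ : V n | eps • ρ ∈ closure S.dom} ∈ 𝓝 w.1 := by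
        have : ContinuousAt (fun ρ : V n => eps • ρ) w.1 := by fun_prop
        exact (this.eventually (S.isOpen_dom.mem_nhds hdom)).mono fun _ h => subset_closure h
      rw [fderivWithin_of_mem_nhds hnhds]
      refine (norm_fderiv_zeroAt_fst_le hr k3 k4 heps hNT (hL _ k2).2).trans_lt ?_
      have e1 : 1 / δ * (eps * (1 + T * L)) = eps * ((1 + T * L) / δ) := by ring
      have e2 : eps ^ (3 / 4 : ℝ) / c₂ = eps ^ (3 / 4 : ℝ) * (1 / c₂) := by ring
      rw [e1, e2]
      exact mul_lt_mul_of_le_of_lt_of_pos_of_nonneg heps34 hδ2 heps (by positivity)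
    · exact (norm_fderiv_zeroAt_snd_le hr k3 k4).trans_lt hδ1
    · exact (abs_deriv_zeroAt_le hr k3 k4).trans_lt hδ1
  · show (eps • eps⁻¹ • p, ζ - (N : ℝ) • S.freq p - Int.fract s • S.freq (eps • eps⁻¹ • p),
      Int.fract s) = (p, ζ - s • S.freq p + intVec 0, Int.fract s + ((0 : ℤ) : ℝ))
    rw [hpp, hζ, intVec_zero, add_zero, Int.cast_zero, add_zero]

end GoodSet

/-! ### Good sections over actions near the resonance. -/

section Sections

variable {r : ℕ∞} {S : UnperturbedSystem n r} {η : V n}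

lemma UnperturbedSystem.lam_pos (S : UnperturbedSystem n r) {p : V n} (hp : p ∈ closure S.dom) :
    0 < S.lam p :=
  mul_pos (abs_pos.2 (S.hyperbolic p hp)) (Real.sqrt_pos.2 (neg_pos.2 S.saddle))

lemma UnperturbedSystem.continuousAt_lam (S : UnperturbedSystem n r) (hη : η ∈ S.dom) :
    ContinuousAt S.lam η := by
  have hF : ∀ p ∈ S.dom, ContDiffAt ℝ 1 S.F (p, S.f 0) := fun p hp =>
    (S.contDiffAt_F p (subset_closure hp) 0 S.zero_mem_D).of_le le_add_self
  have h1 : ContinuousAt (fun p : V n => fderiv ℝ S.F (p, S.f 0) (0, 1)) η :=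
    (ContinuousAt.comp (f := fun p : V n => (p, S.f 0)) (x := η)
      ((hF η hη).continuousAt_fderiv one_ne_zero) (by fun_prop)).clm_apply continuousAt_const
  have h2 : ∀ᶠ p in 𝓝 η, fderiv ℝ S.F (p, S.f 0) (0, 1) = deriv (fun h => S.F (p, h)) (S.f 0) := by
    filter_upwards [S.isOpen_dom.mem_nhds hη] with p hp
    have h3 := ((hF p hp).differentiableAt one_ne_zero).hasFDerivAt
    have h4 : HasDerivAt (fun h : ℝ => (p, h)) ((0, 1) : V n × ℝ) (S.f 0) :=
      (hasDerivAt_const _ _).prodMk (hasDerivAt_id _)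
    exact (HasFDerivAt.comp_hasDerivAt (S.f 0) h3 h4).deriv.symm
  exact (h1.congr h2).abs.mul continuousAt_const

variable (S) in
/-- There is a function on the torus whose graph over `p` lies in the good set and along which the
average of the gradient of the potential is close to `v`. -/
def HasGoodSection (Θ : CrSpace n r (closure S.dom)) (eps c' c'' acc : ℝ) (p v : V n) : Prop :=
  ∃ s : V n → ℝ, (∀ (ζ : V n) (m : Fin n → ℤ), s (ζ + intVec m) = s ζ) ∧
    (∀ ζ, s ζ ∈ Icc (0 : ℝ) (Real.sqrt ((|Real.log eps| / 10) / S.lam p))) ∧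
    (∀ ζ, (p, ζ - s ζ • S.freq p, Int.fract (s ζ)) ∈ J S Θ.1 eps (2 * c') (2 * c'')) ∧
    (∃ 𝓜 : Set (Set (V n)), 𝓜.Finite ∧ (∀ N ∈ 𝓜, IsTorusHypersurface N) ∧
      breakPoints r s ⊆ ⋃₀ 𝓜) ∧
    IntegrableOn (fun ζ => hatZeta S Θ.1 p ζ (s ζ)) (unitCube n) ∧
    ‖(∫ ζ in unitCube n, hatZeta S Θ.1 p ζ (s ζ)) - v‖ < acc

variable {Θ : CrSpace n r (closure S.dom)}

lemma HasGoodSection.mono {eps c' c'' acc acc' : ℝ} {p v v' : V n}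
    (h : HasGoodSection S Θ eps c' c'' acc p v) (hv : ‖v - v'‖ + acc ≤ acc') :
    HasGoodSection S Θ eps c' c'' acc' p v' := by
  obtain ⟨s, h1, h2, h3, h4, h5, h6⟩ := h
  refine ⟨s, h1, h2, h3, h4, h5, ?_⟩
  linarith [norm_sub_le_norm_sub_add_norm_sub (∫ ζ in unitCube n, hatZeta S Θ.1 p ζ (s ζ)) v v']

variable {A : V n → ℝ × ℝ}

/-- The bracket `A ζ'` is valid on a ball about ((η, 0), ζ'), hence at (p, ζ) whenever ζ' is close
to ζ, which is the form `IsSelection` demands. -/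
lemma isSelection_of_uniform {δ : ℝ} (hA : IsGrid A)
    (hU : ∀ ζ, ∀ x, dist x ((η, (0 : ℝ)), ζ) < δ → IsBracketAt S Θ (A ζ) x) {p : V n}
    (hp : ‖p - η‖ < δ) : IsSelection (flowTau S Θ p) (flowTauTau S Θ p) A := by
  refine ⟨hA, fun ζ => ?_⟩
  have hδ : 0 < δ := (norm_nonneg _).trans_lt hp
  filter_upwards [Metric.ball_mem_nhds ζ hδ] with ζ' hζ'
  have h := hU ζ' ((p, 0), ζ) (by
    refine max_lt (max_lt ?_ ?_) ?_
    · rwa [← dist_eq_norm] at hp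
    · simpa using hδ
    · rwa [dist_comm])
  exact (isBracketAt_zero h.1 ζ).1 h

lemma IsGrid.exists_snd_le (hA : IsGrid A) : ∃ T : ℝ, 0 ≤ T ∧ ∀ ζ, (A ζ).2 ≤ T := by
  obtain ⟨T, hT⟩ := (hA.finite.image Prod.snd).bddAbove
  exact ⟨max T 0, le_max_right _ _, fun ζ =>
    (hT ⟨A ζ, ⟨ζ, rfl⟩, rfl⟩).trans (le_max_left _ _)⟩

/-- The average along a selection depends continuously on the action variable. -/
lemma IsSelection.tendsto_integral (hr : 3 ≤ r) (hη : η ∈ S.dom)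
    (hA : IsSelection (flowTau S Θ η) (flowTauTau S Θ η) A) :
    Filter.Tendsto (fun p => ∫ ζ in unitCube n, selGrad (flowTau S Θ p) (flowZeta S Θ p) A ζ) (𝓝 η)
      (𝓝 (∫ ζ in unitCube n, selGrad (flowTau S Θ η) (flowZeta S Θ η) A ζ)) := by
  have hr2 : 2 ≤ r := (by norm_num : (2 : ℕ∞) ≤ 3).trans hr
  obtain ⟨δ, hδ, hU⟩ := hA.exists_uniform hr hη
  obtain ⟨T, hT0, hT⟩ := hA.1.exists_snd_le
  obtain ⟨M, -, hM, -⟩ := (isQuasiPeriodic_flow (Θ := Θ) hr2 (subset_closure hη)).exists_lipschitz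
  have hnear : ∀ᶠ p in 𝓝 η, p ∈ S.dom ∧ IsSelection (flowTau S Θ p) (flowTauTau S Θ p) A := by
    filter_upwards [S.isOpen_dom.mem_nhds hη, Metric.ball_mem_nhds η hδ] with p h1 h2
    exact ⟨h1, isSelection_of_uniform hA.1 (fun ζ x hx => (hU ζ x hx).1) (mem_ball_iff_norm.1 h2)⟩
  have hbound : ∀ᶠ p in 𝓝 η, ∀ z ∈ closedCube n ×ˢ Icc (0 : ℝ) T, ‖flowZeta S Θ p z.1 z.2‖ < M + 1 :=
    (isCompact_closedCube.prod isCompact_Icc).eventually_forall_of_forall_eventually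
      (P := fun p (z : V n × ℝ) => ‖flowZeta S Θ p z.1 z.2‖ < M + 1) fun z _ =>
        (continuousAt_flowZeta (Θ := Θ) hr2 hη z.1 z.2).norm.eventually
          (gt_mem_nhds ((hM z.1 z.2).trans_lt (lt_add_one M)))
  refine tendsto_integral_filter_of_dominated_convergence (fun _ => M + 1) ?_ ?_
    (integrable_const _) ?_
  · filter_upwards [hnear] with p hp
    exact ((isQuasiPeriodic_flow (Θ := Θ) hr2
      (subset_closure hp.1)).aestronglyMeasurable_selGrad hp.2).restrict
  · filter_upwards [hnear, hbound] with p hp hb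
    filter_upwards [ae_restrict_mem measurableSet_unitCube] with ζ hζ
    have h1 := hp.2.isBracket ζ
    have h2 := h1.bracketZero_mem (continuous_flowTau (Θ := Θ) hr2 (subset_closure hp.1) ζ)
    exact (hb (ζ, bracketZero (flowTau S Θ p) (A ζ) ζ) ⟨unitCube_subset hζ,
      (h1.1.trans h2.1.1).le, h2.1.2.le.trans (hT ζ)⟩).le
  · refine Filter.Eventually.of_forall fun ζ => ?_
    have h1 := ((isBracketAt_zero hη ζ).2 (hA.isBracket ζ)).continuousAt hr
    have h2 : ContinuousAt (fun p => (p, ζ, zeroAt S Θ (A ζ) ((p, 0), ζ))) η :=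
      continuousAt_id.prodMk (continuousAt_const.prodMk
        (ContinuousAt.comp (f := fun p : V n => ((p, (0 : ℝ)), ζ)) (x := η) h1 (by fun_prop)))
    have h3 := ContinuousAt.comp (f := fun p => (p, ζ, zeroAt S Θ (A ζ) ((p, 0), ζ))) (x := η)
      (continuousAt_flowZeta (Θ := Θ) hr2 hη ζ _) h2
    simpa only [ContinuousAt, Function.comp_def, zeroAt_zero, selGrad] using h3

/-- The function given by a selection at `η` is a good section over all points close to `η`. -/
theorem IsSelection.exists_hasGoodSection (hr : 3 ≤ r) (hη : η ∈ S.dom)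
    (hA : IsSelection (flowTau S Θ η) (flowTauTau S Θ η) A) {acc C : ℝ} {v : V n} (hC : 0 < C)
    (hv : ‖(∫ ζ in unitCube n, selGrad (flowTau S Θ η) (flowZeta S Θ η) A ζ) - v‖ < acc) :
    ∃ κ : ℝ, 0 < κ ∧ ∀ eps c' c'' : ℝ, 0 < eps → eps < κ → 0 < c' → c' < κ → 0 < c'' → c'' < κ →
      ∀ p : V n, ‖p - η‖ ≤ C / |Real.log eps| → HasGoodSection S Θ eps c' c'' acc p v := by
  have hr2 : 2 ≤ r := (by norm_num : (2 : ℕ∞) ≤ 3).trans hr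
  obtain ⟨δ, hδ, hU⟩ := hA.exists_uniform hr hη
  obtain ⟨T, hT0, hT⟩ := hA.1.exists_snd_le
  obtain ⟨ρ, hρ, L, hL0, hL⟩ := S.exists_freq_bound hr2 hη
  have hTL : 0 ≤ T * L := mul_nonneg hT0 hL0
  set Λ := S.lam η + 1 with hΛ
  have hΛ0 : 0 < Λ := by linarith [S.lam_pos (subset_closure hη)]
  have e1 : ∀ᶠ p in 𝓝 η, S.lam p < Λ :=
    (S.continuousAt_lam hη).eventually (gt_mem_nhds (lt_add_one _))
  have e2 : ∀ᶠ p in 𝓝 η,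
      ‖(∫ ζ in unitCube n, selGrad (flowTau S Θ p) (flowZeta S Θ p) A ζ) - v‖ < acc :=
    ((hA.tendsto_integral hr hη).sub_const v).norm.eventually (gt_mem_nhds hv)
  obtain ⟨d₀, hd₀, hnear⟩ := Metric.eventually_nhds_iff.1 (e1.and e2)
  set m := min ρ δ with hm
  have hm0 : 0 < m := lt_min hρ hδ
  set d := min d₀ (m / 2) with hd
  have hd0 : 0 < d := lt_min hd₀ (half_pos hm0)
  -- |log ε| > C/d brings p within distance d of η, and |log ε| > 10ΛT² gives T² ≤ (|log
  -- ε|/10)/λ(p), so all selected zeros lie in the allowed range.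
  set R := max (C / d) (10 * (Λ * T ^ 2)) with hR
  have hR0 : 0 < R := (div_pos hC hd0).trans_le (le_max_left _ _)
  -- The first bound means |log ε| > R; the second gives 2c(1 + TL) < m/2 for c = c' and c = c'',
  -- the other half of m being left for the distance from p to η.
  refine ⟨min (Real.exp (-R)) (m / (4 * (1 + T * L))),
    lt_min (Real.exp_pos _) (by positivity), ?_⟩
  intro eps c' c'' heps heps' hc' hc'κ hc'' hc''κ p hp
  have heps1 : eps < 1 :=
    (heps'.trans_le (min_le_left _ _)).trans_le (Real.exp_le_one_iff.2 (by linarith))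
  have hlog : R < |Real.log eps| := by
    have : Real.log eps < -R := (Real.log_lt_iff_lt_exp heps).2 (heps'.trans_le (min_le_left _ _))
    rw [abs_of_neg (by linarith)]; linarith
  have hpd : ‖p - η‖ < d := by
    refine hp.trans_lt ?_
    rw [div_lt_iff₀ (hR0.trans hlog)]
    have := (le_max_left _ _).trans_lt hlog
    rw [div_lt_iff₀ hd0] at this
    linarith
  have hpm : ‖p - η‖ < m / 2 := hpd.trans_le (min_le_right _ _)
  have hmρ : m ≤ ρ := min_le_left _ _
  have hmδ : m ≤ δ := min_le_right _ _
  have small : ∀ c, 0 < c → c < min (Real.exp (-R)) (m / (4 * (1 + T * L))) →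
      2 * c * (1 + T * L) < m / 2 := by
    intro c _ hc
    have := hc.trans_le (min_le_right _ _)
    rw [lt_div_iff₀ (by positivity)] at this
    linarith
  have hc1 := small c' hc' hc'κ
  have hc2 := small c'' hc'' hc''κ
  have hc3 : 2 * c' < m / 2 := by
    have : 0 ≤ 2 * c' * (T * L) := by positivity
    linarith
  obtain ⟨hlam, hint⟩ := hnear (y := p) (by
    rw [dist_eq_norm]; exact hpd.trans_le (min_le_left _ _))
  have hpdom : p ∈ S.dom := (hL p (by rw [mem_ball_iff_norm]; linarith)).1
  have hsel := isSelection_of_uniform hA.1 (fun ζ x hx => (hU ζ x hx).1) (p := p) (by linarith)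
  have hb : ∀ ζ, IsBracketAt S Θ (A ζ) ((p, 0), ζ) := fun ζ =>
    (isBracketAt_zero hpdom ζ).2 (hsel.isBracket ζ)
  have hgrad : (fun ζ => hatZeta S Θ.1 p ζ (zeroAt S Θ (A ζ) ((p, 0), ζ))) =
      selGrad (flowTau S Θ p) (flowZeta S Θ p) A := by
    funext ζ
    rw [hatZeta_eq hr2 (subset_closure hpdom), zeroAt_zero]; rfl
  refine ⟨fun ζ => zeroAt S Θ (A ζ) ((p, 0), ζ), ?_, ?_, ?_, ?_, ?_, ?_⟩
  · intro ζ k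
    simp only [hA.1.periodic ζ k]
    exact zeroAt_periodic hr2 (subset_closure hpdom) ζ k
  · intro ζ
    have h1 := ((hb ζ).zeroAt_mem hr2).1
    have h2 : 0 < (A ζ).1 := (hb ζ).2.1
    refine ⟨(h2.trans h1.1).le, (h1.2.le.trans (hT ζ)).trans (Real.le_sqrt_of_sq_le ?_)⟩
    have h3 := S.lam_pos (subset_closure hpdom)
    rw [le_div_iff₀ h3]
    have h4 : T ^ 2 * S.lam p ≤ T ^ 2 * Λ := by gcongr
    have h5 := (le_max_right _ _).trans_lt hlog
    linarith
  · intro ζ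
    exact mem_J hr hδ (hU ζ) hL0 hL (hT ζ) heps heps1 (by positivity) (by positivity)
      (by linarith) (by linarith) (by linarith) (by linarith)
  · obtain ⟨N, hN, hN'⟩ := hA.1.locConst
    refine ⟨range fun i : Fin n => {ζ : V n | ∃ j : ℤ, (N : ℝ) * ζ i = j}, finite_range _, ?_, ?_⟩
    · rintro _ ⟨i, rfl⟩
      exact gridPlane_isTorusHypersurface hN i
    · rw [sUnion_range, ← gridPlanes_eq]
      intro ζ hζ
      by_contra hgrid
      refine hζ ?_
      have h1 : ContDiffAt ℝ ((r - 1 : ℕ∞) : WithTop ℕ∞)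
          (fun ζ' => zeroAt S Θ (A ζ) ((p, 0), ζ')) ζ :=
        ContDiffAt.comp (f := fun ζ' : V n => ((p, (0 : ℝ)), ζ')) ζ ((hb ζ).contDiffAt hr)
          (by fun_prop)
      refine h1.congr_of_eventuallyEq ?_
      filter_upwards [hN' ζ hgrid] with ζ' h
      rw [h]
  · rw [hgrad]
    exact (isQuasiPeriodic_flow (Θ := Θ) hr2 (subset_closure hpdom)).integrableOn_selGrad hsel
  · rw [hgrad]; exact hint

/-- A section for β with accuracy acc/2 serves all directions near β with accuracy acc; compactness
of the sphere makes κ independent of β. -/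
theorem exists_hasGoodSection (hr : 3 ≤ r) (hn : 0 < n) (hη : η ∈ S.dom)
    (hgood : GoodAt (S.freq η) fun x => Θ.1 (η, x)) :
    ∃ lam : ℝ, 0 < lam ∧ ∀ acc : ℝ, 0 < acc → ∀ C : ℝ, 0 < C → ∃ κ : ℝ, 0 < κ ∧
      ∀ eps c' c'' : ℝ, 0 < eps → eps < κ → 0 < c' → c' < κ → 0 < c'' → c'' < κ →
      ∀ p : V n, ‖p - η‖ ≤ C / |Real.log eps| → ∀ β : V n, ‖β‖ = 1 →
      HasGoodSection S Θ eps c' c'' acc p (lam • β) := by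
  have hr2 : 2 ≤ r := (by norm_num : (2 : ℕ∞) ≤ 3).trans hr
  obtain ⟨lam, hlam, h⟩ := (isQuasiPeriodic_flow (Θ := Θ) hr2 (subset_closure hη)).exists_average
    ⟨0, hn⟩ hgood
  refine ⟨lam, hlam, fun acc hacc C hC => ?_⟩
  have key : ∀ᶠ κ : ℝ in 𝓝 0, ∀ β ∈ Metric.sphere (0 : V n) 1, ∀ eps c' c'' : ℝ, 0 < eps → eps < κ →
      0 < c' → c' < κ → 0 < c'' → c'' < κ → ∀ p : V n, ‖p - η‖ ≤ C / |Real.log eps| →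
      HasGoodSection S Θ eps c' c'' acc p (lam • β) := by
    refine (isCompact_sphere (0 : V n) 1).eventually_forall_of_forall_eventually
      (P := fun κ β => ∀ eps c' c'' : ℝ, 0 < eps → eps < κ →
        0 < c' → c' < κ → 0 < c'' → c'' < κ → ∀ p : V n, ‖p - η‖ ≤ C / |Real.log eps| →
        HasGoodSection S Θ eps c' c'' acc p (lam • β)) fun β hβ => ?_
    obtain ⟨A, hA, hAβ⟩ := h β (by simpa using hβ) (acc / 2) (half_pos hacc)
    obtain ⟨κ, hκ, H⟩ := hA.exists_hasGoodSection hr hη hC hAβ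
    have e1 : ∀ᶠ z : ℝ × V n in 𝓝 (0, β), z.1 < κ :=
      (continuous_fst.tendsto ((0 : ℝ), β)).eventually (gt_mem_nhds hκ)
    have e2 : ∀ᶠ z : ℝ × V n in 𝓝 (0, β), ‖lam • β - lam • z.2‖ < acc / 2 := by
      have : Continuous fun z : ℝ × V n => ‖lam • β - lam • z.2‖ := by fun_prop
      exact (this.tendsto _).eventually (gt_mem_nhds (by simpa using half_pos hacc))
    filter_upwards [e1, e2] with z h1 h2 eps c' c'' k1 k2 k3 k4 k5 k6 p hp
    exact (H eps c' c'' k1 (k2.trans h1) k3 (k4.trans h1) k5 (k6.trans h1) p hp).mono (by linarith)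
  obtain ⟨ρ, hρ, hball⟩ := Metric.eventually_nhds_iff.1 key
  refine ⟨ρ / 2, half_pos hρ, fun eps c' c'' k1 k2 k3 k4 k5 k6 p hp β hβ => ?_⟩
  refine hball (y := ρ / 2) ?_ β (by simpa using hβ) eps c' c'' k1 k2 k3 k4 k5 k6 p hp
  rw [Real.dist_eq, sub_zero, abs_of_pos (half_pos hρ)]
  exact half_lt_self hρ

end Sections

end SeparatrixMap

end

theorem mainTheorem4 (n : ℕ) (hn : 2 ≤ n) (r : ℕ∞) (hr : ((n + 3 : ℕ) : ℕ∞) < r)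
    (S : SeparatrixMap.UnperturbedSystem n r)
    -- the resonance `k` and the point `η_*` on it, which is not a multiple resonance
    (k : (Fin n → ℤ) × ℤ) (hk : k ≠ 0)
    (ηstar : SeparatrixMap.V n) (hηstar : ηstar ∈ S.dom) (hres : S.Resonant ηstar k)
    (hsimple : ∀ l : (Fin n → ℤ) × ℤ, S.Resonant ηstar l → ¬ LinearIndependent ℤ ![k, l]) :
    ∃ X : Set (SeparatrixMap.CrSpace n r (closure S.dom)), SeparatrixMap.IsTypical X ∧
      ∀ Θ ∈ X, ∃ lamΘ : ℝ, 0 < lamΘ ∧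
        -- the accuracy `ϵ`, and the constant in the radius `C / |log ε|` of the ball around `η_*`
        ∀ acc : ℝ, 0 < acc → ∀ C : ℝ, 0 < C →
          ∃ κ : ℝ, 0 < κ ∧ ∀ eps c' c'' : ℝ, 0 < eps → eps < κ → 0 < c' → c' < κ →
            0 < c'' → c'' < κ →
          ∀ p : SeparatrixMap.V n, ‖p - ηstar‖ ≤ C / |Real.log eps| →
          ∀ β : SeparatrixMap.V n, ‖β‖ = 1 →
          ∃ s : SeparatrixMap.V n → ℝ,
            -- `s` is a function on the torus with values in `[0, (K̄/λ)^{1/2}]`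
            (∀ (ζ : SeparatrixMap.V n) (m : Fin n → ℤ),
              s (ζ + SeparatrixMap.intVec m) = s ζ) ∧
            (∀ ζ, s ζ ∈ Set.Icc (0 : ℝ) (Real.sqrt ((|Real.log eps| / 10) / S.lam p))) ∧
            -- 1) the graph lies in the good set
            (∀ ζ, (p, ζ - s ζ • S.freq p, Int.fract (s ζ)) ∈
              SeparatrixMap.J S Θ.1 eps (2 * c') (2 * c'')) ∧
            -- 2) the break points
            (∃ 𝓜 : Set (Set (SeparatrixMap.V n)), 𝓜.Finite ∧
              (∀ N ∈ 𝓜, SeparatrixMap.IsTorusHypersurface N) ∧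
              SeparatrixMap.breakPoints r s ⊆ ⋃₀ 𝓜) ∧
            -- 3) the average
            MeasureTheory.IntegrableOn
              (fun ζ => SeparatrixMap.hatZeta S Θ.1 p ζ (s ζ)) (SeparatrixMap.unitCube n) ∧
            ‖(∫ ζ in SeparatrixMap.unitCube n, SeparatrixMap.hatZeta S Θ.1 p ζ (s ζ))
              - lamΘ • β‖ < acc := by
  have hr3 : 3 ≤ r :=
    (by exact_mod_cast Nat.le_add_left 3 n : (3 : ℕ∞) ≤ ((n + 3 : ℕ) : ℕ∞)).trans hr.le
  exact ⟨_, SeparatrixMap.isTypical_goodAt hr3 (S.freq_not_integer hn hk hsimple) S.isOpen_dom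
    hηstar, fun Θ hΘ => SeparatrixMap.exists_hasGoodSection hr3 (by omega) hηstar hΘ⟩
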